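/- **Setting.** Let $(X,d)$ be a geodesic metric space and $\mathfrak m$ a Borel measure on $X$ with $\operatorname{supp}\mathfrak m=X$ and $\mathfrak m(B_r(x))<c_1e^{c_2r^2}$ for all $r>0$, for some $c_1,c_2\ge 0$ and some $x\in X$. Write $M=(X,d,\mathfrak m)$. A function $f\in L^2(\mathfrak m)$ belongs to $W^{1,2}(M)$ if there are Lipschitz functions $f_n\in L^2(\mathfrak m)$ with $f_n\to f$ and $\operatorname{lip}f_n\to G$ in $L^2(\mathfrak m)$ for some $G$, where $\operatorname{lip}f_n$ is the local Lipschitz constant; $|Df|$ is the a.e. minimal such $G$. Assume that $M$ is infinitesimally Hilbertian, i.e. that the norm $(\|f\|_{L^2}^2+\||Df|\|_{L^2}^2)^{1/2}$ of $W^{1,2}(M)$ satisfies the parallelogram law. The cotangent module $L^2(T^*M)$ is the completion of the set of families $\{(B_i,f_i)\}_{i\in\mathbb N}$ ($\{B_i\}$ a Borel partition of $X$, $f_i\in W^{1,2}(M)$, $\sum_i\int_{B_i}|Df_i|^2\,d\mathfrak m<\infty$), where families $\{(A_i,f_i)\}$ and $\{(B_j,g_j)\}$ are identified if $|D(f_i-g_j)|=0$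 a.e. on $A_i\cap B_j$, with pointwise norm $|[(B_i,f_i)]|=\sum_i\chi_{B_i}|Df_i|$ and norm $\||\cdot|\|_{L^2}$; $\mathrm df=[(X,f)]$; the pointwise inner product is $\langle\omega,\eta\rangle=\frac14(|\omega+\eta|^2-|\omega-\eta|^2)$. The tangent module is $L^2(TM)=\mathrm{Hom}_{L^\infty(\mathfrak m)}(L^2(T^*M),L^1(\mathfrak m))$. By the Riesz theorem, $\omega\mapsto\langle\omega,\cdot\rangle$ is a bijection $L^2(T^*M)\to L^2(TM)$; $\nabla f$ is the image of $\mathrm df$, and $L^2(TM)$ carries the pointwise inner product transported from $L^2(T^*M)$. Let $w,v$ be bounded continuous functions on $X$ and $M'=(X,e^wd,e^v\mathfrak m)$, where $(e^wd)(x,y)=\inf_\gamma\int_0^1|\dot\gamma_t|e^{w(\gamma_t)}\,dt$ over the absolutely continuous curves $\gamma:[0,1]\to X$ from $x$ to $y$. Objects of $M'$ carry a prime. **Proposition (conformally transformed gradient).** $W^{1,2}(M)=W^{1,2}(M')$ as sets, $M'$ is infinitesimally Hilbertian, and the Riesz correspondence between cotangent and tangent module holds for both $M$ and $M'$. There is a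 unique isomorphism of topological vector spaces $L^2(T^*M)\cong L^2(T^*M')$ that is $L^\infty$-linear and maps $\mathrm df$ to $\mathrm d'f$ for all $f\in W^{1,2}(M)$, and it induces a unique isomorphism of topological vector spaces $L^2(TM)\cong L^2(TM')$ (by $V'(\omega')=V(\omega)$ a.e. whenever $\omega'$ corresponds to $\omega$). Under these identifications $$\nabla' f=e^{-2w}\,\nabla f\qquad\text{for every } f\in W^{1,2}(M),$$ $$\langle V,W\rangle_{M'}=e^{2w}\,\langle V,W\rangle\quad\mathfrak m\text{-a.e., for all } V,W\in L^2(TM).$$ -/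

import Mathlib

open MeasureTheory Filter Topology Set
open scoped ENNReal NNReal BoundedContinuousFunction

noncomputable section

set_option linter.unusedSectionVars false

/-- A metric space is geodesic if any two points are joined by a constant speed curve whose
length is their distance. -/
class GeodesicSpace (X : Type*) [MetricSpace X] : Prop where
  exists_geodesic : ∀ x y : X, ∃ γ : ℝ → X, γ 0 = x ∧ γ 1 = y ∧
    ∀ s ∈ Icc (0 : ℝ) 1, ∀ t ∈ Icc (0 : ℝ) 1, dist (γ s) (γ t) = |s - t| * dist x y

section Conformal

variable {X : Type*} [MetricSpace X]

/-- The metric derivative `|γ̇_t|` of a curve (the limit exists at almost every `t` if `γ` is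
absolutely continuous). -/
def metricSpeed (γ : ℝ → X) (t : ℝ) : ℝ≥0∞ :=
  limsup (fun s => edist (γ s) (γ t) / edist s t) (𝓝[≠] t)

/-- The weighted length `∫₀¹ |γ̇_t| e^{w(γ_t)} dt`. -/
def conformalLength (w : X →ᵇ ℝ) (γ : ℝ → X) : ℝ≥0∞ :=
  ∫⁻ t in Icc (0 : ℝ) 1, metricSpeed γ t * ENNReal.ofReal (Real.exp (w (γ t)))

/-- The weighted distance `e^w d`: the infimum of the weighted lengths of absolutely continuous
curves `[0,1] → X` from `x` to `y`. -/
def conformalEDist (w : X →ᵇ ℝ) (x y : X) : ℝ≥0∞ :=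
  ⨅ (γ : ℝ → X) (_ : AbsolutelyContinuousOnInterval γ 0 1 ∧ γ 0 = x ∧ γ 1 = y),
    conformalLength w γ

theorem metricSpeed_comp_affine {γ η : ℝ → X} {c e t : ℝ} (hc : c ≠ 0)
    (h : ∀ᶠ s in 𝓝 t, η s = γ (c * s + e)) :
    metricSpeed η t = ENNReal.ofReal |c| * metricSpeed γ (c * t + e) := by
  unfold metricSpeed
  have hA : map (fun s => c * s + e) (𝓝[≠] t) = 𝓝[≠] (c * t + e) := by
    let A : ℝ ≃ₜ ℝ := (Homeomorph.mulLeft₀ c hc).trans (Homeomorph.addRight e)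
    exact A.map_punctured_nhds_eq t
  rw [← hA, ← ENNReal.limsup_const_mul_of_ne_top ENNReal.ofReal_ne_top]
  rw [limsup, limsup, map_map] 
  refine limsup_congr (f := 𝓝[≠] t) ?_
  have h' : ∀ᶠ s in 𝓝[≠] t, η s = γ (c * s + e) := h.filter_mono nhdsWithin_le_nhds
  filter_upwards [h', self_mem_nhdsWithin] with s hs hst
  have hst : s ≠ t := hst
  have h0 : ENNReal.ofReal |c| ≠ 0 := by simpa using hc
  have e1 : edist (c * s + e) (c * t + e) = ENNReal.ofReal |c| * edist s t := by
    rw [edist_dist, edist_dist, ← ENNReal.ofReal_mul (abs_nonneg _), Real.dist_eq, Real.dist_eq,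
      ← abs_mul]
    ring_nf
  simp only [Function.comp]
  rw [hs, h.self_of_nhds, e1, ← mul_div_assoc, ENNReal.mul_div_mul_left _ _ h0 ENNReal.ofReal_ne_top]

theorem absolutelyContinuous_comp_aux {γ η : ℝ → X} {φ : ℝ → ℝ} {K : ℝ}
    (hγ : AbsolutelyContinuousOnInterval γ 0 1)
    (hφ : Monotone φ ∨ Antitone φ) (hK : 0 < K)
    (hLip : ∀ s t, dist (φ s) (φ t) ≤ K * dist s t)
    (hmaps : ∀ t ∈ Icc (0 : ℝ) 1, φ t ∈ Icc (0 : ℝ) 1)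
    (h : ∀ t ∈ Icc (0 : ℝ) 1, η t = γ (φ t)) : AbsolutelyContinuousOnInterval η 0 1 := by
  rw [absolutelyContinuousOnInterval_iff] at hγ ⊢
  intro ε hε
  obtain ⟨δ, hδ, H⟩ := hγ ε hε
  refine ⟨δ / K, by positivity, fun E hE hlen => ?_⟩
  have hE' : ∀ i ∈ Finset.range E.1, (E.2 i).1 ∈ Icc (0 : ℝ) 1 ∧ (E.2 i).2 ∈ Icc (0 : ℝ) 1 := by
    have := hE.1
    rwa [uIcc_of_le zero_le_one] at this
  have := H (E.1, fun i => (φ (E.2 i).1, φ (E.2 i).2)) ⟨?_, ?_⟩ ?_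
  · refine lt_of_eq_of_lt (Finset.sum_congr rfl fun i hi => ?_) this
    rw [h _ (hE' i hi).1, h _ (hE' i hi).2]
  · intro i hi
    rw [uIcc_of_le zero_le_one]
    exact ⟨hmaps _ (hE' i hi).1, hmaps _ (hE' i hi).2⟩
  · intro i hi j hj hij
    have := hE.2 hi hj hij
    simp only [Function.onFun, uIoc, Ioc_disjoint_Ioc] at this ⊢
    rcases hφ with hφ | hφ
    · simp only [← hφ.map_min, ← hφ.map_max]
      exact hφ this
    · simp only [← hφ.map_min, ← hφ.map_max]
      exact hφ this
  · calc _ ≤ ∑ i ∈ Finset.range E.1, K * dist (E.2 i).1 (E.2 i).2 :=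
          Finset.sum_le_sum fun i _ => hLip _ _
      _ = K * ∑ i ∈ Finset.range E.1, dist (E.2 i).1 (E.2 i).2 := (Finset.mul_sum _ _ _).symm
      _ < K * (δ / K) := by gcongr
      _ = δ := by field_simp

/-- Concatenation of two curves on `[0,1]`. -/
def concatCurve (γ₁ γ₂ : ℝ → X) (t : ℝ) : X := if t ≤ 1 / 2 then γ₁ (2 * t) else γ₂ (2 * t - 1)

theorem absolutelyContinuous_concatCurve {γ₁ γ₂ : ℝ → X}
    (h₁ : AbsolutelyContinuousOnInterval γ₁ 0 1) (h₂ : AbsolutelyContinuousOnInterval γ₂ 0 1)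
    (h : γ₁ 1 = γ₂ 0) : AbsolutelyContinuousOnInterval (concatCurve γ₁ γ₂) 0 1 := by
  have h₁' : AbsolutelyContinuousOnInterval (fun t => γ₁ (min (2 * t) 1)) 0 1 :=
    absolutelyContinuous_comp_aux h₁ (φ := fun t => min (2 * t) 1) (K := 2)
      (Or.inl fun a b hab => by dsimp only; gcongr) (by norm_num)
      (fun s t => by
        simp only [Real.dist_eq]
        refine (abs_min_sub_min_le_max _ _ _ _).trans ?_
        rw [← mul_sub, abs_mul]; simp)
      (fun t ht => ⟨le_min (by linarith [ht.1]) zero_le_one, min_le_right _ _⟩) (fun _ _ => rfl)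
  have h₂' : AbsolutelyContinuousOnInterval (fun t => γ₂ (max (2 * t - 1) 0)) 0 1 :=
    absolutelyContinuous_comp_aux h₂ (φ := fun t => max (2 * t - 1) 0) (K := 2)
      (Or.inl fun a b hab => by dsimp only; gcongr) (by norm_num)
      (fun s t => by
        simp only [Real.dist_eq]
        refine (abs_max_sub_max_le_max _ _ _ _).trans ?_
        rw [sub_sub_sub_cancel_right, ← mul_sub, abs_mul]; simp)
      (fun t ht => ⟨le_max_right _ _, max_le (by linarith [ht.2]) zero_le_one⟩) (fun _ _ => rfl)
  have hsum : Tendsto _ _ _ := Tendsto.add h₁' h₂'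
  rw [add_zero] at hsum
  refine squeeze_zero (fun E => Finset.sum_nonneg fun _ _ => dist_nonneg) (fun E => ?_) hsum
  rw [← Finset.sum_add_distrib]
  refine Finset.sum_le_sum fun i _ => ?_
  generalize (E.2 i).1 = a
  generalize (E.2 i).2 = b
  beta_reduce
  by_cases ha : a ≤ 1 / 2 <;> by_cases hb : b ≤ 1 / 2
  · rw [concatCurve, concatCurve, if_pos ha, if_pos hb, min_eq_left (by linarith),
      min_eq_left (by linarith)]
    exact le_add_of_nonneg_right dist_nonneg
  · rw [concatCurve, concatCurve, if_pos ha, if_neg hb, min_eq_left (by linarith),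
      min_eq_right (by linarith), max_eq_right (by linarith), max_eq_left (by linarith), h]
    exact dist_triangle _ _ _
  · rw [concatCurve, concatCurve, if_neg ha, if_pos hb, min_eq_right (by linarith),
      min_eq_left (by linarith), max_eq_left (by linarith), max_eq_right (by linarith), h, add_comm]
    exact dist_triangle _ _ _
  · rw [concatCurve, concatCurve, if_neg ha, if_neg hb, max_eq_left (by linarith),
      max_eq_left (by linarith)]
    exact le_add_of_nonneg_left dist_nonneg

theorem lintegral_conformal_affine (w : X →ᵇ ℝ) {γ η : ℝ → X} {c e : ℝ} (hc : c ≠ 0)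
    {s : Set ℝ} (hs : IsOpen s) (h : ∀ t ∈ s, η t = γ (c * t + e)) :
    ∫⁻ t in s, metricSpeed η t * ENNReal.ofReal (Real.exp (w (η t))) =
      ∫⁻ t in (fun t => c * t + e) '' s,
        metricSpeed γ t * ENNReal.ofReal (Real.exp (w (γ t))) := by
  rw [lintegral_image_eq_lintegral_abs_deriv_mul hs.measurableSet (f' := fun _ => c)]
  · refine setLIntegral_congr_fun hs.measurableSet fun t ht => ?_
    rw [metricSpeed_comp_affine hc (by filter_upwards [hs.mem_nhds ht] with r hr using h r hr),
      h t ht, mul_assoc]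
  · intro t _
    simpa using (((hasDerivAt_id t).const_mul c).add_const e).hasDerivWithinAt
  · intro a _ b _ hab
    simpa [hc] using hab

theorem conformalLength_eq_Ioo (w : X →ᵇ ℝ) (γ : ℝ → X) :
    conformalLength w γ =
      ∫⁻ t in Ioo (0 : ℝ) 1, metricSpeed γ t * ENNReal.ofReal (Real.exp (w (γ t))) :=
  setLIntegral_congr Ioo_ae_eq_Icc.symm

theorem conformalLength_concatCurve (w : X →ᵇ ℝ) (γ₁ γ₂ : ℝ → X) :
    conformalLength w (concatCurve γ₁ γ₂) = conformalLength w γ₁ + conformalLength w γ₂ := by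
  have e1 := lintegral_conformal_affine w (γ := γ₁) (η := concatCurve γ₁ γ₂) (c := 2) (e := 0)
    two_ne_zero (s := Ioo 0 (1 / 2)) isOpen_Ioo
    (fun t ht => by rw [concatCurve, if_pos ht.2.le, add_zero])
  have e2 := lintegral_conformal_affine w (γ := γ₂) (η := concatCurve γ₁ γ₂) (c := 2) (e := -1)
    two_ne_zero (s := Ioo (1 / 2) 1) isOpen_Ioo
    (fun t ht => by rw [concatCurve, if_neg (not_le.2 ht.1), sub_eq_add_neg])
  have i1 : (fun t : ℝ => 2 * t + 0) '' Ioo 0 (1 / 2) = Ioo 0 1 := by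
    ext t; constructor
    · rintro ⟨s, hs, rfl⟩; exact ⟨by linarith [hs.1], by linarith [hs.2]⟩
    · intro ht; exact ⟨t / 2, ⟨by linarith [ht.1], by linarith [ht.2]⟩, by ring⟩
  have i2 : (fun t : ℝ => 2 * t + -1) '' Ioo (1 / 2) 1 = Ioo 0 1 := by
    ext t; constructor
    · rintro ⟨s, hs, rfl⟩; exact ⟨by linarith [hs.1], by linarith [hs.2]⟩
    · intro ht; exact ⟨(t + 1) / 2, ⟨by linarith [ht.1], by linarith [ht.2]⟩, by ring⟩
  rw [i1, ← conformalLength_eq_Ioo] at e1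
  rw [i2, ← conformalLength_eq_Ioo] at e2
  rw [← e1, ← e2, ← lintegral_union measurableSet_Ioo
    (Set.disjoint_left.2 fun t h h' => lt_asymm h.2 h'.1), conformalLength]
  refine setLIntegral_congr ?_
  have : (Icc (0 : ℝ) 1) =ᵐ[volume] (Ioo 0 (1 / 2) ∪ Ioo (1 / 2) 1 : Set ℝ) := by
    have a1 : Ioo (0 : ℝ) (1 / 2) =ᵐ[volume] Icc 0 (1 / 2) := Ioo_ae_eq_Icc
    have a2 : Ioo (1 / 2 : ℝ) 1 =ᵐ[volume] Icc (1 / 2) 1 := Ioo_ae_eq_Icc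
    have := a1.union a2
    rw [Icc_union_Icc_eq_Icc (by norm_num) (by norm_num)] at this
    exact this.symm
  exact this

theorem edist_le_lintegral_metricSpeed {γ : ℝ → X} (hγ : AbsolutelyContinuousOnInterval γ 0 1) :
    edist (γ 0) (γ 1) ≤ ∫⁻ t in Icc (0 : ℝ) 1, metricSpeed γ t := by
  set φ : ℝ → ℝ := fun t => dist (γ t) (γ 0) with hφ
  have hφd : ∀ s t, dist (φ s) (φ t) ≤ dist (γ s) (γ t) := fun s t => by
    rw [Real.dist_eq]; exact abs_dist_sub_le _ _ _
  have hac : AbsolutelyContinuousOnInterval φ 0 1 :=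
    squeeze_zero (fun E => Finset.sum_nonneg fun _ _ => dist_nonneg)
      (fun E => Finset.sum_le_sum fun i _ => hφd _ _) hγ
  have hpt : ∀ t, ‖deriv φ t‖ₑ ≤ metricSpeed γ t := by
    intro t
    by_cases hd : DifferentiableAt ℝ φ t
    · have h1 : Tendsto (fun s => ‖slope φ t s‖ₑ) (𝓝[≠] t) (𝓝 ‖deriv φ t‖ₑ) :=
        (continuous_enorm.tendsto _).comp (hasDerivAt_iff_tendsto_slope.1 hd.hasDerivAt)
      rw [← h1.limsup_eq]
      refine limsup_le_limsup ?_
      filter_upwards [self_mem_nhdsWithin] with s hs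
      have hs : s ≠ t := hs
      rw [slope_def_field, Real.enorm_eq_ofReal_abs, abs_div, ENNReal.ofReal_div_of_pos
        (abs_pos.2 (sub_ne_zero.2 hs)), edist_dist, edist_dist, ← Real.dist_eq, ← Real.dist_eq]
      gcongr
      exact hφd _ _
    · simp [deriv_zero_of_not_differentiableAt hd]
  have hft := hac.integral_deriv_eq_sub
  have h1 : edist (γ 0) (γ 1) = ‖∫ t in (0 : ℝ)..1, deriv φ t‖ₑ := by
    rw [hft, hφ]; simp [edist_dist, dist_comm, Real.enorm_eq_ofReal_abs]
  rw [h1, intervalIntegral.integral_of_le zero_le_one]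
  refine (enorm_integral_le_lintegral_enorm _).trans ?_
  rw [setLIntegral_congr Ioc_ae_eq_Icc]
  exact lintegral_mono hpt

theorem exp_neg_mul_edist_le_conformalEDist (w : X →ᵇ ℝ) (x y : X) :
    ENNReal.ofReal (Real.exp (-‖w‖)) * edist x y ≤ conformalEDist w x y := by
  refine le_iInf₂ fun γ hγ => ?_
  obtain ⟨hγ, rfl, rfl⟩ := hγ
  calc _ ≤ ENNReal.ofReal (Real.exp (-‖w‖)) * ∫⁻ t in Icc (0 : ℝ) 1, metricSpeed γ t := by
        gcongr; exact edist_le_lintegral_metricSpeed hγ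
    _ = ∫⁻ t in Icc (0 : ℝ) 1, ENNReal.ofReal (Real.exp (-‖w‖)) * metricSpeed γ t :=
        (lintegral_const_mul' _ _ ENNReal.ofReal_ne_top).symm
    _ ≤ _ := by
        refine lintegral_mono fun t => ?_
        rw [mul_comm]
        gcongr
        exact (abs_le.1 (w.norm_coe_le_norm (γ t))).1

theorem conformalEDist_le_exp_mul_edist [GeodesicSpace X] (w : X →ᵇ ℝ) (x y : X) :
    conformalEDist w x y ≤ ENNReal.ofReal (Real.exp ‖w‖) * edist x y := by
  obtain ⟨γ, h0, h1, hγ⟩ := GeodesicSpace.exists_geodesic x y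
  have hac : AbsolutelyContinuousOnInterval γ 0 1 := by
    refine LipschitzOnWith.absolutelyContinuousOnInterval (K := nndist x y) ?_
    rw [uIcc_of_le zero_le_one]
    refine LipschitzOnWith.of_dist_le_mul fun s hs t ht => ?_
    rw [hγ s hs t ht, Real.dist_eq, mul_comm, coe_nndist]
  refine (iInf₂_le γ ⟨hac, h0, h1⟩).trans ?_
  rw [conformalLength_eq_Ioo]
  calc _ ≤ ∫⁻ t in Ioo (0 : ℝ) 1, edist x y * ENNReal.ofReal (Real.exp ‖w‖) := by
        refine setLIntegral_mono' measurableSet_Ioo fun t ht => ?_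
        gcongr
        · refine limsup_le_of_le (h := ?_)
          filter_upwards [self_mem_nhdsWithin,
            nhdsWithin_le_nhds (Icc_mem_nhds ht.1 ht.2)] with s hs hs'
          rw [edist_dist, hγ s hs' t ⟨ht.1.le, ht.2.le⟩, ENNReal.ofReal_mul (abs_nonneg _),
            ← Real.dist_eq, ← edist_dist, ← edist_dist, mul_comm, mul_div_assoc]
          exact mul_le_of_le_one_right' ENNReal.div_self_le_one
        · exact (abs_le.1 (w.norm_coe_le_norm (γ t))).2
    _ = _ := by simp [mul_comm]

theorem conformalEDist_comm_le (w : X →ᵇ ℝ) (x y : X) :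
    conformalEDist w x y ≤ conformalEDist w y x := by
  refine le_iInf₂ fun γ hγ => ?_
  have hac : AbsolutelyContinuousOnInterval (fun t => γ (-1 * t + 1)) 0 1 := by
    refine absolutelyContinuous_comp_aux hγ.1 (φ := fun t => -1 * t + 1) (K := 1)
      (Or.inr fun a b hab => by dsimp only; linarith) one_pos (fun s t => ?_)
      (fun t ht => ⟨by linarith [ht.2], by linarith [ht.1]⟩) (fun _ _ => rfl)
    rw [Real.dist_eq, Real.dist_eq, one_mul, abs_sub_comm s t]
    exact le_of_eq (by ring_nf)
  refine (iInf₂_le (fun t => γ (-1 * t + 1)) ⟨hac, by simpa using hγ.2.2,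
    by simpa using hγ.2.1⟩).trans (le_of_eq ?_)
  · have := lintegral_conformal_affine w (γ := γ) (η := fun t => γ (-1 * t + 1)) (c := -1)
      (e := 1) (by norm_num) (s := Ioo 0 1) isOpen_Ioo (fun t _ => rfl)
    rw [conformalLength_eq_Ioo, this, conformalLength_eq_Ioo]
    congr 2
    ext t; constructor
    · rintro ⟨s, hs, rfl⟩; exact ⟨by linarith [hs.2], by linarith [hs.1]⟩
    · intro ht; exact ⟨1 - t, ⟨by linarith [ht.2], by linarith [ht.1]⟩, by ring⟩

theorem conformalEDist_triangle (w : X →ᵇ ℝ) (x y z : X) :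
    conformalEDist w x z ≤ conformalEDist w x y + conformalEDist w y z := by
  refine ENNReal.le_of_forall_pos_le_add fun ε hε hfin => ?_
  have hε' : (ε / 2 : ℝ≥0∞) ≠ 0 := by simpa using hε.ne'
  have h1 := ENNReal.lt_add_right (ne_top_of_le_ne_top hfin.ne le_self_add) hε'
  have h2 := ENNReal.lt_add_right (ne_top_of_le_ne_top hfin.ne le_add_self) hε'
  obtain ⟨γ₁, h1⟩ := iInf_lt_iff.1 h1
  obtain ⟨⟨a1, b1, c1⟩, l1⟩ := iInf_lt_iff.1 h1
  obtain ⟨γ₂, h2⟩ := iInf_lt_iff.1 h2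
  obtain ⟨⟨a2, b2, c2⟩, l2⟩ := iInf_lt_iff.1 h2
  calc _ ≤ conformalLength w (concatCurve γ₁ γ₂) :=
        iInf₂_le _ ⟨absolutelyContinuous_concatCurve a1 a2 (c1.trans b2.symm),
          by simp [concatCurve, b1], by norm_num [concatCurve, c2]⟩
    _ ≤ (conformalEDist w x y + ε / 2) + (conformalEDist w y z + ε / 2) := by
        rw [conformalLength_concatCurve]; exact add_le_add l1.le l2.le
    _ = _ := by rw [add_add_add_comm, ENNReal.add_halves]

/-- The set `X` with the weighted distance `e^w d`. -/
def ConformalSpace (_w : X →ᵇ ℝ) : Type _ := X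

/-- The identity map from `X` to `(X, e^w d)`. -/
def toConformal (w : X →ᵇ ℝ) : X ≃ ConformalSpace w := Equiv.refl X

instance ConformalSpace.metricSpace [GeodesicSpace X] (w : X →ᵇ ℝ) :
    MetricSpace (ConformalSpace w) :=
  letI : EMetricSpace (ConformalSpace w) :=
    { edist := fun x y => conformalEDist w ((toConformal w).symm x) ((toConformal w).symm y)
      edist_self := fun x => le_antisymm ((conformalEDist_le_exp_mul_edist w _ _).trans (by simp))
        zero_le
      edist_comm := fun x y => le_antisymm (conformalEDist_comm_le w _ _)
        (conformalEDist_comm_le w _ _)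
      edist_triangle := fun x y z => conformalEDist_triangle w _ _ _
      eq_of_edist_eq_zero := fun {x y} h => by
        have h' := exp_neg_mul_edist_le_conformalEDist w ((toConformal w).symm x)
          ((toConformal w).symm y)
        rw [h, nonpos_iff_eq_zero, mul_eq_zero] at h'
        rcases h' with h' | h'
        · exact absurd (ENNReal.ofReal_eq_zero.1 h') (not_le.2 (Real.exp_pos _))
        · exact (toConformal w).symm.injective (edist_eq_zero.1 h') }
  EMetricSpace.toMetricSpace fun x y =>
    ne_top_of_le_ne_top (ENNReal.mul_ne_top ENNReal.ofReal_ne_top (edist_ne_top _ _))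
      (conformalEDist_le_exp_mul_edist w _ _)

theorem ConformalSpace.edist_eq [GeodesicSpace X] (w : X →ᵇ ℝ) (x y : X) :
    edist (toConformal w x) (toConformal w y) = conformalEDist w x y := rfl

instance ConformalSpace.measurableSpace [MeasurableSpace X] (w : X →ᵇ ℝ) :
    MeasurableSpace (ConformalSpace w) := inferInstanceAs (MeasurableSpace X)

theorem continuous_toConformal [GeodesicSpace X] (w : X →ᵇ ℝ) :
    Continuous (toConformal w) := by
  have : LipschitzWith (Real.exp ‖w‖).toNNReal (toConformal w) := fun x y => by
    rw [ConformalSpace.edist_eq]; exact conformalEDist_le_exp_mul_edist w x y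
  exact this.continuous

theorem continuous_toConformal_symm [GeodesicSpace X] (w : X →ᵇ ℝ) :
    Continuous (toConformal w).symm := by
  have : AntilipschitzWith (Real.exp ‖w‖).toNNReal (toConformal w) := fun x y => by
    rw [ConformalSpace.edist_eq]
    refine le_trans (le_of_eq ?_) (mul_le_mul_right
      (exp_neg_mul_edist_le_conformalEDist w x y) (ENNReal.ofReal (Real.exp ‖w‖)))
    rw [← mul_assoc, ← ENNReal.ofReal_mul (Real.exp_pos _).le, ← Real.exp_add]
    simp
  exact (this.to_rightInverse (toConformal w).right_inv).continuous

instance ConformalSpace.borelSpace [MeasurableSpace X] [BorelSpace X] [GeodesicSpace X]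
    (w : X →ᵇ ℝ) : BorelSpace (ConformalSpace w) := by
  let e : X ≃ₜ ConformalSpace w :=
    ⟨toConformal w, continuous_toConformal w, continuous_toConformal_symm w⟩
  refine ⟨?_⟩
  have h := e.symm.isInducing.eq_induced
  calc (ConformalSpace.measurableSpace w : MeasurableSpace (ConformalSpace w))
      = MeasurableSpace.comap (toConformal w).symm (borel X) := by
        rw [← BorelSpace.measurable_eq (α := X)]; exact MeasurableSpace.comap_id.symm
    _ = borel (ConformalSpace w) := by
        rw [h]; exact (borel_comap (f := (toConformal w).symm)).symm

/-- The weighted measure `e^v m`, on the space with the weighted distance. -/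
def conformalMeasure [MeasurableSpace X] (w v : X →ᵇ ℝ) (m : Measure X) :
    Measure (ConformalSpace w) :=
  (m.withDensity fun x => ENNReal.ofReal (Real.exp (v x))).map (toConformal w)

end Conformal

/-- Truncation at level `N`. -/
def clampReal {Y : Type*} (N : ℝ) (f : Y → ℝ) (x : Y) : ℝ := max (-N) (min N (f x))

theorem abs_clampReal_sub_le {Y : Type*} (N : ℝ) (f : Y → ℝ) (x y : Y) :
    |clampReal N f y - clampReal N f x| ≤ |f y - f x| := by
  unfold clampReal
  refine (abs_max_sub_max_le_max _ _ _ _).trans ?_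
  simp only [sub_self, abs_zero, abs_nonneg, sup_of_le_right]
  refine (abs_min_sub_min_le_max _ _ _ _).trans ?_
  simp

section Sobolev

variable {X : Type*} [MetricSpace X]

/-- The local Lipschitz constant `lip f (x) = limsup_{y → x} |f y - f x| / d (x, y)`; it is `0` at an
isolated point, where the limsup is over the trivial filter. -/
def localLip (f : X → ℝ) (x : X) : ℝ≥0∞ :=
  limsup (fun y => edist (f y) (f x) / edist y x) (𝓝[≠] x)

/-- The local Lipschitz constant as a real number; used for Lipschitz functions, for which it is
finite. -/
def lipReal (f : X → ℝ) (x : X) : ℝ := (localLip f x).toReal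

/-- `f` is Lipschitz. -/
def IsLip (f : X → ℝ) : Prop := ∃ K : ℝ≥0, LipschitzWith K f

theorem IsLip.localLip_ne_top {f : X → ℝ} (hf : IsLip f) (x : X) : localLip f x ≠ ∞ := by
  obtain ⟨K, hK⟩ := hf
  refine ne_top_of_le_ne_top (ENNReal.coe_ne_top (r := K)) (limsup_le_of_le (h := ?_))
  filter_upwards with y
  exact ENNReal.div_le_of_le_mul (hK y x)

theorem lipReal_nonneg (f : X → ℝ) (x : X) : 0 ≤ lipReal f x := ENNReal.toReal_nonneg

theorem IsLip.eventually_le {f : X → ℝ} (hf : IsLip f) {x : X} {c : ℝ} (hc : lipReal f x < c) :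
    ∀ᶠ y in 𝓝 x, |f y - f x| ≤ c * dist y x := by
  have h1 : localLip f x < ENNReal.ofReal c :=
    (ENNReal.lt_ofReal_iff_toReal_lt (hf.localLip_ne_top x)).2 hc
  have h2 := eventually_lt_of_limsup_lt h1
  rw [eventually_nhdsWithin_iff] at h2
  have hc0 : 0 ≤ c := (lipReal_nonneg f x).trans hc.le
  filter_upwards [h2] with y hy
  by_cases hyx : y = x
  · simp [hyx]
  · have h3 := (ENNReal.div_le_iff (by simpa using hyx) (edist_ne_top _ _)).1 (hy hyx).le
    rw [edist_dist, edist_dist, ← ENNReal.ofReal_mul hc0,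
      ENNReal.ofReal_le_ofReal_iff (by positivity), Real.dist_eq] at h3
    exact h3

theorem lipReal_le {f : X → ℝ} {x : X} {a : ℝ} (ha : 0 ≤ a)
    (h : ∀ c > a, ∀ᶠ y in 𝓝 x, |f y - f x| ≤ c * dist y x) : lipReal f x ≤ a := by
  refine ENNReal.toReal_le_of_le_ofReal ha ?_
  refine le_of_forall_gt fun b hb => ?_
  obtain ⟨c, hac, hcb⟩ := ENNReal.lt_iff_exists_nnreal_btwn.1 hb
  have hac' : a < c := by
    rw [ENNReal.ofReal, ENNReal.coe_lt_coe] at hac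
    exact Real.toNNReal_lt_iff_lt_coe ha |>.1 hac
  refine lt_of_le_of_lt (limsup_le_of_le (h := ?_)) hcb
  filter_upwards [nhdsWithin_le_nhds (h c hac')] with y hy
  refine ENNReal.div_le_of_le_mul ?_
  rw [edist_dist, edist_dist, ← ENNReal.ofReal_coe_nnreal, ← ENNReal.ofReal_mul c.coe_nonneg,
    Real.dist_eq]
  exact ENNReal.ofReal_le_ofReal hy

theorem lipReal_le_of_eventually {f : X → ℝ} {x : X} {a : ℝ}
    (h : ∀ ε > 0, ∀ᶠ y in 𝓝 x, |f y - f x| ≤ (a + ε) * dist y x) (ha : 0 ≤ a) :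
    lipReal f x ≤ a :=
  lipReal_le ha fun c hc => by simpa using h (c - a) (sub_pos.2 hc)

theorem lipReal_add_le {f g : X → ℝ} (hf : IsLip f) (hg : IsLip g) (x : X) :
    lipReal (f + g) x ≤ lipReal f x + lipReal g x := by
  refine lipReal_le_of_eventually (fun ε hε => ?_)
    (add_nonneg (lipReal_nonneg _ _) (lipReal_nonneg _ _))
  filter_upwards [hf.eventually_le (lt_add_of_pos_right (lipReal f x) (half_pos hε)),
    hg.eventually_le (lt_add_of_pos_right (lipReal g x) (half_pos hε))] with y h1 h2
  have : (f + g) y - (f + g) x = (f y - f x) + (g y - g x) := by simp only [Pi.add_apply]; ring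
  rw [this]
  refine (abs_add_le _ _).trans ?_
  linarith

theorem lipReal_smul_le {f : X → ℝ} (hf : IsLip f) (c : ℝ) (x : X) :
    lipReal (c • f) x ≤ |c| * lipReal f x := by
  refine lipReal_le_of_eventually (fun ε hε => ?_)
    (mul_nonneg (abs_nonneg _) (lipReal_nonneg _ _))
  filter_upwards [hf.eventually_le (lt_add_of_pos_right (lipReal f x)
    (show 0 < ε / (|c| + 1) by positivity))] with y h1
  have : (c • f) y - (c • f) x = c * (f y - f x) := by simp only [Pi.smul_apply, smul_eq_mul]; ring
  rw [this, abs_mul]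
  calc |c| * |f y - f x| ≤ |c| * ((lipReal f x + ε / (|c| + 1)) * dist y x) := by gcongr
    _ = (|c| * lipReal f x + |c| * (ε / (|c| + 1))) * dist y x := by ring
    _ ≤ (|c| * lipReal f x + (|c| + 1) * (ε / (|c| + 1))) * dist y x := by gcongr; linarith
    _ = _ := by field_simp

theorem IsLip.add {f g : X → ℝ} (hf : IsLip f) (hg : IsLip g) : IsLip (f + g) := by
  obtain ⟨K, hK⟩ := hf
  obtain ⟨L, hL⟩ := hg
  exact ⟨K + L, hK.add hL⟩

theorem IsLip.smul {f : X → ℝ} (hf : IsLip f) (c : ℝ) : IsLip (c • f) := by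
  obtain ⟨K, hK⟩ := hf
  exact ⟨_, (lipschitzWith_smul c).comp hK⟩

theorem IsLip.continuous {f : X → ℝ} (hf : IsLip f) : Continuous f := by
  obtain ⟨K, hK⟩ := hf
  exact hK.continuous

theorem IsLip.clampReal {f : X → ℝ} (hf : IsLip f) (N : ℝ) : IsLip (clampReal N f) := by
  obtain ⟨K, hK⟩ := hf
  refine ⟨K, LipschitzWith.of_dist_le_mul fun x y => ?_⟩
  rw [Real.dist_eq]
  exact (abs_clampReal_sub_le N f y x).trans (by simpa [Real.dist_eq] using hK.dist_le_mul x y)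

theorem lipReal_clampReal_le {f : X → ℝ} (hf : IsLip f) (N : ℝ) (x : X) :
    lipReal (clampReal N f) x ≤ lipReal f x := by
  refine lipReal_le_of_eventually (fun ε hε => ?_) (lipReal_nonneg _ _)
  filter_upwards [hf.eventually_le (lt_add_of_pos_right (lipReal f x) hε)] with y h1
  exact (abs_clampReal_sub_le N f x y).trans h1

theorem lipReal_glue_le {f g χ : X → ℝ} {L : ℝ≥0} (hf : IsLip f) (hg : IsLip g)
    (hχ : LipschitzWith L χ) (h0 : ∀ x, 0 ≤ χ x) (h1 : ∀ x, χ x ≤ 1) (x : X) :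
    lipReal (fun x => g x + χ x * (f x - g x)) x ≤
      χ x * lipReal f x + (1 - χ x) * lipReal g x + L * |f x - g x| := by
  have e1 := h0 x
  have e2 := h1 x
  have e3 := lipReal_nonneg f x
  have e4 := lipReal_nonneg g x
  refine lipReal_le_of_eventually (fun ε hε => ?_) (by
    have : 0 ≤ 1 - χ x := by linarith
    positivity)
  have hcont : ContinuousAt (fun y => L * |f y - g y|) x :=
    (((hf.continuous.sub hg.continuous).abs).const_mul _).continuousAt
  have hev : ∀ᶠ y in 𝓝 x, L * |f y - g y| < L * |f x - g x| + ε / 2 :=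
    hcont.eventually_lt continuousAt_const (by linarith)
  filter_upwards [hf.eventually_le (lt_add_of_pos_right (lipReal f x) (half_pos hε)),
    hg.eventually_le (lt_add_of_pos_right (lipReal g x) (half_pos hε)), hev] with y h2 h3 h4
  have h5 : |χ y - χ x| ≤ L * dist y x := by simpa [Real.dist_eq] using hχ.dist_le_mul y x
  have : (g y + χ y * (f y - g y)) - (g x + χ x * (f x - g x)) =
      χ x * (f y - f x) + (1 - χ x) * (g y - g x) + (χ y - χ x) * (f y - g y) := by ring
  rw [this]
  have hd : 0 ≤ dist y x := dist_nonneg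
  calc _ ≤ |χ x * (f y - f x)| + |(1 - χ x) * (g y - g x)| + |(χ y - χ x) * (f y - g y)| :=
        abs_add_three _ _ _
    _ = χ x * |f y - f x| + (1 - χ x) * |g y - g x| + |χ y - χ x| * |f y - g y| := by
        rw [abs_mul, abs_mul, abs_mul, abs_of_nonneg e1, abs_of_nonneg (sub_nonneg.2 e2)]
    _ ≤ χ x * ((lipReal f x + ε / 2) * dist y x) + (1 - χ x) * ((lipReal g x + ε / 2) * dist y x)
        + (L * dist y x) * |f y - g y| := by
        have : 0 ≤ 1 - χ x := by linarith
        gcongr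
    _ ≤ χ x * ((lipReal f x + ε / 2) * dist y x) + (1 - χ x) * ((lipReal g x + ε / 2) * dist y x)
        + (L * |f x - g x| + ε / 2) * dist y x := by
        have := mul_le_mul_of_nonneg_right h4.le hd
        linarith
    _ = _ := by ring

variable [MeasurableSpace X] [BorelSpace X]

theorem measurable_lipReal {f : X → ℝ} (hf : Continuous f) : Measurable (lipReal f) := by
  have key : localLip f = fun x => ⨅ n : ℕ, ⨆ y : X,
      (Metric.ball y (1 / (n + 1 : ℝ)) \ {y}).indicator
        (fun x => edist (f y) (f x) / edist y x) x := by
    funext x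
    have hb : (𝓝[≠] x).HasBasis (fun _ : ℕ => True)
        (fun n : ℕ => Metric.ball x (1 / (n + 1 : ℝ)) ∩ {x}ᶜ) :=
      nhdsWithin_hasBasis Metric.nhds_basis_ball_inv_nat_succ _
    rw [localLip, hb.limsup_eq_iInf_iSup]
    simp only [iInf_true]
    refine iInf_congr fun n => ?_
    refine iSup_congr fun y => ?_
    by_cases hy : y ∈ Metric.ball x (1 / (n + 1 : ℝ)) ∩ {x}ᶜ
    · have hy' : x ∈ Metric.ball y (1 / (n + 1 : ℝ)) \ {y} :=
        ⟨Metric.mem_ball_comm.1 hy.1, fun h => hy.2 (Eq.symm h)⟩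
      rw [indicator_of_mem hy', iSup_pos hy]
    · have hy' : x ∉ Metric.ball y (1 / (n + 1 : ℝ)) \ {y} := fun h =>
        hy ⟨Metric.mem_ball_comm.1 h.1, fun h' => h.2 (Eq.symm h')⟩
      rw [indicator_of_notMem hy', iSup_neg hy, bot_eq_zero]
  have hmeas : Measurable (localLip f) := by
    rw [key]
    refine Measurable.iInf fun n => ?_
    refine LowerSemicontinuous.measurable ?_
    refine lowerSemicontinuous_iSup fun y => ?_
    intro x
    by_cases hx : x ∈ Metric.ball y (1 / (n + 1 : ℝ)) \ {y}
    · have hopen : IsOpen (Metric.ball y (1 / (n + 1 : ℝ)) \ {y}) :=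
        Metric.isOpen_ball.sdiff isClosed_singleton
      have hne : edist y x ≠ 0 := by
        simpa [eq_comm] using hx.2
      have hc : ContinuousAt (fun x => edist (f y) (f x) / edist y x) x :=
        ENNReal.Tendsto.div ((continuous_const.edist hf).tendsto x) (Or.inr hne)
          ((continuous_const.edist continuous_id).tendsto x)
          (Or.inr (edist_ne_top _ _))
      have hc' : ContinuousAt ((Metric.ball y (1 / (n + 1 : ℝ)) \ {y}).indicator
          (fun x => edist (f y) (f x) / edist y x)) x :=
        hc.congr (by
          filter_upwards [hopen.mem_nhds hx] with z hz
          rw [indicator_of_mem hz])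
      exact hc'.lowerSemicontinuousAt
    · intro c hc
      rw [indicator_of_notMem hx] at hc
      exact absurd hc not_lt_zero
  exact hmeas.ennreal_toReal

/-- `G` is a relaxed gradient of `f`: there are Lipschitz functions `F n ∈ L²` with `F n → f` and
`lip (F n) → G` in `L²`. -/
def IsRelaxedGradient (m : Measure X) (f G : X → ℝ) : Prop :=
  MemLp G 2 m ∧ ∃ F : ℕ → X → ℝ,
    (∀ n, IsLip (F n) ∧ MemLp (F n) 2 m ∧ MemLp (lipReal (F n)) 2 m) ∧
    Tendsto (fun n => eLpNorm (F n - f) 2 m) atTop (𝓝 0) ∧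
    Tendsto (fun n => eLpNorm (lipReal (F n) - G) 2 m) atTop (𝓝 0)

/-- `f` is a Sobolev function, `f ∈ W^{1,2}(X, d, m)`. -/
def MemSobolev (m : Measure X) (f : X → ℝ) : Prop :=
  MemLp f 2 m ∧ ∃ G, IsRelaxedGradient m f G

/-- Auxiliary (upper) version of `IsRelaxedGradient`: the functions `h ≥ lip F` converge. -/
def IsUpperRelaxed (m : Measure X) (f G : X → ℝ) : Prop :=
  ∀ ε : ℝ≥0∞, 0 < ε → ∃ F h : X → ℝ, IsLip F ∧ MemLp F 2 m ∧ MemLp h 2 m ∧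
    (∀ᵐ x ∂m, lipReal F x ≤ h x) ∧ eLpNorm (F - f) 2 m ≤ ε ∧ eLpNorm (h - G) 2 m ≤ ε

variable {m : Measure X} {f g G G' H : X → ℝ}

theorem IsRelaxedGradient.isUpperRelaxed (h : IsRelaxedGradient m f G) : IsUpperRelaxed m f G := by
  intro ε hε
  obtain ⟨-, F, hF, h1, h2⟩ := h
  obtain ⟨n, hn1, hn2⟩ := ((h1.eventually_lt_const hε).and (h2.eventually_lt_const hε)).exists
  exact ⟨F n, lipReal (F n), (hF n).1, (hF n).2.1, (hF n).2.2, Eventually.of_forall fun _ => le_rfl,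
    hn1.le, hn2.le⟩

theorem IsUpperRelaxed.add (hf : MemLp f 2 m) (hg : MemLp g 2 m) (hG : MemLp G 2 m)
    (hH : MemLp H 2 m) (h1 : IsUpperRelaxed m f G) (h2 : IsUpperRelaxed m g H) :
    IsUpperRelaxed m (f + g) (G + H) := by
  intro ε hε
  have hε2 : 0 < ε / 2 := ENNReal.half_pos hε.ne'
  obtain ⟨F1, u1, a1, b1, c1, d1, e1, i1⟩ := h1 _ hε2
  obtain ⟨F2, u2, a2, b2, c2, d2, e2, i2⟩ := h2 _ hε2
  refine ⟨F1 + F2, u1 + u2, a1.add a2, b1.add b2, c1.add c2, ?_, ?_, ?_⟩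
  · filter_upwards [d1, d2] with x hx1 hx2
    exact (lipReal_add_le a1 a2 x).trans (add_le_add hx1 hx2)
  · rw [add_sub_add_comm, ← ENNReal.add_halves ε]
    exact (eLpNorm_add_le (b1.sub hf).1 (b2.sub hg).1 (by norm_num)).trans (add_le_add e1 e2)
  · rw [add_sub_add_comm, ← ENNReal.add_halves ε]
    exact (eLpNorm_add_le (c1.sub hG).1 (c2.sub hH).1 (by norm_num)).trans (add_le_add i1 i2)

theorem IsUpperRelaxed.smul (h1 : IsUpperRelaxed m f G) (c : ℝ) :
    IsUpperRelaxed m (c • f) (|c| • G) := by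
  intro ε hε
  have hc0 : (‖c‖ₑ + 1) ≠ 0 := by simp
  have hct : (‖c‖ₑ + 1) ≠ ∞ := by simp
  obtain ⟨F1, u1, a1, b1, c1, d1, e1, i1⟩ := h1 _ (ENNReal.div_pos hε.ne' hct)
  have hb : ‖c‖ₑ * (ε / (‖c‖ₑ + 1)) ≤ ε := by
    calc ‖c‖ₑ * (ε / (‖c‖ₑ + 1)) ≤ (‖c‖ₑ + 1) * (ε / (‖c‖ₑ + 1)) := by gcongr; exact le_self_add
      _ = ε := ENNReal.mul_div_cancel hc0 hct
  refine ⟨c • F1, |c| • u1, a1.smul c, b1.const_smul c, c1.const_smul _, ?_, ?_, ?_⟩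
  · filter_upwards [d1] with x hx
    exact (lipReal_smul_le a1 c x).trans (mul_le_mul_of_nonneg_left hx (abs_nonneg _))
  · rw [← smul_sub, eLpNorm_const_smul]
    exact (mul_le_mul_right e1 _).trans hb
  · rw [← smul_sub, eLpNorm_const_smul, Real.enorm_abs]
    exact (mul_le_mul_right i1 _).trans hb

theorem IsUpperRelaxed.nonneg (hG : MemLp G 2 m) (h : IsUpperRelaxed m f G) :
    ∀ᵐ x ∂m, 0 ≤ G x := by
  have hz : eLpNorm (fun x => min (G x) 0) 2 m = 0 := by
    refine le_antisymm (le_of_forall_gt_imp_ge_of_dense fun ε hε => ?_) zero_le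
    obtain ⟨F1, u1, a1, b1, c1, d1, e1, i1⟩ := h ε hε
    refine le_trans (eLpNorm_mono_ae ?_) i1
    filter_upwards [d1] with x hx
    have h0 := (lipReal_nonneg F1 x).trans hx
    simp only [Pi.sub_apply, Real.norm_eq_abs]
    rcases le_total (G x) 0 with hg | hg
    · rw [min_eq_left hg, abs_of_nonpos hg]
      exact le_trans (by linarith) (le_abs_self _)
    · rw [min_eq_right hg, abs_zero]; exact abs_nonneg _
  have hm : AEStronglyMeasurable (fun x => min (G x) 0) m :=
    hG.1.inf aestronglyMeasurable_const
  rw [eLpNorm_eq_zero_iff hm two_ne_zero] at hz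
  filter_upwards [hz] with x hx
  simpa using hx

theorem IsUpperRelaxed.of_approx (hG : MemLp G 2 m)
    (h : ∀ ε : ℝ≥0∞, 0 < ε → ∃ G', MemLp G' 2 m ∧ IsUpperRelaxed m f G' ∧
      eLpNorm (G' - G) 2 m ≤ ε) : IsUpperRelaxed m f G := by
  intro ε hε
  have hε2 : 0 < ε / 2 := ENNReal.half_pos hε.ne'
  obtain ⟨G', hG', hK, hd⟩ := h _ hε2
  obtain ⟨F1, u1, a1, b1, c1, d1, e1, i1⟩ := hK _ hε2
  refine ⟨F1, u1, a1, b1, c1, d1, e1.trans ENNReal.half_le_self, ?_⟩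
  rw [← sub_add_sub_cancel u1 G' G, ← ENNReal.add_halves ε]
  exact (eLpNorm_add_le (c1.sub hG').1 (hG'.sub hG).1 (by norm_num)).trans (add_le_add i1 hd)

theorem tendsto_eLpNorm_two_zero {u : ℕ → X → ℝ} {D : X → ℝ} (hD : MemLp D 2 m)
    (hu : ∀ n, AEStronglyMeasurable (u n) m) (hle : ∀ n x, |u n x| ≤ |D x|)
    (hlim : ∀ x, Tendsto (fun n => u n x) atTop (𝓝 0)) :
    Tendsto (fun n => eLpNorm (u n) 2 m) atTop (𝓝 0) := by
  have e : ∀ v : X → ℝ, eLpNorm v 2 m = (∫⁻ x, ‖v x‖ₑ ^ (2 : ℝ) ∂m) ^ (1 / 2 : ℝ) := fun v => by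
    rw [eLpNorm_eq_lintegral_rpow_enorm_toReal two_ne_zero ENNReal.ofNat_ne_top]; simp
  have hDfin : ∫⁻ x, ‖D x‖ₑ ^ (2 : ℝ) ∂m ≠ ∞ := by
    have := lintegral_rpow_enorm_lt_top_of_eLpNorm_lt_top two_ne_zero ENNReal.ofNat_ne_top hD.2
    simpa using this.ne
  have h1 : Tendsto (fun n => ∫⁻ x, ‖u n x‖ₑ ^ (2 : ℝ) ∂m) atTop (𝓝 (∫⁻ _, 0 ∂m)) := by
    refine tendsto_lintegral_of_dominated_convergence' (fun x => ‖D x‖ₑ ^ (2 : ℝ))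
      (fun n => (hu n).enorm.pow_const _) (fun n => Eventually.of_forall fun x => ?_) hDfin
      (Eventually.of_forall fun x => ?_)
    · exact ENNReal.rpow_le_rpow (enorm_le_iff_norm_le.2 (hle n x)) (by norm_num)
    · have := (ENNReal.continuous_rpow_const (y := 2)).tendsto ‖(0 : ℝ)‖ₑ
      simp only [enorm_zero, ENNReal.zero_rpow_of_pos (show (0 : ℝ) < 2 by norm_num)] at this
      refine this.comp ?_
      simpa [Function.comp_def] using (continuous_enorm.tendsto (0 : ℝ)).comp (hlim x)
  rw [lintegral_zero] at h1
  simp only [e]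
  have := ((ENNReal.continuous_rpow_const (y := 1 / 2)).tendsto 0).comp h1
  simpa [Function.comp_def] using this

theorem IsUpperRelaxed.bounded (h : IsUpperRelaxed m f G) (hf : MemLp f 2 m) {ε : ℝ≥0∞}
    (hε : 0 < ε) : ∃ F h : X → ℝ, ∃ N : ℝ, (∀ x, |F x| ≤ N) ∧ IsLip F ∧ MemLp F 2 m ∧ MemLp h 2 m ∧
    (∀ᵐ x ∂m, lipReal F x ≤ h x) ∧ eLpNorm (F - f) 2 m ≤ ε ∧ eLpNorm (h - G) 2 m ≤ ε := by
  have hε2 : 0 < ε / 2 := ENNReal.half_pos hε.ne'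
  obtain ⟨F, u, a, b, c, d, e, i⟩ := h _ hε2
  have hmeas : ∀ N : ℝ, AEStronglyMeasurable (clampReal N F) m := fun N =>
    (a.clampReal N).continuous.measurable.aestronglyMeasurable
  have hle : ∀ (n : ℕ) (x : X), |clampReal n F x - F x| ≤ |F x| ∧ |clampReal n F x| ≤ n ∧
      |clampReal n F x| ≤ |F x| := by
    intro n x
    have hn : (0 : ℝ) ≤ n := n.cast_nonneg
    unfold clampReal
    rcases le_total (F x) n with h1 | h1
    · rw [min_eq_right h1]
      rcases le_total (-n : ℝ) (F x) with h2 | h2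
      · rw [max_eq_right h2]; simp [abs_le, h1, h2]
      · rw [max_eq_left h2, abs_of_nonpos (show F x ≤ 0 by linarith), abs_neg, abs_of_nonneg hn,
          abs_of_nonneg (by linarith)]
        exact ⟨by linarith, le_rfl, by linarith⟩
    · rw [min_eq_left h1, max_eq_right (by linarith), abs_of_nonneg hn,
        abs_of_nonneg (hn.trans h1), abs_of_nonpos (by linarith)]
      exact ⟨by linarith, le_rfl, by linarith⟩
  have ht : Tendsto (fun n : ℕ => eLpNorm (clampReal n F - F) 2 m) atTop (𝓝 0) := by
    refine tendsto_eLpNorm_two_zero b (fun n => (hmeas n).sub b.1) (fun n x => (hle n x).1)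
      (fun x => ?_)
    refine tendsto_const_nhds.congr' ?_
    filter_upwards [eventually_ge_atTop ⌈|F x|⌉₊] with n hn
    have hn' : |F x| ≤ n := (Nat.le_ceil _).trans (by exact_mod_cast hn)
    rw [abs_le] at hn'
    simp [clampReal, hn'.1, hn'.2]
  obtain ⟨n, hn⟩ := (ht.eventually_lt_const hε2).exists
  have hmem : MemLp (clampReal n F) 2 m :=
    b.mono (hmeas n) (Eventually.of_forall fun x => (hle n x).2.2)
  refine ⟨clampReal n F, u, n, fun x => (hle n x).2.1, a.clampReal n, hmem, c, ?_, ?_,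
    i.trans ENNReal.half_le_self⟩
  · filter_upwards [d] with x hx using (lipReal_clampReal_le a n x).trans hx
  · rw [← sub_add_sub_cancel (clampReal n F) F f, ← ENNReal.add_halves ε]
    exact (eLpNorm_add_le (hmem.sub b).1 (b.sub hf).1 (by norm_num)).trans (add_le_add hn.le e)

theorem MemLp.cutoff_mul {χ D : X → ℝ} (hχ : Continuous χ) (h0 : ∀ x, 0 ≤ χ x)
    (h1 : ∀ x, χ x ≤ 1) (hD : MemLp D 2 m) :
    MemLp (χ * D) 2 m ∧ eLpNorm (χ * D) 2 m ≤ eLpNorm D 2 m := by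
  have hle : ∀ x, ‖(χ * D) x‖ ≤ ‖D x‖ := fun x => by
    simp only [Pi.mul_apply, norm_mul, Real.norm_eq_abs, abs_of_nonneg (h0 x)]
    exact mul_le_of_le_one_left (abs_nonneg _) (h1 x)
  exact ⟨hD.mono (hχ.measurable.aestronglyMeasurable.mul hD.1) (Eventually.of_forall hle),
    eLpNorm_mono hle⟩

theorem IsUpperRelaxed.glue (hf : MemLp f 2 m) (hG : MemLp G 2 m) (hH : MemLp H 2 m)
    (h1 : IsUpperRelaxed m f G) (h2 : IsUpperRelaxed m f H) {χ : X → ℝ} {L : ℝ≥0}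
    (hχ : LipschitzWith L χ) (hχ0 : ∀ x, 0 ≤ χ x) (hχ1 : ∀ x, χ x ≤ 1) :
    IsUpperRelaxed m f (H + χ * (G - H)) := by
  intro ε hε
  set c : ℝ≥0∞ := 3 + 2 * L with hc
  have hc0 : c ≠ 0 := by simp [hc]
  have hct : c ≠ ∞ := by finiteness
  set δ := ε / c with hδ
  have hδ0 : 0 < δ := ENNReal.div_pos hε.ne' hct
  have hcδ : c * δ = ε := ENNReal.mul_div_cancel hc0 hct
  obtain ⟨F1, u1, N1, n1, a1, b1, c1, d1, e1, i1⟩ := h1.bounded hf hδ0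
  obtain ⟨F2, u2, N2, n2, a2, b2, c2, d2, e2, i2⟩ := h2.bounded hf hδ0
  have hχ1' : ∀ x, 0 ≤ 1 - χ x := fun x => by linarith [hχ1 x]
  have hD : eLpNorm (F1 - F2) 2 m ≤ 2 * δ := by
    rw [← sub_sub_sub_cancel_right F1 F2 f, two_mul]
    exact (eLpNorm_sub_le (b1.sub hf).1 (b2.sub hf).1 (by norm_num)).trans (add_le_add e1 e2)
  have hm1 := MemLp.cutoff_mul hχ.continuous hχ0 hχ1 (b1.sub b2)
  have hm2 := MemLp.cutoff_mul hχ.continuous hχ0 hχ1 (c1.sub hG)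
  have hm3 := MemLp.cutoff_mul (χ := fun x => 1 - χ x) (continuous_const.sub hχ.continuous) hχ1'
    (fun x => by linarith [hχ0 x]) (c2.sub hH)
  have hm4 := MemLp.cutoff_mul hχ.continuous hχ0 hχ1 (c1.sub c2)
  have hm5 : MemLp (fun x => (L : ℝ) * |F1 x - F2 x|) 2 m := ((b1.sub b2).abs).const_mul _
  have hm5' : eLpNorm (fun x => (L : ℝ) * |F1 x - F2 x|) 2 m ≤ 2 * L * δ := by
    have : (fun x => (L : ℝ) * |F1 x - F2 x|) = (L : ℝ) • fun x => ‖(F1 - F2) x‖ := rfl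
    rw [this, eLpNorm_const_smul, eLpNorm_norm]
    calc _ ≤ ‖(L : ℝ)‖ₑ * (2 * δ) := mul_le_mul_right hD _
      _ = _ := by
        rw [Real.enorm_eq_ofReal L.coe_nonneg, ENNReal.ofReal_coe_nnreal]; ring
  refine ⟨fun x => F2 x + χ x * (F1 x - F2 x),
    (u2 + χ * (u1 - u2)) + fun x => (L : ℝ) * |F1 x - F2 x|, ?_, b2.add hm1.1,
    (c2.add hm4.1).add hm5, ?_, ?_, ?_⟩
  · obtain ⟨K1, k1⟩ := a1
    obtain ⟨K2, k2⟩ := a2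
    refine ⟨K2 + ((K1 + K2) + (N1 + N2).toNNReal * L), LipschitzWith.of_dist_le_mul fun x y => ?_⟩
    have q1 := k1.dist_le_mul x y
    have q2 := k2.dist_le_mul x y
    have q3 := hχ.dist_le_mul x y
    rw [Real.dist_eq] at q1 q2 q3 ⊢
    have hN : |F1 y - F2 y| ≤ ((N1 + N2).toNNReal : ℝ) :=
      ((abs_sub _ _).trans (add_le_add (n1 y) (n2 y))).trans (Real.le_coe_toNNReal _)
    have : F2 x + χ x * (F1 x - F2 x) - (F2 y + χ y * (F1 y - F2 y)) =
      (F2 x - F2 y) + (χ x * ((F1 x - F1 y) - (F2 x - F2 y)) + (χ x - χ y) * (F1 y - F2 y)) := by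
      ring
    rw [this]
    have hd : 0 ≤ dist x y := dist_nonneg
    have r1 : |χ x * ((F1 x - F1 y) - (F2 x - F2 y))| ≤ K1 * dist x y + K2 * dist x y := by
      rw [abs_mul, abs_of_nonneg (hχ0 x)]
      exact (mul_le_of_le_one_left (abs_nonneg _) (hχ1 x)).trans
        ((abs_sub _ _).trans (add_le_add q1 q2))
    have r2 : |(χ x - χ y) * (F1 y - F2 y)| ≤ (L * dist x y) * ((N1 + N2).toNNReal : ℝ) := by
      rw [abs_mul]; gcongr
    refine (abs_add_le _ _).trans ?_
    refine (add_le_add q2 ((abs_add_le _ _).trans (add_le_add r1 r2))).trans (le_of_eq ?_)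
    push_cast; ring
  · filter_upwards [d1, d2] with x hx1 hx2
    refine (lipReal_glue_le a1 a2 hχ hχ0 hχ1 x).trans ?_
    have := mul_le_mul_of_nonneg_left hx1 (hχ0 x)
    have := mul_le_mul_of_nonneg_left hx2 (hχ1' x)
    simp only [Pi.add_apply, Pi.mul_apply, Pi.sub_apply]
    linarith
  · have : (fun x => F2 x + χ x * (F1 x - F2 x)) - f = (F2 - f) + χ * (F1 - F2) := by
      funext x; simp only [Pi.add_apply, Pi.mul_apply, Pi.sub_apply]; ring
    rw [this]
    calc _ ≤ eLpNorm (F2 - f) 2 m + eLpNorm (χ * (F1 - F2)) 2 m :=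
          eLpNorm_add_le (b2.sub hf).1 hm1.1.1 (by norm_num)
      _ ≤ δ + 2 * δ := add_le_add e2 (hm1.2.trans hD)
      _ = 3 * δ := by ring
      _ ≤ c * δ := by gcongr; exact le_self_add
      _ = ε := hcδ
  · have : (u2 + χ * (u1 - u2) + fun x => (L : ℝ) * |F1 x - F2 x|) - (H + χ * (G - H)) =
        (χ * (u1 - G) + (fun x => 1 - χ x) * (u2 - H)) + fun x => (L : ℝ) * |F1 x - F2 x| := by
      funext x; simp only [Pi.add_apply, Pi.mul_apply, Pi.sub_apply]; ring
    rw [this]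
    calc _ ≤ (eLpNorm (χ * (u1 - G)) 2 m + eLpNorm ((fun x => 1 - χ x) * (u2 - H)) 2 m) +
            eLpNorm (fun x => (L : ℝ) * |F1 x - F2 x|) 2 m :=
          (eLpNorm_add_le (hm2.1.add hm3.1).1 hm5.1 (by norm_num)).trans
            (add_le_add_left (eLpNorm_add_le hm2.1.1 hm3.1.1 (by norm_num)) _)
      _ ≤ (δ + δ) + 2 * L * δ := add_le_add (add_le_add (hm2.2.trans i1) (hm3.2.trans i2)) hm5'
      _ = (2 + 2 * L) * δ := by ring
      _ ≤ c * δ := by rw [hc]; gcongr; norm_num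
      _ = ε := hcδ

theorem IsUpperRelaxed.indicator_closed (hf : MemLp f 2 m) (hG : MemLp G 2 m) (hH : MemLp H 2 m)
    (h1 : IsUpperRelaxed m f G) (h2 : IsUpperRelaxed m f H) {E : Set X} (hE : IsClosed E) :
    IsUpperRelaxed m f (H + E.indicator (G - H)) := by
  have hD := hG.sub hH
  have hI : MemLp (E.indicator (G - H)) 2 m := hD.indicator hE.measurableSet
  have hpos : ∀ n : ℕ, (0 : ℝ) < 1 / (n + 1) := fun n => Nat.one_div_pos_of_nat
  set χ : ℕ → X → ℝ := fun n x => (thickenedIndicator (hpos n) E x : ℝ) with hχ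
  have hLip : ∀ n : ℕ, LipschitzWith (1 / (n + 1 : ℝ)).toNNReal⁻¹ (χ n) := fun n =>
    lipschitzWith_thickenedIndicator (hpos n) E
  have hχ0 : ∀ n x, 0 ≤ χ n x := fun n x => NNReal.coe_nonneg _
  have hχ1 : ∀ n x, χ n x ≤ 1 := fun n x => by
    exact NNReal.coe_le_one.2 (thickenedIndicator_le_one (hpos n) E x)
  have hlim : ∀ x, Tendsto (fun n => χ n x) atTop (𝓝 (E.indicator (fun _ => (1 : ℝ)) x)) := by
    intro x
    have := tendsto_pi_nhds.1 (thickenedIndicator_tendsto_indicator_closure hpos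
      tendsto_one_div_add_atTop_nhds_zero_nat E) x
    rw [hE.closure_eq] at this
    have h3 := (NNReal.continuous_coe.tendsto _).comp this
    have e : ((E.indicator (fun _ => (1 : ℝ≥0)) x : ℝ≥0) : ℝ) = E.indicator (fun _ => (1 : ℝ)) x := by
      by_cases hx : x ∈ E <;> simp [hx]
    rw [e] at h3
    exact h3
  have ht : Tendsto (fun n => eLpNorm (χ n * (G - H) - E.indicator (G - H)) 2 m) atTop (𝓝 0) := by
    refine tendsto_eLpNorm_two_zero hD (fun n => ?_) (fun n x => ?_) (fun x => ?_)
    · exact ((hLip n).continuous.measurable.aestronglyMeasurable.mul hD.1).sub hI.1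
    · by_cases hx : x ∈ E
      · have := hχ1 n x
        have h0 := hχ0 n x
        simp only [Pi.sub_apply, Pi.mul_apply, indicator_of_mem hx]
        rw [show χ n x * (G x - H x) - (G x - H x) = -((1 - χ n x) * (G x - H x)) by ring, abs_neg,
          abs_mul, abs_of_nonneg (by linarith)]
        exact mul_le_of_le_one_left (abs_nonneg _) (by linarith)
      · simp only [Pi.sub_apply, Pi.mul_apply, indicator_of_notMem hx, sub_zero, abs_mul,
          abs_of_nonneg (hχ0 n x)]
        exact mul_le_of_le_one_left (abs_nonneg _) (hχ1 n x)
    · have := (hlim x).mul_const ((G - H) x)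
      have h4 := this.sub_const (E.indicator (G - H) x)
      have e : E.indicator (fun _ => (1 : ℝ)) x * (G - H) x - E.indicator (G - H) x = 0 := by
        by_cases hx : x ∈ E <;> simp [hx]
      rw [e] at h4
      exact h4
  refine IsUpperRelaxed.of_approx (hH.add hI) fun ε hε => ?_
  obtain ⟨n, hn⟩ := (ht.eventually_lt_const hε).exists
  have hm := MemLp.cutoff_mul (hLip n).continuous (hχ0 n) (hχ1 n) hD
  refine ⟨H + χ n * (G - H), hH.add hm.1, h1.glue hf hG hH h2 (hLip n) (hχ0 n) (hχ1 n), ?_⟩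
  rw [add_sub_add_left_eq_sub]
  exact hn.le

theorem IsUpperRelaxed.indicator (hf : MemLp f 2 m) (hG : MemLp G 2 m) (hH : MemLp H 2 m)
    (h1 : IsUpperRelaxed m f G) (h2 : IsUpperRelaxed m f H) {E : Set X} (hE : MeasurableSet E) :
    IsUpperRelaxed m f (H + E.indicator (G - H)) := by
  have hD := hG.sub hH
  have hI : MemLp (E.indicator (G - H)) 2 m := hD.indicator hE
  have hDfin : ∫⁻ x, ‖(G - H) x‖ₑ ^ (2 : ℝ) ∂m ≠ ∞ := by
    have := lintegral_rpow_enorm_lt_top_of_eLpNorm_lt_top two_ne_zero ENNReal.ofNat_ne_top hD.2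
    simpa using this.ne
  set ν := m.withDensity (fun x => ‖(G - H) x‖ₑ ^ (2 : ℝ)) with hν
  have : IsFiniteMeasure ν := isFiniteMeasure_withDensity hDfin
  refine IsUpperRelaxed.of_approx (hH.add hI) fun ε hε => ?_
  obtain ⟨F, hFE, hFc, hF⟩ := hE.exists_isClosed_sdiff_lt (μ := ν) (measure_ne_top _ _)
    (ε := ε ^ (2 : ℝ)) (by simpa using hε.ne')
  refine ⟨H + F.indicator (G - H), hH.add (hD.indicator hFc.measurableSet),
    h1.indicator_closed hf hG hH h2 hFc, ?_⟩
  have hmeas : MeasurableSet (E \ F) := hE.diff hFc.measurableSet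
  have e1 : (H + F.indicator (G - H)) - (H + E.indicator (G - H)) =
      -((E \ F).indicator (G - H)) := by
    rw [add_sub_add_left_eq_sub, Set.indicator_sdiff hFE, neg_sub]
  rw [e1, eLpNorm_neg, eLpNorm_indicator_eq_eLpNorm_restrict hmeas,
    eLpNorm_eq_lintegral_rpow_enorm_toReal two_ne_zero ENNReal.ofNat_ne_top]
  have e2 : ∫⁻ x in E \ F, ‖(G - H) x‖ₑ ^ (2 : ℝ) ∂m = ν (E \ F) := (withDensity_apply _ hmeas).symm
  simp only [ENNReal.toReal_ofNat]
  rw [e2]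
  calc ν (E \ F) ^ (1 / 2 : ℝ) ≤ (ε ^ (2 : ℝ)) ^ (1 / 2 : ℝ) := by gcongr
    _ = ε := by rw [← ENNReal.rpow_mul]; simp

/-- A relaxed gradient of least `L²` norm. -/
theorem exists_least_norm_relaxedGradient (hf : MemLp f 2 m) (hG : MemLp G 2 m)
    (h : IsUpperRelaxed m f G) : ∃ G₀, IsRelaxedGradient m f G₀ ∧
      ∀ G', MemLp G' 2 m → IsUpperRelaxed m f G' → eLpNorm G₀ 2 m ≤ eLpNorm G' 2 m := by
  set A : ℝ≥0∞ → Set (X → ℝ) := fun ε => {F | IsLip F ∧ MemLp F 2 m ∧ MemLp (lipReal F) 2 m ∧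
    eLpNorm (F - f) 2 m ≤ ε} with hA
  set η : ℝ≥0∞ → ℝ≥0∞ := fun ε => ⨅ F ∈ A ε, eLpNorm (lipReal F) 2 m with hη
  have hηle : ∀ ε, 0 < ε → ∀ G', MemLp G' 2 m → IsUpperRelaxed m f G' → η ε ≤ eLpNorm G' 2 m := by
    intro ε hε G' hG' hK
    refine ENNReal.le_of_forall_pos_le_add fun δ hδ _ => ?_
    have hδ' : (0 : ℝ≥0∞) < δ := by exact_mod_cast hδ
    obtain ⟨F, u, a, b, c, d, e, i⟩ := hK (min ε δ) (lt_min hε hδ')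
    have hle : ∀ᵐ x ∂m, ‖lipReal F x‖ ≤ ‖u x‖ := by
      filter_upwards [d] with x hx
      rw [Real.norm_of_nonneg (lipReal_nonneg _ _)]
      exact hx.trans (le_abs_self _)
    have hmem : MemLp (lipReal F) 2 m :=
      c.mono (measurable_lipReal a.continuous).aestronglyMeasurable hle
    calc η ε ≤ eLpNorm (lipReal F) 2 m :=
          iInf₂_le F ⟨a, b, hmem, e.trans (min_le_left _ _)⟩
      _ ≤ eLpNorm u 2 m := eLpNorm_mono_ae hle
      _ = eLpNorm (G' + (u - G')) 2 m := by rw [add_sub_cancel]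
      _ ≤ eLpNorm G' 2 m + eLpNorm (u - G') 2 m :=
          eLpNorm_add_le hG'.1 (c.sub hG').1 (by norm_num)
      _ ≤ eLpNorm G' 2 m + δ := by gcongr; exact i.trans (min_le_right _ _)
  have hηanti : ∀ {ε ε'}, ε ≤ ε' → η ε' ≤ η ε := fun {ε ε'} hle =>
    biInf_mono fun F hF => ⟨hF.1, hF.2.1, hF.2.2.1, hF.2.2.2.trans hle⟩
  set e : ℕ → ℝ≥0∞ := fun n => ENNReal.ofReal (1 / (n + 1)) with he
  have he0 : ∀ n, 0 < e n := fun n => ENNReal.ofReal_pos.2 Nat.one_div_pos_of_nat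
  have heanti : Antitone e := fun a b hab => ENNReal.ofReal_le_ofReal
    (one_div_le_one_div_of_le (by positivity) (by gcongr))
  have hηfin : ∀ n, η (e n) ≠ ∞ := fun n => ne_top_of_le_ne_top hG.2.ne (hηle _ (he0 n) G hG h)
  have hmono : Monotone fun n => η (e n) := fun a b hab => hηanti (heanti hab)
  set L : ℝ≥0∞ := ⨆ n, η (e n) with hL
  have hLle : ∀ G', MemLp G' 2 m → IsUpperRelaxed m f G' → L ≤ eLpNorm G' 2 m :=
    fun G' h1 h2 => iSup_le fun n => hηle _ (he0 n) G' h1 h2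
  have hLfin : L ≠ ∞ := ne_top_of_le_ne_top hG.2.ne (hLle G hG h)
  have hchoose : ∀ n, ∃ F ∈ A (e n), eLpNorm (lipReal F) 2 m ≤ η (e n) + e n := by
    intro n
    have := ENNReal.lt_add_right (hηfin n) (he0 n).ne'
    obtain ⟨F, hF⟩ := iInf_lt_iff.1 this
    obtain ⟨hF1, hF2⟩ := iInf_lt_iff.1 hF
    exact ⟨F, hF1, hF2.le⟩
  choose F hFA hFle using hchoose
  set u : ℕ → Lp ℝ 2 m := fun n => (hFA n).2.2.1.toLp with hu
  set a : ℕ → ℝ := fun n => (η (e n)).toReal with ha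
  have ha0 : ∀ n, 0 ≤ a n := fun n => ENNReal.toReal_nonneg
  have hatend : Tendsto a atTop (𝓝 L.toReal) :=
    (ENNReal.tendsto_toReal hLfin).comp (tendsto_atTop_iSup hmono)
  have haL : ∀ n, a n ≤ L.toReal := fun n => ENNReal.toReal_mono hLfin (le_iSup (fun n => η (e n)) n)
  have hun : ∀ n, ‖u n‖ ≤ a n + 1 / (n + 1) := by
    intro n
    rw [hu, Lp.norm_toLp]
    refine (ENNReal.toReal_mono (ENNReal.add_ne_top.2 ⟨hηfin n, ENNReal.ofReal_ne_top⟩)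
      (hFle n)).trans (le_of_eq ?_)
    rw [ENNReal.toReal_add (hηfin n) ENNReal.ofReal_ne_top, ENNReal.toReal_ofReal (by positivity)]
  have hmid : ∀ N n k, N ≤ n → N ≤ k → 2 * a N ≤ ‖u n + u k‖ := by
    intro N n k hn hk
    set P : X → ℝ := (1 / 2 : ℝ) • (F n + F k) with hP
    have hPL : IsLip P := ((hFA n).1.add (hFA k).1).smul _
    have hle : ∀ x, lipReal P x ≤ (1 / 2) * (lipReal (F n) x + lipReal (F k) x) := fun x => by
      refine (lipReal_smul_le ((hFA n).1.add (hFA k).1) _ x).trans ?_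
      rw [abs_of_pos (by norm_num)]
      gcongr
      exact lipReal_add_le (hFA n).1 (hFA k).1 x
    have hle' : ∀ x, ‖lipReal P x‖ ≤ ‖((1 / 2 : ℝ) • (lipReal (F n) + lipReal (F k))) x‖ :=
      fun x => by
        rw [Real.norm_of_nonneg (lipReal_nonneg _ _)]
        exact (hle x).trans (le_abs_self _)
    have hsm : MemLp ((1 / 2 : ℝ) • (lipReal (F n) + lipReal (F k))) 2 m :=
      ((hFA n).2.2.1.add (hFA k).2.2.1).const_smul _
    have hPmem : MemLp (lipReal P) 2 m :=
      hsm.mono (measurable_lipReal hPL.continuous).aestronglyMeasurable (Eventually.of_forall hle')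
    have hPA : P ∈ A (e N) := by
      refine ⟨hPL, ((hFA n).2.1.add (hFA k).2.1).const_smul _, hPmem, ?_⟩
      have : P - f = (1 / 2 : ℝ) • ((F n - f) + (F k - f)) := by
        funext x; simp [hP]; ring
      rw [this, eLpNorm_const_smul]
      have h12 : ‖(1 / 2 : ℝ)‖ₑ = 1 / 2 := by
        rw [Real.enorm_eq_ofReal (by norm_num), ENNReal.ofReal_div_of_pos (by norm_num)]; simp
      calc _ ≤ ‖(1 / 2 : ℝ)‖ₑ * (e N + e N) := by
            gcongr
            exact (eLpNorm_add_le ((hFA n).2.1.sub hf).1 ((hFA k).2.1.sub hf).1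
              (by norm_num)).trans (add_le_add ((hFA n).2.2.2.trans (heanti hn))
                ((hFA k).2.2.2.trans (heanti hk)))
        _ = e N := by
            rw [h12, ← two_mul, ← mul_assoc, ENNReal.div_mul_cancel two_ne_zero (by simp), one_mul]
    have h3 : η (e N) ≤ eLpNorm ((1 / 2 : ℝ) • (lipReal (F n) + lipReal (F k))) 2 m :=
      (iInf₂_le P hPA).trans (eLpNorm_mono hle')
    have h4 : a N ≤ ‖(1 / 2 : ℝ) • (u n + u k)‖ := by
      have : (1 / 2 : ℝ) • (u n + u k) = hsm.toLp := rfl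
      rw [this, Lp.norm_toLp]
      exact ENNReal.toReal_mono hsm.2.ne h3
    rw [norm_smul, Real.norm_of_nonneg (by norm_num)] at h4
    linarith
  set b : ℕ → ℝ := fun N => √(4 * (L.toReal + 1 / (N + 1)) ^ 2 - 4 * a N ^ 2) with hb
  have hbtend : Tendsto b atTop (𝓝 0) := by
    have h1 : Tendsto (fun N : ℕ => 4 * (L.toReal + 1 / ((N : ℝ) + 1)) ^ 2 - 4 * a N ^ 2) atTop
        (𝓝 (4 * (L.toReal + 0) ^ 2 - 4 * L.toReal ^ 2)) :=
      (((tendsto_one_div_add_atTop_nhds_zero_nat.const_add _).pow 2).const_mul 4).sub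
        ((hatend.pow 2).const_mul 4)
    have h2 := (Real.continuous_sqrt.tendsto _).comp h1
    simpa [hb, Function.comp_def] using h2
  have hcauchy : CauchySeq u := by
    refine cauchySeq_of_le_tendsto_0 b (fun n k N hn hk => ?_) hbtend
    rw [dist_eq_norm]
    refine Real.le_sqrt_of_sq_le ?_
    have hpar := parallelogram_law_with_norm ℝ (u n) (u k)
    have hbd : ∀ j, N ≤ j → ‖u j‖ ≤ L.toReal + 1 / (N + 1) := fun j hj =>
      (hun j).trans (add_le_add (haL j) (one_div_le_one_div_of_le (by positivity) (by gcongr)))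
    have q1 := pow_le_pow_left₀ (norm_nonneg _) (hbd n hn) 2
    have q2 := pow_le_pow_left₀ (norm_nonneg _) (hbd k hk) 2
    have q3 := pow_le_pow_left₀ (by linarith [ha0 N]) (hmid N n k hn hk) 2
    nlinarith
  obtain ⟨G₀, hG₀⟩ := cauchySeq_tendsto_of_complete hcauchy
  refine ⟨G₀, ⟨Lp.memLp G₀, F, fun n => ⟨(hFA n).1, (hFA n).2.1, (hFA n).2.2.1⟩, ?_, ?_⟩, ?_⟩
  · refine tendsto_of_tendsto_of_tendsto_of_le_of_le tendsto_const_nhds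
      (h := e) ?_ (fun _ => zero_le) (fun n => (hFA n).2.2.2)
    have := ENNReal.tendsto_ofReal (tendsto_one_div_add_atTop_nhds_zero_nat (𝕜 := ℝ))
    simpa [he] using this
  · have h1 := (Lp.tendsto_Lp_iff_tendsto_eLpNorm' u G₀).1 hG₀
    refine h1.congr fun n => eLpNorm_congr_ae ?_
    filter_upwards [(hFA n).2.2.1.coeFn_toLp] with x hx
    simp only [Pi.sub_apply, hu]
    rw [hx]
  · intro G' h1 h2
    have hnorm : ‖G₀‖ ≤ L.toReal := by
      have h3 : Tendsto (fun n => a n + 1 / ((n : ℝ) + 1)) atTop (𝓝 (L.toReal + 0)) :=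
        hatend.add tendsto_one_div_add_atTop_nhds_zero_nat
      rw [add_zero] at h3
      exact le_of_tendsto_of_tendsto' hG₀.norm h3 hun
    rw [Lp.norm_def] at hnorm
    exact ((ENNReal.toReal_le_toReal (Lp.eLpNorm_ne_top _) hLfin).1 hnorm).trans (hLle G' h1 h2)

/-- Every Sobolev function has a relaxed gradient that is minimal in the almost everywhere sense. -/
theorem exists_minimal_relaxedGradient (hf : MemLp f 2 m) (hG : MemLp G 2 m)
    (h : IsUpperRelaxed m f G) : ∃ G₀, IsRelaxedGradient m f G₀ ∧ Measurable G₀ ∧ (∀ x, 0 ≤ G₀ x) ∧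
      ∀ G', MemLp G' 2 m → IsUpperRelaxed m f G' → G₀ ≤ᵐ[m] G' := by
  obtain ⟨G₁, hG₁, hmin⟩ := exists_least_norm_relaxedGradient hf hG h
  have hG₁K := hG₁.isUpperRelaxed
  have hmin' : ∀ G', MemLp G' 2 m → IsUpperRelaxed m f G' → G₁ ≤ᵐ[m] G' := by
    intro G' h1 h2
    obtain ⟨B, hBm, hB⟩ := h1.1.aemeasurable
    obtain ⟨C, hCm, hC⟩ := hG₁.1.1.aemeasurable
    set E : Set X := {x | B x < C x} with hE
    have hEm : MeasurableSet E := measurableSet_lt hBm hCm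
    have hglue := h2.indicator hf h1 hG₁.1 hG₁K hEm
    have hgm : MemLp (G₁ + E.indicator (G' - G₁)) 2 m := hG₁.1.add ((h1.sub hG₁.1).indicator hEm)
    have hle := hmin _ hgm hglue
    have hpt : ∀ᵐ x ∂m, ‖(G₁ + E.indicator (G' - G₁)) x‖ₑ ^ (2 : ℝ) ≤ ‖G₁ x‖ₑ ^ (2 : ℝ) := by
      filter_upwards [hB, hC, h2.nonneg h1] with x hx1 hx2 hx3
      refine ENNReal.rpow_le_rpow (enorm_le_iff_norm_le.2 ?_) (by norm_num)
      by_cases hx : x ∈ E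
      · have : B x < C x := hx
        simp only [Pi.add_apply, indicator_of_mem hx, Pi.sub_apply, add_sub_cancel]
        rw [Real.norm_of_nonneg hx3]
        exact le_trans (by rw [hx1, hx2]; exact this.le) (le_abs_self _)
      · simp [indicator_of_notMem hx]
    have hint : ∫⁻ x, ‖G₁ x‖ₑ ^ (2 : ℝ) ∂m ≤
        ∫⁻ x, ‖(G₁ + E.indicator (G' - G₁)) x‖ₑ ^ (2 : ℝ) ∂m := by
      rw [eLpNorm_eq_lintegral_rpow_enorm_toReal two_ne_zero ENNReal.ofNat_ne_top,
        eLpNorm_eq_lintegral_rpow_enorm_toReal two_ne_zero ENNReal.ofNat_ne_top] at hle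
      simpa using (ENNReal.rpow_le_rpow_iff (by norm_num)).1 hle
    have hfin : ∫⁻ x, ‖(G₁ + E.indicator (G' - G₁)) x‖ₑ ^ (2 : ℝ) ∂m ≠ ∞ := by
      have := lintegral_rpow_enorm_lt_top_of_eLpNorm_lt_top two_ne_zero ENNReal.ofNat_ne_top hgm.2
      simpa using this.ne
    have heq := ae_eq_of_ae_le_of_lintegral_le hpt hfin (hG₁.1.1.enorm.pow_const _) hint
    filter_upwards [hB, hC, h2.nonneg h1, heq] with x hx1 hx2 hx3 hx4
    by_contra hlt
    have hlt : G' x < G₁ x := not_le.1 hlt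
    have hx : x ∈ E := by
      change B x < C x
      rwa [← hx1, ← hx2]
    simp only [Pi.add_apply, indicator_of_mem hx, Pi.sub_apply, add_sub_cancel] at hx4
    have h5 := (ENNReal.rpow_left_injective (x := 2) (by norm_num)) hx4
    rw [enorm_eq_iff_norm_eq, Real.norm_of_nonneg hx3,
      Real.norm_of_nonneg (hx3.trans hlt.le)] at h5
    exact hlt.ne h5
  obtain ⟨C, hCm, hC⟩ := hG₁.1.1.aemeasurable
  have hCeq : (fun x => |C x|) =ᵐ[m] G₁ := by
    filter_upwards [hC, hG₁K.nonneg hG₁.1] with x hx1 hx2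
    rw [← hx1, abs_of_nonneg hx2]
  refine ⟨fun x => |C x|, ⟨hG₁.1.ae_eq hCeq.symm, ?_⟩, hCm.abs, fun x => abs_nonneg _,
    fun G' h1 h2 => hCeq.le.trans (hmin' G' h1 h2)⟩
  obtain ⟨-, F, hF, h1, h2⟩ := hG₁
  refine ⟨F, hF, h1, h2.congr fun n => eLpNorm_congr_ae ?_⟩
  filter_upwards [hCeq] with x hx
  simp only [Pi.sub_apply, hx]

theorem MemSobolev.exists_minimal (h : MemSobolev m f) :
    ∃ G₀, IsRelaxedGradient m f G₀ ∧ Measurable G₀ ∧ (∀ x, 0 ≤ G₀ x) ∧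
      ∀ G', MemLp G' 2 m → IsUpperRelaxed m f G' → G₀ ≤ᵐ[m] G' := by
  obtain ⟨hf, G, hG⟩ := h
  exact exists_minimal_relaxedGradient hf hG.1 hG.isUpperRelaxed

open Classical in
/-- The minimal weak upper gradient `|Df|` of a Sobolev function: the relaxed gradient that is
minimal in the almost everywhere sense (a chosen nonnegative Borel representative of it). -/
def weakGrad (m : Measure X) (f : X → ℝ) : X → ℝ :=
  if h : MemSobolev m f then h.exists_minimal.choose else 0

theorem MemSobolev.isRelaxedGradient_weakGrad (h : MemSobolev m f) :
    IsRelaxedGradient m f (weakGrad m f) := by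
  rw [weakGrad, dif_pos h]; exact h.exists_minimal.choose_spec.1

theorem MemSobolev.weakGrad_le_of_upper (h : MemSobolev m f) (hG : MemLp G 2 m)
    (hK : IsUpperRelaxed m f G) : weakGrad m f ≤ᵐ[m] G := by
  rw [weakGrad, dif_pos h]; exact h.exists_minimal.choose_spec.2.2.2 G hG hK

/-- `|Df|` lies below every relaxed gradient of `f`. -/
theorem MemSobolev.weakGrad_le (h : MemSobolev m f) (hG : IsRelaxedGradient m f G) :
    weakGrad m f ≤ᵐ[m] G :=
  h.weakGrad_le_of_upper hG.1 hG.isUpperRelaxed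

theorem measurable_weakGrad (m : Measure X) (f : X → ℝ) : Measurable (weakGrad m f) := by
  by_cases h : MemSobolev m f
  · rw [weakGrad, dif_pos h]; exact h.exists_minimal.choose_spec.2.1
  · rw [weakGrad, dif_neg h]; exact measurable_zero

theorem weakGrad_nonneg (m : Measure X) (f : X → ℝ) (x : X) : 0 ≤ weakGrad m f x := by
  by_cases h : MemSobolev m f
  · rw [weakGrad, dif_pos h]; exact h.exists_minimal.choose_spec.2.2.1 x
  · rw [weakGrad, dif_neg h]; exact le_rfl

theorem memSobolev_of_upper (hf : MemLp f 2 m) (hG : MemLp G 2 m) (h : IsUpperRelaxed m f G) :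
    MemSobolev m f := by
  obtain ⟨G₀, h0, -⟩ := exists_minimal_relaxedGradient hf hG h
  exact ⟨hf, G₀, h0⟩

theorem MemSobolev.upper_add (hf : MemSobolev m f) (hg : MemSobolev m g) :
    IsUpperRelaxed m (f + g) (weakGrad m f + weakGrad m g) :=
  IsUpperRelaxed.add hf.1 hg.1 hf.isRelaxedGradient_weakGrad.1 hg.isRelaxedGradient_weakGrad.1
    hf.isRelaxedGradient_weakGrad.isUpperRelaxed hg.isRelaxedGradient_weakGrad.isUpperRelaxed

theorem MemSobolev.add (hf : MemSobolev m f) (hg : MemSobolev m g) : MemSobolev m (f + g) :=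
  memSobolev_of_upper (hf.1.add hg.1)
    (hf.isRelaxedGradient_weakGrad.1.add hg.isRelaxedGradient_weakGrad.1) (hf.upper_add hg)

theorem MemSobolev.smul (hf : MemSobolev m f) (c : ℝ) : MemSobolev m (c • f) :=
  memSobolev_of_upper (hf.1.const_smul c) (hf.isRelaxedGradient_weakGrad.1.const_smul |c|)
    (hf.isRelaxedGradient_weakGrad.isUpperRelaxed.smul c)

theorem memSobolev_zero (m : Measure X) : MemSobolev m (0 : X → ℝ) := by
  have h0 : lipReal (0 : X → ℝ) = 0 := by
    funext x
    exact le_antisymm (lipReal_le le_rfl fun c hc => Eventually.of_forall fun y => by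
      simpa using mul_nonneg (le_of_lt hc) dist_nonneg) (lipReal_nonneg _ _)
  refine ⟨MemLp.zero, 0, MemLp.zero, fun _ => 0, fun _ => ⟨⟨0, LipschitzWith.const 0⟩, MemLp.zero, ?_⟩,
    ?_, ?_⟩
  · rw [h0]; exact MemLp.zero
  · simp
  · simp [h0]

/-- The Sobolev space `W^{1,2}(X, d, m)`, as a space of functions (functions that agree almost
everywhere have the same `|Df|` and the same differential). -/
def sobolevSpace (m : Measure X) : Submodule ℝ (X → ℝ) where
  carrier := {f | MemSobolev m f}
  add_mem' hf hg := hf.add hg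
  zero_mem' := memSobolev_zero m
  smul_mem' c _ hf := hf.smul c

theorem weakGrad_add_le (hf : MemSobolev m f) (hg : MemSobolev m g) :
    ∀ᵐ x ∂m, weakGrad m (f + g) x ≤ weakGrad m f x + weakGrad m g x :=
  (hf.add hg).weakGrad_le_of_upper
    (hf.isRelaxedGradient_weakGrad.1.add hg.isRelaxedGradient_weakGrad.1) (hf.upper_add hg)

theorem weakGrad_smul_le (hf : MemSobolev m f) (c : ℝ) :
    ∀ᵐ x ∂m, weakGrad m (c • f) x ≤ |c| * weakGrad m f x :=
  (hf.smul c).weakGrad_le_of_upper (hf.isRelaxedGradient_weakGrad.1.const_smul |c|)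
    (hf.isRelaxedGradient_weakGrad.isUpperRelaxed.smul c)

theorem weakGrad_smul (hf : MemSobolev m f) (c : ℝ) :
    ∀ᵐ x ∂m, weakGrad m (c • f) x = |c| * weakGrad m f x := by
  by_cases hc : c = 0
  · filter_upwards [weakGrad_smul_le hf c] with x hx
    refine le_antisymm hx ?_
    rw [hc, abs_zero, zero_mul]
    exact weakGrad_nonneg _ _ _
  · have h1 := weakGrad_smul_le (hf.smul c) c⁻¹
    rw [inv_smul_smul₀ hc] at h1
    filter_upwards [weakGrad_smul_le hf c, h1] with x hx1 hx2
    refine le_antisymm hx1 ?_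
    rw [abs_inv] at hx2
    have hc' : 0 < |c| := abs_pos.2 hc
    calc |c| * weakGrad m f x ≤ |c| * (|c|⁻¹ * weakGrad m (c • f) x) := by gcongr
      _ = _ := by field_simp

/-- The Sobolev norm `(‖f‖²_{L²} + ‖|Df|‖²_{L²})^{1/2}`. -/
def sobolevNorm (m : Measure X) (f : X → ℝ) : ℝ :=
  √((eLpNorm f 2 m).toReal ^ 2 + (eLpNorm (weakGrad m f) 2 m).toReal ^ 2)

/-- `(X, d, m)` is infinitesimally Hilbertian: the norm of `W^{1,2}` comes from an inner product,
i.e. it satisfies the parallelogram law. -/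
def InfinitesimallyHilbertian (m : Measure X) : Prop :=
  ∀ f ∈ sobolevSpace m, ∀ g ∈ sobolevSpace m,
    sobolevNorm m (f + g) ^ 2 + sobolevNorm m (f - g) ^ 2 =
      2 * sobolevNorm m f ^ 2 + 2 * sobolevNorm m g ^ 2

/-- The carré du champ `Γ(f, g) = (|D(f+g)|² - |D(f-g)|²) / 4`. -/
def carreDuChamp (m : Measure X) (f g : X → ℝ) (x : X) : ℝ :=
  (weakGrad m (f + g) x ^ 2 - weakGrad m (f - g) x ^ 2) / 4

/-- `e` takes countably many values, each on a measurable set. -/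
def IsStep {α : Type*} (e : X → α) : Prop :=
  (range e).Countable ∧ ∀ a, MeasurableSet (e ⁻¹' {a})

theorem IsStep.measurableSet_preimage {α : Type*} {e : X → α} (he : IsStep e) (S : Set α) :
    MeasurableSet (e ⁻¹' S) := by
  have : e ⁻¹' S = ⋃ a ∈ range e ∩ S, e ⁻¹' {a} := by
    ext x; simp
  rw [this]
  exact MeasurableSet.biUnion (he.1.mono inter_subset_left) fun a _ => he.2 a

theorem IsStep.comp {α β : Type*} {e : X → α} (he : IsStep e) (φ : α → β) :
    IsStep (fun x => φ (e x)) := by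
  refine ⟨?_, fun b => he.measurableSet_preimage (φ ⁻¹' {b})⟩
  rw [show (fun x => φ (e x)) = φ ∘ e from rfl, range_comp]
  exact he.1.image φ

theorem IsStep.prodMk {α β : Type*} {e : X → α} {e' : X → β} (he : IsStep e) (he' : IsStep e') :
    IsStep (fun x => (e x, e' x)) := by
  refine ⟨(he.1.prod he'.1).mono ?_, fun p => ?_⟩
  · rintro _ ⟨x, rfl⟩; exact ⟨mem_range_self x, mem_range_self x⟩
  · have : (fun x => (e x, e' x)) ⁻¹' {p} = e ⁻¹' {p.1} ∩ e' ⁻¹' {p.2} := by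
      ext x; simp [Prod.ext_iff]
    rw [this]; exact (he.2 _).inter (he'.2 _)

theorem isStep_const {α : Type*} (a : α) : IsStep (fun _ : X => a) :=
  ⟨(countable_singleton a).mono (by rintro _ ⟨x, rfl⟩; rfl), fun _ => MeasurableSet.const _⟩

theorem IsStep.ae {α : Type*} {e : X → α} (he : IsStep e) {P : α → X → Prop}
    (h : ∀ a, ∀ᵐ x ∂m, P a x) : ∀ᵐ x ∂m, P (e x) x := by
  have : ∀ᵐ x ∂m, ∀ a ∈ range e, P a x := (ae_ball_iff he.1).2 fun a _ => h a
  filter_upwards [this] with x hx using hx _ (mem_range_self x)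

theorem IsStep.measurable_eval {α : Type*} {e : X → α} (he : IsStep e) {G : α → X → ℝ}
    (hG : ∀ a, Measurable (G a)) : Measurable (fun x => G (e x) x) := by
  intro S hS
  have : (fun x => G (e x) x) ⁻¹' S = ⋃ a ∈ range e, e ⁻¹' {a} ∩ G a ⁻¹' S := by
    ext x
    simp only [mem_preimage, mem_iUnion, mem_inter_iff, mem_singleton_iff, exists_prop]
    exact ⟨fun h => ⟨e x, mem_range_self x, rfl, h⟩, fun ⟨a, _, h1, h2⟩ => h1 ▸ h2⟩
  rw [this]
  exact MeasurableSet.biUnion he.1 fun a _ => (he.2 a).inter (hG a hS)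

/-- The pre-cotangent module. A family `{(B_i, f_i)}_i`, with `{B_i}_i` a countable Borel partition
of `X` and `f_i` Sobolev functions, is encoded as the function `e` on `X` with value `f_i` on `B_i`;
its pointwise norm is `∑_i χ_{B_i} |D f_i|`, i.e. `x ↦ |D (e x)| (x)`, which has to be in `L²`. The
sum `{(A_i ∩ B_j, f_i + g_j)}` is then the pointwise sum. -/
def preCotangentSubmodule (m : Measure X) : Submodule ℝ (X → sobolevSpace m) where
  carrier := {e | IsStep e ∧ MemLp (fun x => weakGrad m (e x) x) 2 m}
  add_mem' {e e'} he he' := by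
    have hs : IsStep (e + e') := (he.1.prodMk he'.1).comp fun p => p.1 + p.2
    refine ⟨hs, (he.2.add he'.2).mono
      (hs.measurable_eval (G := fun f => weakGrad m f) fun f =>
        measurable_weakGrad m f).aestronglyMeasurable ?_⟩
    have h := (he.1.prodMk he'.1).ae (m := m)
      (P := fun p x => weakGrad m (p.1 + p.2 : X → ℝ) x ≤ weakGrad m p.1 x + weakGrad m p.2 x)
      fun p => weakGrad_add_le p.1.2 p.2.2
    filter_upwards [h] with x hx
    rw [Real.norm_of_nonneg (weakGrad_nonneg _ _ _)]
    exact hx.trans (le_abs_self _)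
  zero_mem' := by
    refine ⟨isStep_const 0, ?_⟩
    exact (memSobolev_zero m).isRelaxedGradient_weakGrad.1
  smul_mem' c e he := by
    have hs : IsStep (c • e) := he.1.comp fun f => c • f
    refine ⟨hs, (he.2.const_smul |c|).mono
      (hs.measurable_eval (G := fun f => weakGrad m f) fun f =>
        measurable_weakGrad m f).aestronglyMeasurable ?_⟩
    have h := he.1.ae (m := m)
      (P := fun f x => weakGrad m (c • f : X → ℝ) x = |c| * weakGrad m f x)
      fun f => weakGrad_smul f.2 c
    filter_upwards [h] with x hx
    refine le_of_eq ?_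
    exact congrArg norm hx

/-- The pre-cotangent module, with the seminorm below. -/
def PreCotangent (m : Measure X) : Type _ := preCotangentSubmodule m

instance (m : Measure X) : AddCommGroup (PreCotangent m) :=
  inferInstanceAs (AddCommGroup (preCotangentSubmodule m))

instance (m : Measure X) : Module ℝ (PreCotangent m) :=
  inferInstanceAs (Module ℝ (preCotangentSubmodule m))

namespace PreCotangent

/-- The Sobolev function `f_i` attached to the points of `B_i`. -/
def val (e : PreCotangent m) : X → sobolevSpace m := Subtype.val e

theorem isStep (e : PreCotangent m) : IsStep e.val := (Subtype.property e).1

/-- The pointwise norm `∑_i χ_{B_i} |D f_i|`. -/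
def pnorm (e : PreCotangent m) (x : X) : ℝ := weakGrad m (e.val x) x

theorem memLp_pnorm (e : PreCotangent m) : MemLp e.pnorm 2 m := (Subtype.property e).2

theorem pnorm_nonneg (e : PreCotangent m) (x : X) : 0 ≤ e.pnorm x := weakGrad_nonneg _ _ _

theorem pnorm_add_le (e e' : PreCotangent m) :
    ∀ᵐ x ∂m, (e + e').pnorm x ≤ e.pnorm x + e'.pnorm x :=
  (e.isStep.prodMk e'.isStep).ae (m := m)
    (P := fun p x => weakGrad m (p.1 + p.2 : X → ℝ) x ≤ weakGrad m p.1 x + weakGrad m p.2 x)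
    fun p => weakGrad_add_le p.1.2 p.2.2

theorem pnorm_smul (c : ℝ) (e : PreCotangent m) :
    ∀ᵐ x ∂m, (c • e).pnorm x = |c| * e.pnorm x :=
  e.isStep.ae (m := m) (P := fun f x => weakGrad m (c • f : X → ℝ) x = |c| * weakGrad m f x)
    fun f => weakGrad_smul f.2 c

theorem pnorm_neg (e : PreCotangent m) : ∀ᵐ x ∂m, (-e).pnorm x = e.pnorm x := by
  have := pnorm_smul (-1) e
  rw [neg_one_smul] at this
  simpa using this

theorem eLpNorm_pnorm_smul (c : ℝ) (e : PreCotangent m) :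
    eLpNorm (c • e).pnorm 2 m = ‖c‖ₑ * eLpNorm e.pnorm 2 m := by
  rw [← eLpNorm_const_smul c e.pnorm 2 m]
  refine eLpNorm_congr_norm_ae ?_
  filter_upwards [pnorm_smul c e] with x hx
  rw [hx]
  simp

theorem toReal_eLpNorm_pnorm_add_le (e e' : PreCotangent m) :
    (eLpNorm (e + e').pnorm 2 m).toReal ≤
      (eLpNorm e.pnorm 2 m).toReal + (eLpNorm e'.pnorm 2 m).toReal := by
  have h1 := e.memLp_pnorm
  have h2 := e'.memLp_pnorm
  have h3 : eLpNorm (e + e').pnorm 2 m ≤ eLpNorm (e.pnorm + e'.pnorm) 2 m := by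
    refine eLpNorm_mono_ae ?_
    filter_upwards [pnorm_add_le e e'] with x hx
    rw [Real.norm_of_nonneg (pnorm_nonneg _ _)]
    exact hx.trans (le_abs_self _)
  have h4 := h3.trans (eLpNorm_add_le h1.1 h2.1 (by norm_num))
  rw [← ENNReal.toReal_add h1.2.ne h2.2.ne]
  exact ENNReal.toReal_mono (ENNReal.add_ne_top.2 ⟨h1.2.ne, h2.2.ne⟩) h4

/-- The seminorm `‖e‖ = ‖|e|‖_{L²}`; its kernel is the equivalence relation
`|D(f_i - g_j)| = 0` almost everywhere on `A_i ∩ B_j`. -/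
def seminorm (m : Measure X) : AddGroupSeminorm (PreCotangent m) where
  toFun e := (eLpNorm e.pnorm 2 m).toReal
  map_zero' := by
    have h := eLpNorm_pnorm_smul (m := m) 0 0
    rw [zero_smul, enorm_zero, zero_mul] at h
    rw [h, ENNReal.toReal_zero]
  add_le' := toReal_eLpNorm_pnorm_add_le
  neg' e := by
    rw [eLpNorm_congr_ae (pnorm_neg e)]

end PreCotangent

instance (m : Measure X) : SeminormedAddCommGroup (PreCotangent m) :=
  (PreCotangent.seminorm m).toSeminormedAddCommGroup

theorem PreCotangent.norm_def (e : PreCotangent m) : ‖e‖ = (eLpNorm e.pnorm 2 m).toReal := rfl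

instance (m : Measure X) : NormedSpace ℝ (PreCotangent m) where
  norm_smul_le c e := by
    rw [PreCotangent.norm_def, PreCotangent.norm_def, PreCotangent.eLpNorm_pnorm_smul,
      ENNReal.toReal_mul]
    simp

/-- The cotangent module `L²(T*M)`: the (Hausdorff) completion of the pre-cotangent module. -/
abbrev Cotangent (m : Measure X) : Type _ := UniformSpace.Completion (PreCotangent m)

/-- The element `{(X, f)}` of the pre-cotangent module. -/
def PreCotangent.const (f : sobolevSpace m) : PreCotangent m :=
  (⟨fun _ => f, isStep_const f, (MemSobolev.isRelaxedGradient_weakGrad f.2).1⟩ :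
    preCotangentSubmodule m)

/-- The differential `df = [(X, f)]` of a Sobolev function. -/
def differential (m : Measure X) (f : sobolevSpace m) : Cotangent m :=
  ((PreCotangent.const f : PreCotangent m) : Cotangent m)

/-- The pointwise norm on the pre-cotangent module, with values in `L²(m)`. -/
def PreCotangent.pnormLp (e : PreCotangent m) : Lp ℝ 2 m := e.memLp_pnorm.toLp

theorem PreCotangent.lipschitzWith_pnormLp :
    LipschitzWith 1 (PreCotangent.pnormLp : PreCotangent m → Lp ℝ 2 m) := by
  refine LipschitzWith.of_dist_le_mul fun e e' => ?_
  rw [NNReal.coe_one, one_mul, dist_eq_norm, dist_eq_norm, pnormLp, pnormLp, ← MemLp.toLp_sub,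
    Lp.norm_toLp, norm_def]
  refine ENNReal.toReal_mono (e - e').memLp_pnorm.2.ne (eLpNorm_mono_ae ?_)
  have h1 := pnorm_add_le (e - e') e'
  have h2 := pnorm_add_le (-(e - e')) e
  rw [sub_add_cancel] at h1
  rw [show -(e - e') + e = e' by abel] at h2
  filter_upwards [h1, h2, pnorm_neg (e - e')] with x k1 k2 k3
  rw [Real.norm_of_nonneg (pnorm_nonneg _ _), Pi.sub_apply, Real.norm_eq_abs, abs_le]
  rw [k3] at k2
  constructor <;> linarith

/-- The pointwise norm `|ω| ∈ L²(m)` of `ω ∈ L²(T*M)`, extended by continuity. -/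
def pointwiseNorm (ω : Cotangent m) : Lp ℝ 2 m :=
  UniformSpace.Completion.extension PreCotangent.pnormLp ω

theorem pointwiseNorm_coe (e : PreCotangent m) :
    pointwiseNorm (e : Cotangent m) = e.pnormLp :=
  UniformSpace.Completion.extension_coe PreCotangent.lipschitzWith_pnormLp.uniformContinuous e

/-- The pointwise inner product of `L²(T*M)`, by polarization. -/
def cotangentInner (ω η : Cotangent m) (x : X) : ℝ :=
  (pointwiseNorm (ω + η) x ^ 2 - pointwiseNorm (ω - η) x ^ 2) / 4

/-- `⟨df, dg⟩ = Γ(f, g)` almost everywhere. -/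
theorem cotangentInner_differential (f g : sobolevSpace m) :
    ∀ᵐ x ∂m, cotangentInner (differential m f) (differential m g) x = carreDuChamp m f g x := by
  have h1 : differential m f + differential m g = differential m (f + g) :=
    (UniformSpace.Completion.coe_add _ _).symm
  have h2 : differential m f - differential m g = differential m (f - g) :=
    (UniformSpace.Completion.coe_sub _ _).symm
  have h3 : ∀ h : sobolevSpace m, pointwiseNorm (differential m h) =ᵐ[m] weakGrad m h := fun h => by
    rw [differential, pointwiseNorm_coe]
    exact (PreCotangent.memLp_pnorm _).coeFn_toLp
  filter_upwards [h3 (f + g), h3 (f - g)] with x k1 k2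
  rw [cotangentInner, h1, h2, k1, k2]
  rfl

/-- Multiplication by a step function: `s · {(A_i, f_i)} = {(A_i ∩ B_j, s_j f_i)}` for
`s = ∑_j s_j χ_{B_j}`. -/
def preStepMul {s : X → ℝ} (hs : IsStep s) (hb : MemLp s ∞ m) (e : PreCotangent m) :
    PreCotangent m :=
  (⟨fun x => s x • e.val x, (hs.prodMk e.isStep).comp fun p => p.1 • p.2, by
    refine (e.memLp_pnorm.mul (r := 2) hb).mono
      (((hs.prodMk e.isStep).comp fun p => p.1 • p.2).measurable_eval
        (G := fun f => weakGrad m f) fun f => measurable_weakGrad m f).aestronglyMeasurable ?_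
    have h := (hs.prodMk e.isStep).ae (m := m)
      (P := fun p x => weakGrad m (p.1 • p.2 : X → ℝ) x = |p.1| * weakGrad m p.2 x)
      fun p => weakGrad_smul p.2.2 p.1
    filter_upwards [h] with x hx
    refine le_of_eq ((congrArg norm hx).trans ?_)
    simp [PreCotangent.pnorm]⟩ : preCotangentSubmodule m)

theorem pnorm_preStepMul {s : X → ℝ} (hs : IsStep s) (hb : MemLp s ∞ m) (e : PreCotangent m) :
    ∀ᵐ x ∂m, (preStepMul hs hb e).pnorm x = |s x| * e.pnorm x :=
  (hs.prodMk e.isStep).ae (m := m)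
    (P := fun p x => weakGrad m (p.1 • p.2 : X → ℝ) x = |p.1| * weakGrad m p.2 x)
    fun p => weakGrad_smul p.2.2 p.1

theorem norm_le_of_pnorm_le {u : X → ℝ} (hu : MemLp u ∞ m) {e e' : PreCotangent m}
    (h : ∀ᵐ x ∂m, e.pnorm x ≤ |u x| * e'.pnorm x) :
    ‖e‖ ≤ (eLpNorm u ∞ m).toReal * ‖e'‖ := by
  rw [PreCotangent.norm_def, PreCotangent.norm_def, ← ENNReal.toReal_mul]
  refine ENNReal.toReal_mono (ENNReal.mul_ne_top hu.2.ne e'.memLp_pnorm.2.ne) ?_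
  refine le_trans (eLpNorm_mono_ae ?_)
    (eLpNorm_smul_le_eLpNorm_top_mul_eLpNorm 2 e'.memLp_pnorm.1 u)
  filter_upwards [h] with x hx
  rw [Real.norm_of_nonneg (PreCotangent.pnorm_nonneg _ _)]
  refine hx.trans (le_of_eq ?_)
  simp [abs_of_nonneg (PreCotangent.pnorm_nonneg e' x)]

/-- Multiplication by a step function as a continuous linear map. -/
def preStepMulL {s : X → ℝ} (hs : IsStep s) (hb : MemLp s ∞ m) :
    PreCotangent m →L[ℝ] PreCotangent m :=
  LinearMap.mkContinuous
    { toFun := preStepMul hs hb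
      map_add' := fun e e' => Subtype.ext (funext fun x => smul_add (s x) (e.val x) (e'.val x))
      map_smul' := fun c e => Subtype.ext (funext fun x => smul_comm (s x) c (e.val x)) }
    (eLpNorm s ∞ m).toReal
    (fun e => norm_le_of_pnorm_le hb ((pnorm_preStepMul hs hb e).mono fun _ hx => hx.le))

theorem norm_completion_preStepMulL_sub_le {s t : X → ℝ} (hs : IsStep s) (hb : MemLp s ∞ m)
    (ht : IsStep t) (hc : MemLp t ∞ m) :
    ‖(preStepMulL hs hb).completion - (preStepMulL ht hc).completion‖ ≤
      (eLpNorm (s - t) ∞ m).toReal := by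
  refine ContinuousLinearMap.opNorm_le_bound _ ENNReal.toReal_nonneg fun ω => ?_
  induction ω using UniformSpace.Completion.induction_on with
  | hp => exact isClosed_le (by fun_prop) (by fun_prop)
  | ih e =>
    rw [_root_.sub_apply, ContinuousLinearMap.completion_apply_coe,
      ContinuousLinearMap.completion_apply_coe, ← UniformSpace.Completion.coe_sub,
      UniformSpace.Completion.norm_coe, UniformSpace.Completion.norm_coe]
    have hst : IsStep (s - t) := (hs.prodMk ht).comp fun p => p.1 - p.2
    have : preStepMulL hs hb e - preStepMulL ht hc e = preStepMul hst (hb.sub hc) e :=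
      Subtype.ext (funext fun x => (sub_smul (s x) (t x) (e.val x)).symm)
    rw [this]
    exact norm_le_of_pnorm_le (hb.sub hc)
      ((pnorm_preStepMul hst (hb.sub hc) e).mono fun _ hx => hx.le)

/-- Step functions are dense in `L^∞`. -/
theorem exists_isStep_approx {a : X → ℝ} (ha : MemLp a ∞ m) (n : ℕ) :
    ∃ s : X → ℝ, IsStep s ∧ MemLp s ∞ m ∧ (eLpNorm (s - a) ∞ m).toReal ≤ 1 / (n + 1) := by
  obtain ⟨b, hb, hab⟩ := ha.1.aemeasurable
  have hn : (0 : ℝ) < n + 1 := by positivity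
  set s : X → ℝ := fun x => (⌊(n + 1 : ℝ) * b x⌋ : ℝ) / (n + 1) with hs
  have hstep : IsStep s := by
    have hf : Measurable fun x => ⌊(n + 1 : ℝ) * b x⌋ := (hb.const_mul _).floor
    have h1 : IsStep fun x => ⌊(n + 1 : ℝ) * b x⌋ :=
      ⟨to_countable _, fun k => hf (measurableSet_singleton k)⟩
    exact h1.comp fun k : ℤ => (k : ℝ) / (n + 1)
  have hsm : AEStronglyMeasurable s m :=
    (hstep.measurable_eval (G := fun r _ => r) fun r => measurable_const).aestronglyMeasurable
  have hclose : ∀ᵐ x ∂m, ‖(s - a) x‖ ≤ 1 / (n + 1 : ℝ) := by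
    filter_upwards [hab] with x hx
    have h1 := Int.floor_le ((n + 1 : ℝ) * b x)
    have h2 := Int.lt_floor_add_one ((n + 1 : ℝ) * b x)
    rw [Pi.sub_apply, hx, Real.norm_eq_abs]
    have : s x - b x = ((⌊(n + 1 : ℝ) * b x⌋ : ℝ) - (n + 1) * b x) / (n + 1) := by
      simp only [hs]; field_simp
    rw [this, abs_div, abs_of_pos hn]
    gcongr
    rw [abs_le]; constructor <;> linarith
  have hsub : MemLp (s - a) ∞ m := memLp_top_of_bound (hsm.sub ha.1) _ hclose
  refine ⟨s, hstep, ?_, ?_⟩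
  · simpa using hsub.add ha
  · refine ENNReal.toReal_le_of_le_ofReal (by positivity) ?_
    rw [eLpNorm_exponent_top]
    exact eLpNormEssSup_le_of_ae_bound hclose

/-- Multiplication by step functions extends to multiplication by functions in `L^∞`. -/
theorem exists_linftyMul {a : X → ℝ} (ha : MemLp a ∞ m) :
    ∃ T : Cotangent m →L[ℝ] Cotangent m, ∀ (s : X → ℝ) (hs : IsStep s) (hb : MemLp s ∞ m),
      ‖(preStepMulL hs hb).completion - T‖ ≤ (eLpNorm (s - a) ∞ m).toReal := by
  choose s hs hb hc using exists_isStep_approx ha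
  have htri : ∀ (t : X → ℝ) (_ : MemLp t ∞ m) (n : ℕ),
      (eLpNorm (t - s n) ∞ m).toReal ≤ (eLpNorm (t - a) ∞ m).toReal + 1 / (n + 1) := by
    intro t ht n
    rw [← sub_sub_sub_cancel_right t (s n) a]
    refine (ENNReal.toReal_mono (ENNReal.add_ne_top.2 ⟨(ht.sub ha).2.ne, ((hb n).sub ha).2.ne⟩)
      (eLpNorm_sub_le (ht.sub ha).1 ((hb n).sub ha).1 le_top)).trans ?_
    rw [ENNReal.toReal_add (ht.sub ha).2.ne ((hb n).sub ha).2.ne]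
    gcongr
    exact hc n
  have hlim : Tendsto (fun N : ℕ => 1 / ((N : ℝ) + 1) + 1 / ((N : ℝ) + 1)) atTop (𝓝 0) := by
    simpa using (tendsto_one_div_add_atTop_nhds_zero_nat (𝕜 := ℝ)).add
      tendsto_one_div_add_atTop_nhds_zero_nat
  have hcauchy : CauchySeq fun n => (preStepMulL (hs n) (hb n)).completion := by
    refine cauchySeq_of_le_tendsto_0 _ (fun n k N hn hk => ?_) hlim
    rw [dist_eq_norm]
    refine (norm_completion_preStepMulL_sub_le _ _ _ _).trans ((htri _ (hb n) k).trans ?_)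
    refine add_le_add ((hc n).trans ?_) ?_ <;>
      exact one_div_le_one_div_of_le (by positivity) (by gcongr)
  obtain ⟨T, hT⟩ := cauchySeq_tendsto_of_complete hcauchy
  refine ⟨T, fun t ht hb' => ?_⟩
  have h1 : Tendsto (fun n => ‖(preStepMulL ht hb').completion -
      (preStepMulL (hs n) (hb n)).completion‖) atTop
      (𝓝 ‖(preStepMulL ht hb').completion - T‖) := (hT.const_sub _).norm
  have h2 : Tendsto (fun n : ℕ => (eLpNorm (t - a) ∞ m).toReal + 1 / ((n : ℝ) + 1)) atTop
      (𝓝 ((eLpNorm (t - a) ∞ m).toReal + 0)) :=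
    tendsto_one_div_add_atTop_nhds_zero_nat.const_add _
  rw [add_zero] at h2
  exact le_of_tendsto_of_tendsto' h1 h2 fun n =>
    (norm_completion_preStepMulL_sub_le _ _ _ _).trans (htri t hb' n)

open Classical in
/-- The multiplication `ω ↦ a ω` of `L²(T*M)` by a function `a ∈ L^∞(m)` (and `0` for other `a`):
the operator that is the limit of the multiplications by step functions approximating `a`. -/
def linftyMul (m : Measure X) (a : X → ℝ) : Cotangent m →L[ℝ] Cotangent m :=
  if h : MemLp a ∞ m then (exists_linftyMul h).choose else 0

theorem linftyMul_spec {a : X → ℝ} (ha : MemLp a ∞ m) {s : X → ℝ} (hs : IsStep s)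
    (hb : MemLp s ∞ m) :
    ‖(preStepMulL hs hb).completion - linftyMul m a‖ ≤ (eLpNorm (s - a) ∞ m).toReal := by
  rw [linftyMul, dif_pos ha]
  exact (exists_linftyMul ha).choose_spec s hs hb

/-- The tangent module `L²(TM) = Hom_{L^∞}(L²(T*M), L¹(m))`: the continuous linear maps
`V : L²(T*M) → L¹(m)` with `V (a ω) = a V(ω)` for `a ∈ L^∞(m)`. -/
def Tangent (m : Measure X) : Submodule ℝ (Cotangent m →L[ℝ] Lp ℝ 1 m) where
  carrier := {V | ∀ a, MemLp a ∞ m → ∀ ω, ∀ᵐ x ∂m, V (linftyMul m a ω) x = a x * V ω x}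
  add_mem' {V W} hV hW a ha ω := by
    filter_upwards [hV a ha ω, hW a ha ω, Lp.coeFn_add (V (linftyMul m a ω)) (W (linftyMul m a ω)),
      Lp.coeFn_add (V ω) (W ω)] with x h1 h2 h3 h4
    rw [_root_.add_apply, _root_.add_apply, h3, h4, Pi.add_apply,
      Pi.add_apply, h1, h2, mul_add]
  zero_mem' a ha ω := by
    filter_upwards [Lp.coeFn_zero ℝ 1 m] with x h1
    rw [_root_.zero_apply, _root_.zero_apply, h1]
    simp
  smul_mem' c V hV a ha ω := by
    filter_upwards [hV a ha ω, Lp.coeFn_smul c (V (linftyMul m a ω)), Lp.coeFn_smul c (V ω)]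
      with x h1 h2 h3
    rw [_root_.smul_apply, _root_.smul_apply, h2, h3, Pi.smul_apply,
      Pi.smul_apply, h1, smul_eq_mul, smul_eq_mul, mul_left_comm]

/-- The product `a V` of `a ∈ L^∞(m)` and `V ∈ L²(TM)`: `(a V)(ω) = a V(ω) = V(a ω)`. -/
def tangentMul (a : X → ℝ) (V : Tangent m) : Tangent m :=
  ⟨(V : Cotangent m →L[ℝ] Lp ℝ 1 m) ∘L linftyMul m a, by
    intro b hb ω
    by_cases ha : MemLp a ∞ m
    · filter_upwards [V.2 a ha (linftyMul m b ω), V.2 b hb ω, V.2 a ha ω] with x h1 h2 h3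
      rw [ContinuousLinearMap.comp_apply, ContinuousLinearMap.comp_apply, h1, h2, h3,
        mul_left_comm]
    · have h0 : linftyMul m a = 0 := dif_neg ha
      filter_upwards [Lp.coeFn_zero ℝ 1 m] with x h1
      simp only [h0, ContinuousLinearMap.comp_zero, _root_.zero_apply, h1]
      simp⟩

/-- `V ∈ L²(TM)` and `ω ∈ L²(T*M)` correspond to each other under the Riesz theorem:
`V(η) = ⟨ω, η⟩` for all `η`. -/
def IsRieszDual (ω : Cotangent m) (V : Tangent m) : Prop :=
  ∀ η, ∀ᵐ x ∂m, (V : Cotangent m →L[ℝ] Lp ℝ 1 m) η x = cotangentInner ω η x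

/-- The Riesz theorem holds for `L²(T*M)`: the relation `IsRieszDual` is a bijection between
`L²(T*M)` and `L²(TM)`. -/
def RieszCorrespondence (m : Measure X) : Prop :=
  (∀ ω : Cotangent m, ∃! V : Tangent m, IsRieszDual ω V) ∧
    ∀ V : Tangent m, ∃! ω : Cotangent m, IsRieszDual ω V

open Classical in
/-- The element of `L²(TM)` that corresponds to `ω ∈ L²(T*M)` (`0` if there is none). -/
def sharp (ω : Cotangent m) : Tangent m :=
  if h : ∃ V : Tangent m, IsRieszDual ω V then h.choose else 0

open Classical in
/-- The element of `L²(T*M)` that corresponds to `V ∈ L²(TM)` (`0` if there is none). -/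
def flat (V : Tangent m) : Cotangent m :=
  if h : ∃ ω : Cotangent m, IsRieszDual ω V then h.choose else 0

/-- The gradient `∇f ∈ L²(TM)`, the element that corresponds to `df`. -/
def tangentGradient (m : Measure X) (f : sobolevSpace m) : Tangent m := sharp (differential m f)

/-- The pointwise inner product of `L²(TM)`, inherited from `L²(T*M)`. -/
def tangentInner (V W : Tangent m) (x : X) : ℝ := cotangentInner (flat V) (flat W) x

end Sobolev

section Identification

variable {X : Type*} [MetricSpace X] [MeasurableSpace X] [BorelSpace X]

/-- The standing assumptions on the measure: `supp m = X`, and `m (B_r(x)) < c₁ exp (c₂ r²)` for all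
`r > 0`, for some `c₁, c₂ ≥ 0` and some point `x`. -/
def IsAdmissibleMeasure (m : Measure X) : Prop :=
  m.support = univ ∧ ∃ c₁ c₂ : ℝ, 0 ≤ c₁ ∧ 0 ≤ c₂ ∧ ∃ x : X, ∀ r : ℝ, 0 < r →
    m (Metric.ball x r) < ENNReal.ofReal (c₁ * Real.exp (c₂ * r ^ 2))

/-- `ι` is the canonical identification of `L²(T*M)` and `L²(T*M')`, `M' = (X, e^w d, e^v m)`: it is
linear over `L^∞` and maps the differential of a function to the differential of the same
function. -/
structure IsCotangentIdentification [GeodesicSpace X] (m : Measure X) (w v : X →ᵇ ℝ)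
    (ι : Cotangent m ≃L[ℝ] Cotangent (conformalMeasure w v m)) : Prop where
  map_differential : ∀ (f : X → ℝ) (hf : f ∈ sobolevSpace m)
    (hf' : f ∘ (toConformal w).symm ∈ sobolevSpace (conformalMeasure w v m)),
    ι (differential m ⟨f, hf⟩) = differential (conformalMeasure w v m) ⟨_, hf'⟩
  map_mul : ∀ a : X → ℝ, MemLp a ∞ m → ∀ ω : Cotangent m,
    ι (linftyMul m a ω) = linftyMul (conformalMeasure w v m) (a ∘ (toConformal w).symm) (ι ω)

/-- `J` is the identification of `L²(TM)` and `L²(TM')` dual to `ι`: a vector field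
`V : L²(T*M) → L¹(m)` and its image are the same map, i.e. `(J V)(ι ω) = V(ω)`. -/
def IsTangentIdentification [GeodesicSpace X] (m : Measure X) (w v : X →ᵇ ℝ)
    (ι : Cotangent m ≃L[ℝ] Cotangent (conformalMeasure w v m))
    (J : Tangent m ≃L[ℝ] Tangent (conformalMeasure w v m)) : Prop :=
  ∀ (V : Tangent m) (ω : Cotangent m), ∀ᵐ x ∂m,
    (J V : Cotangent (conformalMeasure w v m) →L[ℝ] Lp ℝ 1 (conformalMeasure w v m)) (ι ω)
      (toConformal w x) = (V : Cotangent m →L[ℝ] Lp ℝ 1 m) ω x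

end Identification

end

noncomputable section

/-! ### The distance `e^w d` at small scales and the local Lipschitz constant -/

section ConformalDistance

variable {X : Type*} [MetricSpace X]

/-! Everything rests on the pointwise identity `|D'f| = e^{-w} |Df|`. Since `w` is continuous, the
distance `e^w d` to a point `x` is close to `e^{w(x)} d` near `x`, with a ratio tending to 1
(`eventually_dist_toConformal`). Hence local Lipschitz constants are multiplied by exactly `e^{-w}`
(`lipReal_comp_toConformal_symm`). As `w` and `v` are bounded, multiplication by `e^{±w}` and the
change of measure are bounded in `L²`, so approximating Lipschitz functions serve both spaces.
Minimality on each side then gives `W^{1,2}(M) = W^{1,2}(M')` and the identity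
(`weakGrad_conformalMeasure`). The density `e^v` affects integrals only, never pointwise norms.

The delicate point is that infinitesimal Hilbertianity is an integrated condition, while passing to
`M'` inserts a variable weight. It has to be localized to a parallelogram law for `|D ·|` almost
everywhere (`InfinitesimallyHilbertian.parallelogramDefect_eq_zero`). For this, `f` and `g` are
folded by a sawtooth with values in `[0, δ]`. The folded functions are locally `±f` and `±g` plus
constants, so by locality (`MemSobolev.weakGrad_eq_zero`) the defect in the parallelogram law is
unchanged. After multiplication by a Lipschitz cutoff `χ`, the Leibniz error is proportional to the
size of the folded functions and vanishes as `δ → 0`. The integrated law for these products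
therefore yields that `χ²` times the defect has integral zero, and enough cutoffs are available to
conclude that the defect vanishes. A pointwise law is only multiplied by `e^{-2w}` on `M'`, and
integrating it there gives the Hilbertian property of `M'`.

On the cotangent module the pointwise law extends by density and polarizes to an `L¹`-valued inner
product, linear over `L^∞`. The Riesz correspondence follows from the Hilbert space theorem for the
integrated product, localized by testing with indicator functions. Sending a family `{(B_i, f_i)}`
to itself extends to the identification `cotangentTransfer`. It is the only one, because a family
coincides on each of its countably many pieces with a differential, and families are dense. Tangent
vectors, being maps into `L¹`, are transported along it.

The formulas are then algebra. On cotangent modules `⟨·,·⟩' = e^{-2w} ⟨·,·⟩`, which puts the factor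
`e^{-2w}` in front of the gradient. The covector dual to the image of `V` is the image of `e^{2w}`
times the one dual to `V`, and the tangent product acquires `e^{-2w} (e^{2w})² = e^{2w}`. -/

theorem enorm_deriv_le_metricSpeed {γ : ℝ → X} {φ : ℝ → ℝ}
    (hφ : ∀ s t, dist (φ s) (φ t) ≤ dist (γ s) (γ t)) (t : ℝ) :
    ‖deriv φ t‖ₑ ≤ metricSpeed γ t := by
  by_cases hd : DifferentiableAt ℝ φ t
  · have h1 : Tendsto (fun s => ‖slope φ t s‖ₑ) (𝓝[≠] t) (𝓝 ‖deriv φ t‖ₑ) :=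
      (continuous_enorm.tendsto _).comp (hasDerivAt_iff_tendsto_slope.1 hd.hasDerivAt)
    rw [← h1.limsup_eq]
    refine limsup_le_limsup ?_
    filter_upwards [self_mem_nhdsWithin] with s hs
    have hs : s ≠ t := hs
    rw [slope_def_field, Real.enorm_eq_ofReal_abs, abs_div, ENNReal.ofReal_div_of_pos
      (abs_pos.2 (sub_ne_zero.2 hs)), edist_dist, edist_dist, ← Real.dist_eq, ← Real.dist_eq]
    gcongr
    exact hφ _ _
  · simp [deriv_zero_of_not_differentiableAt hd]

theorem dist_min_dist_le (x y z : X) (δ : ℝ) :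
    dist (min (dist y x) δ) (min (dist z x) δ) ≤ dist y z := by
  rw [Real.dist_eq]
  refine (abs_min_sub_min_le_max _ _ _ _).trans ?_
  simpa using abs_dist_sub_le y z x

theorem absolutelyContinuousOnInterval_min_dist {γ : ℝ → X} {a b : ℝ}
    (hγ : AbsolutelyContinuousOnInterval γ a b) (x : X) (δ : ℝ) :
    AbsolutelyContinuousOnInterval (fun t => min (dist (γ t) x) δ) a b :=
  squeeze_zero (fun _ => Finset.sum_nonneg fun _ _ => dist_nonneg)
    (fun _ => Finset.sum_le_sum fun _ _ => dist_min_dist_le _ _ _ _) hγ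

/-- Inside the ball the weight is at least `e^a` and truncating the distance does not increase
speed. Outside the closed ball the truncated distance is locally constant along the curve, so its
derivative vanishes and no information on `w` is needed. -/
theorem ofReal_exp_mul_enorm_deriv_le (w : X →ᵇ ℝ) {x : X} {a δ : ℝ}
    (h : ∀ z ∈ Metric.closedBall x δ, a ≤ w z) {γ : ℝ → X}
    (hγ : ContinuousOn (fun t => dist (γ t) x) (uIcc 0 1))
    {t : ℝ} (ht : t ∈ Ioo (0 : ℝ) 1) :
    ENNReal.ofReal (Real.exp a) * ‖deriv (fun t => min (dist (γ t) x) δ) t‖ₑ ≤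
      metricSpeed γ t * ENNReal.ofReal (Real.exp (w (γ t))) := by
  by_cases hball : γ t ∈ Metric.closedBall x δ
  · rw [mul_comm]
    exact mul_le_mul' (enorm_deriv_le_metricSpeed (fun s t => dist_min_dist_le _ _ _ _) t)
      (ENNReal.ofReal_le_ofReal (Real.exp_le_exp.2 (h _ hball)))
  · have hct : ContinuousAt (fun t => dist (γ t) x) t :=
      hγ.continuousAt (by rw [uIcc_of_le zero_le_one]; exact Icc_mem_nhds ht.1 ht.2)
    have hev : (fun t => min (dist (γ t) x) δ) =ᶠ[𝓝 t] fun _ => δ := by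
      filter_upwards [hct.eventually (lt_mem_nhds (not_le.1 hball))] with s hs
      exact min_eq_right (le_of_lt hs)
    rw [hev.deriv_eq]
    simp

theorem ofReal_exp_mul_enorm_integral_deriv_le (w : X →ᵇ ℝ) {a : ℝ} {γ : ℝ → X} {φ : ℝ → ℝ}
    (h : ∀ t ∈ Ioo (0 : ℝ) 1, ENNReal.ofReal (Real.exp a) * ‖deriv φ t‖ₑ ≤
      metricSpeed γ t * ENNReal.ofReal (Real.exp (w (γ t)))) :
    ENNReal.ofReal (Real.exp a) * ‖∫ t in (0 : ℝ)..1, deriv φ t‖ₑ ≤ conformalLength w γ := by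
  rw [intervalIntegral.integral_of_le zero_le_one, conformalLength_eq_Ioo,
    ← setIntegral_congr_set (Ioo_ae_eq_Ioc (μ := volume) (a := (0 : ℝ)) (b := 1))]
  calc _ ≤ ENNReal.ofReal (Real.exp a) * ∫⁻ t in Ioo (0 : ℝ) 1, ‖deriv φ t‖ₑ :=
        mul_le_mul_right (enorm_integral_le_lintegral_enorm _) _
    _ = ∫⁻ t in Ioo (0 : ℝ) 1, ENNReal.ofReal (Real.exp a) * ‖deriv φ t‖ₑ :=
        (lintegral_const_mul' _ _ ENNReal.ofReal_ne_top).symm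
    _ ≤ _ := setLIntegral_mono' measurableSet_Ioo h

/-- If `w ≥ a` on the closed ball of radius `δ` about `x`, then curves ending at `x` have weighted
length at least `e^a` times the truncated distance of their end points. -/
theorem ofReal_exp_mul_min_le_conformalEDist (w : X →ᵇ ℝ) {x : X} {a δ : ℝ} (hδ : 0 ≤ δ)
    (h : ∀ z ∈ Metric.closedBall x δ, a ≤ w z) (y : X) :
    ENNReal.ofReal (Real.exp a) * ENNReal.ofReal (min (dist y x) δ) ≤ conformalEDist w y x := by
  refine le_iInf₂ fun γ hγ => ?_
  obtain ⟨hγ, h0, hx⟩ := hγ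
  -- Truncating at `δ` takes care of curves that leave the ball: no exit time has to be chosen, and
  -- the truncated distance still drops from `min (d(y, x)) δ` to `0`.
  have hac := absolutelyContinuousOnInterval_min_dist hγ x δ
  have hft := hac.integral_deriv_eq_sub
  rw [h0, hx, dist_self, min_eq_left hδ, zero_sub] at hft
  have h1 : ENNReal.ofReal (min (dist y x) δ) =
      ‖∫ t in (0 : ℝ)..1, deriv (fun t => min (dist (γ t) x) δ) t‖ₑ := by
    rw [hft, enorm_neg, Real.enorm_eq_ofReal (le_min dist_nonneg hδ)]
  have hdist : AbsolutelyContinuousOnInterval (fun t => dist (γ t) x) 0 1 :=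
    squeeze_zero (fun _ => Finset.sum_nonneg fun _ _ => dist_nonneg)
      (fun _ => Finset.sum_le_sum fun _ _ => by
        rw [Real.dist_eq]; exact abs_dist_sub_le _ _ _) hγ
  rw [h1]
  exact ofReal_exp_mul_enorm_integral_deriv_le w fun t ht =>
    ofReal_exp_mul_enorm_deriv_le w h hdist.continuousOn ht

/-- If `w ≤ a` on the closed ball of radius `d(y, x)` about `x`, then `e^w d (y, x) ≤ e^a d (y, x)`. -/
theorem conformalEDist_le_of_le_on_closedBall [GeodesicSpace X] (w : X →ᵇ ℝ) {x y : X} {a : ℝ}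
    (h : ∀ z ∈ Metric.closedBall x (dist y x), w z ≤ a) :
    conformalEDist w y x ≤ ENNReal.ofReal (Real.exp a) * edist y x := by
  obtain ⟨γ, h0, h1, hγ⟩ := GeodesicSpace.exists_geodesic y x
  have hac : AbsolutelyContinuousOnInterval γ 0 1 := by
    refine LipschitzOnWith.absolutelyContinuousOnInterval (K := nndist y x) ?_
    rw [uIcc_of_le zero_le_one]
    refine LipschitzOnWith.of_dist_le_mul fun s hs t ht => ?_
    rw [hγ s hs t ht, Real.dist_eq, mul_comm, coe_nndist]
  refine (iInf₂_le γ ⟨hac, h0, h1⟩).trans ?_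
  rw [conformalLength_eq_Ioo]
  calc _ ≤ ∫⁻ t in Ioo (0 : ℝ) 1, edist y x * ENNReal.ofReal (Real.exp a) := by
        refine setLIntegral_mono' measurableSet_Ioo fun t ht => ?_
        gcongr
        · refine limsup_le_of_le (h := ?_)
          filter_upwards [self_mem_nhdsWithin,
            nhdsWithin_le_nhds (Icc_mem_nhds ht.1 ht.2)] with s hs hs'
          rw [edist_dist, hγ s hs' t ⟨ht.1.le, ht.2.le⟩, ENNReal.ofReal_mul (abs_nonneg _),
            ← Real.dist_eq, ← edist_dist, ← edist_dist, mul_comm, mul_div_assoc]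
          exact mul_le_of_le_one_right' ENNReal.div_self_le_one
        · refine h _ ?_
          -- The geodesic ends at `x`, so its point at time `t` lies at distance `(1 - t) d(y, x)`
          -- from `x` and stays in the ball.
          have := hγ t ⟨ht.1.le, ht.2.le⟩ 1 ⟨zero_le_one, le_rfl⟩
          rw [h1] at this
          rw [Metric.mem_closedBall, this, abs_of_nonpos (by linarith [ht.2])]
          exact mul_le_of_le_one_left dist_nonneg (by linarith [ht.1])
    _ = _ := by simp [mul_comm]

variable [GeodesicSpace X]

theorem ConformalSpace.dist_eq (w : X →ᵇ ℝ) (x y : X) :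
    dist (toConformal w x) (toConformal w y) = (conformalEDist w x y).toReal := by
  rw [dist_edist, ConformalSpace.edist_eq]

/-- Near `x`, the distance `e^w d` to `x` is comparable to `e^{w(x)} d`. -/
theorem eventually_dist_toConformal (w : X →ᵇ ℝ) (x : X) {ε : ℝ} (hε : 0 < ε) :
    ∀ᶠ y in 𝓝 x, Real.exp (w x - ε) * dist y x ≤ dist (toConformal w y) (toConformal w x) ∧
      dist (toConformal w y) (toConformal w x) ≤ Real.exp (w x + ε) * dist y x := by
  have hw : ∀ᶠ z in 𝓝 x, |w z - w x| < ε := by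
    have := (w.continuous.tendsto x).eventually (Metric.ball_mem_nhds (w x) hε)
    simpa [Real.dist_eq] using this
  obtain ⟨δ, hδ, hball⟩ := Metric.nhds_basis_closedBall.eventually_iff.1 hw
  filter_upwards [Metric.closedBall_mem_nhds x hδ] with y hy
  have hfin : conformalEDist w y x ≠ ∞ := by
    rw [← ConformalSpace.edist_eq]; exact edist_ne_top _ _
  rw [ConformalSpace.dist_eq]
  constructor
  · have h1 := ofReal_exp_mul_min_le_conformalEDist w (x := x) (a := w x - ε) hδ.le
      (fun z hz => by linarith [(abs_lt.1 (hball hz)).1]) y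
    rw [min_eq_left hy, ← ENNReal.ofReal_mul (Real.exp_pos _).le] at h1
    exact (ENNReal.ofReal_le_iff_le_toReal hfin).1 h1
  · have h1 := conformalEDist_le_of_le_on_closedBall w (x := x) (y := y) (a := w x + ε)
      (fun z hz => by
        linarith [(abs_lt.1 (hball (Metric.closedBall_subset_closedBall hy hz))).2])
    rw [edist_dist, ← ENNReal.ofReal_mul (Real.exp_pos _).le] at h1
    exact ENNReal.toReal_le_of_le_ofReal (by positivity) h1

/-- The identity map is bi-Lipschitz between the two distances, with constant `e^{‖w‖}` both ways.
-/
theorem isLip_comp_toConformal_symm_iff (w : X →ᵇ ℝ) {f : X → ℝ} :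
    IsLip (f ∘ (toConformal w).symm) ↔ IsLip f := by
  have h1 : LipschitzWith (Real.exp ‖w‖).toNNReal (toConformal w) := fun x y => by
    rw [ConformalSpace.edist_eq]; exact conformalEDist_le_exp_mul_edist w x y
  have h2 : AntilipschitzWith (Real.exp ‖w‖).toNNReal (toConformal w) := fun x y => by
    rw [ConformalSpace.edist_eq]
    refine le_trans (le_of_eq ?_) (mul_le_mul_right
      (exp_neg_mul_edist_le_conformalEDist w x y) (ENNReal.ofReal (Real.exp ‖w‖)))
    rw [← mul_assoc, ← ENNReal.ofReal_mul (Real.exp_pos _).le, ← Real.exp_add]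
    simp
  constructor
  · rintro ⟨K, hK⟩
    exact ⟨_, hK.comp h1⟩
  · rintro ⟨K, hK⟩
    exact ⟨_, hK.comp (h2.to_rightInverse (toConformal w).right_inv)⟩

/-- The local Lipschitz constant with respect to `e^w d` is `e^{-w}` times the one with respect
to `d`. -/
theorem lipReal_comp_toConformal_symm (w : X →ᵇ ℝ) {f : X → ℝ} (hf : IsLip f) (x : X) :
    lipReal (f ∘ (toConformal w).symm) (toConformal w x) = Real.exp (-w x) * lipReal f x := by
  have hf' : IsLip (f ∘ (toConformal w).symm) := (isLip_comp_toConformal_symm_iff w).2 hf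
  -- A strict inequality survives a small change of the exponent, which leaves room for the factor
  -- `e^{±ε}` by which `e^w d` may differ from `e^{w(x)} d` near `x`.
  have hsmall : ∀ a b : ℝ, ∀ g : ℝ → ℝ, Continuous g → a < b * g 0 → ∃ ε > 0, a < b * g ε := by
    intro a b g hg hab
    have h0 : ∀ᶠ ε in 𝓝 (0 : ℝ), a < b * g ε :=
      continuousAt_const.eventually_lt ((hg.const_mul b).continuousAt) hab
    have h1 : ∀ᶠ ε in 𝓝[>] (0 : ℝ), a < b * g ε := h0.filter_mono nhdsWithin_le_nhds
    obtain ⟨ε, h2, h3⟩ := (h1.and self_mem_nhdsWithin).exists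
    exact ⟨ε, h3, h2⟩
  refine le_antisymm ?_ ?_
  · refine lipReal_le (mul_nonneg (Real.exp_pos _).le (lipReal_nonneg _ _)) fun c hc => ?_
    have hc0 : 0 ≤ c := (mul_nonneg (Real.exp_pos _).le (lipReal_nonneg f x)).trans hc.le
    obtain ⟨ε, hε, hlt⟩ := hsmall (lipReal f x) c (fun ε => Real.exp (w x - ε)) (by fun_prop) (by
      rw [Real.exp_neg] at hc
      have := (inv_mul_lt_iff₀ (Real.exp_pos (w x))).1 hc
      simpa [mul_comm] using this)
    have hev := (hf.eventually_le hlt).and (eventually_dist_toConformal w x hε)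
    have ht : Tendsto (toConformal w).symm (𝓝 (toConformal w x)) (𝓝 x) :=
      (continuous_toConformal_symm w).tendsto (toConformal w x)
    filter_upwards [ht.eventually hev] with y hy
    calc |f ((toConformal w).symm y) - f x|
        ≤ c * Real.exp (w x - ε) * dist ((toConformal w).symm y) x := hy.1
      _ = c * (Real.exp (w x - ε) * dist ((toConformal w).symm y) x) := by ring
      _ ≤ _ := mul_le_mul_of_nonneg_left hy.2.1 hc0
  · rw [Real.exp_neg, inv_mul_le_iff₀ (Real.exp_pos _)]
    refine lipReal_le (mul_nonneg (Real.exp_pos _).le (lipReal_nonneg _ _)) fun c hc => ?_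
    have hc0 : 0 ≤ c := (mul_nonneg (Real.exp_pos _).le (lipReal_nonneg _ _)).trans hc.le
    obtain ⟨ε, hε, hlt⟩ := hsmall (lipReal (f ∘ (toConformal w).symm) (toConformal w x)) c
      (fun ε => Real.exp (-(w x + ε))) (by fun_prop) (by
        have h1 := (lt_inv_mul_iff₀ (Real.exp_pos (w x))).2 hc
        rw [← Real.exp_neg] at h1
        simpa [mul_comm] using h1)
    have ht := ((continuous_toConformal w).tendsto x).eventually (hf'.eventually_le hlt)
    filter_upwards [ht, eventually_dist_toConformal w x hε] with y hy1 hy2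
    calc |f y - f x| ≤ c * Real.exp (-(w x + ε)) * dist (toConformal w y) (toConformal w x) := hy1
      _ ≤ c * Real.exp (-(w x + ε)) * (Real.exp (w x + ε) * dist y x) := by
          gcongr; exact hy2.2
      _ = c * dist y x * (Real.exp (-(w x + ε)) * Real.exp (w x + ε)) := by ring
      _ = c * dist y x := by rw [← Real.exp_add]; simp

end ConformalDistance

/-! ### Null sets and `L^p` spaces of the weighted measure -/

section ConformalMeasure

variable {X : Type*} [MetricSpace X] [MeasurableSpace X] [BorelSpace X]

/-- The identity map from `X` to `(X, e^w d)`, as a measurable equivalence. -/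
def toConformalMeasurable (w : X →ᵇ ℝ) : X ≃ᵐ ConformalSpace w where
  toEquiv := toConformal w
  -- The σ-algebra on `ConformalSpace w` is by definition that of `X`.
  measurable_toFun := measurable_id
  measurable_invFun := measurable_id

theorem measurable_toConformal (w : X →ᵇ ℝ) : Measurable (toConformal w) :=
  (toConformalMeasurable w).measurable

theorem measurable_toConformal_symm (w : X →ᵇ ℝ) : Measurable (toConformal w).symm :=
  (toConformalMeasurable w).symm.measurable

/-- The density `e^v` lies between `e^{-‖v‖}` and `e^{‖v‖}`; this bound and its reverse make the
null sets and the `L^p` spaces of the two measures agree. -/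
theorem conformalMeasure_le (w v : X →ᵇ ℝ) (m : Measure X) :
    conformalMeasure w v m ≤ ENNReal.ofReal (Real.exp ‖v‖) • m.map (toConformal w) := by
  rw [conformalMeasure, ← Measure.map_smul]
  refine Measure.map_mono ?_ (measurable_toConformal w)
  rw [← withDensity_const]
  refine withDensity_mono (Eventually.of_forall fun x => ?_)
  exact ENNReal.ofReal_le_ofReal (Real.exp_le_exp.2 (abs_le.1 (v.norm_coe_le_norm x)).2)

theorem le_conformalMeasure (w v : X →ᵇ ℝ) (m : Measure X) :
    m.map (toConformal w) ≤ ENNReal.ofReal (Real.exp ‖v‖) • conformalMeasure w v m := by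
  rw [conformalMeasure, ← Measure.map_smul]
  refine Measure.map_mono ?_ (measurable_toConformal w)
  rw [← withDensity_smul' _ _ ENNReal.ofReal_ne_top]
  conv_lhs => rw [← withDensity_one (μ := m)]
  refine withDensity_mono (Eventually.of_forall fun x => ?_)
  simp only [Pi.one_apply, Pi.smul_apply, smul_eq_mul]
  rw [← ENNReal.ofReal_mul (Real.exp_pos _).le, ← Real.exp_add, ENNReal.one_le_ofReal]
  refine Real.one_le_exp ?_
  linarith [(abs_le.1 (v.norm_coe_le_norm x)).1]

theorem ae_conformalMeasure_iff {w v : X →ᵇ ℝ} {m : Measure X} {P : ConformalSpace w → Prop} :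
    (∀ᵐ y ∂conformalMeasure w v m, P y) ↔ ∀ᵐ x ∂m, P (toConformal w x) := by
  have h1 : conformalMeasure w v m ≪ m.map (toConformal w) :=
    Measure.absolutelyContinuous_of_le_smul (conformalMeasure_le w v m)
  have h2 : m.map (toConformal w) ≪ conformalMeasure w v m :=
    Measure.absolutelyContinuous_of_le_smul (le_conformalMeasure w v m)
  have h3 : (∀ᵐ y ∂m.map (toConformal w), P y) ↔ ∀ᵐ x ∂m, P (toConformal w x) :=
    (toConformalMeasurable w).measurableEmbedding.ae_map_iff
  rw [← h3]
  exact ⟨fun h => h2.ae_le h, fun h => h1.ae_le h⟩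

theorem eLpNorm_conformalMeasure_le (w v : X →ᵇ ℝ) (m : Measure X) (f : X → ℝ) (p : ℝ≥0∞) :
    eLpNorm (f ∘ (toConformal w).symm) p (conformalMeasure w v m) ≤
      ENNReal.ofReal (Real.exp ‖v‖) ^ (1 / p).toReal * eLpNorm f p m := by
  refine (eLpNorm_le_of_measure_le_smul (conformalMeasure_le w v m)).trans (le_of_eq ?_)
  congr 1
  exact ((toConformalMeasurable w).measurableEmbedding.eLpNorm_map_measure).trans (by
    congr 1)

theorem eLpNorm_comp_toConformal_le {w v : X →ᵇ ℝ} {m : Measure X} (f : ConformalSpace w → ℝ)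
    (p : ℝ≥0∞) : eLpNorm (f ∘ toConformal w) p m ≤ ENNReal.ofReal (Real.exp ‖v‖) ^ (1 / p).toReal *
      eLpNorm f p (conformalMeasure w v m) :=
  le_trans (le_of_eq
    ((toConformalMeasurable w).measurableEmbedding.eLpNorm_map_measure (g := f)).symm)
    (eLpNorm_le_of_measure_le_smul (le_conformalMeasure w v m))

theorem memLp_conformalMeasure_iff {w v : X →ᵇ ℝ} {m : Measure X} {f : X → ℝ} {p : ℝ≥0∞} :
    MemLp (f ∘ (toConformal w).symm) p (conformalMeasure w v m) ↔ MemLp f p m := by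
  have h : MemLp (f ∘ (toConformal w).symm) p (m.map (toConformal w)) ↔ MemLp f p m :=
    (toConformalMeasurable w).memLp_map_measure_iff
  rw [← h]
  exact ⟨fun h => h.of_measure_le_smul ENNReal.ofReal_ne_top (le_conformalMeasure w v m),
    fun h => h.of_measure_le_smul ENNReal.ofReal_ne_top (conformalMeasure_le w v m)⟩

theorem MeasureTheory.MemLp.comp_toConformal {w v : X →ᵇ ℝ} {m : Measure X}
    {f : ConformalSpace w → ℝ} {p : ℝ≥0∞} (h : MemLp f p (conformalMeasure w v m)) :
    MemLp (f ∘ toConformal w) p m :=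
  (memLp_conformalMeasure_iff (f := f ∘ toConformal w)).1 h

end ConformalMeasure

/-! ### Sobolev functions and minimal gradients of `M'` -/

section ConformalSobolev

variable {X : Type*} [MetricSpace X] [MeasurableSpace X] [BorelSpace X] {m : Measure X}

theorem MeasureTheory.MemLp.exp_mul {f : X → ℝ} {p : ℝ≥0∞} (hf : MemLp f p m) (u : X →ᵇ ℝ) :
    MemLp (fun x => Real.exp (u x) * f x) p m := by
  refine hf.of_le_mul (c := Real.exp ‖u‖)
    ((Real.continuous_exp.comp u.continuous).measurable.aestronglyMeasurable.mul hf.1)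
    (Eventually.of_forall fun x => ?_)
  rw [norm_mul, Real.norm_of_nonneg (Real.exp_pos _).le]
  gcongr
  exact (abs_le.1 (u.norm_coe_le_norm x)).2

theorem eLpNorm_exp_mul_le (f : X → ℝ) (p : ℝ≥0∞) (u : X →ᵇ ℝ) :
    eLpNorm (fun x => Real.exp (u x) * f x) p m ≤
      ENNReal.ofReal (Real.exp ‖u‖) * eLpNorm f p m := by
  refine eLpNorm_le_mul_eLpNorm_of_ae_le_mul (Eventually.of_forall fun x => ?_) p
  rw [norm_mul, Real.norm_of_nonneg (Real.exp_pos _).le]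
  gcongr
  exact (abs_le.1 (u.norm_coe_le_norm x)).2

variable [GeodesicSpace X] {w v : X →ᵇ ℝ} {f G : X → ℝ}

theorem exists_pos_mul_le {C ε : ℝ≥0∞} (hC : C ≠ ∞) (hε : 0 < ε) : ∃ δ > 0, δ ≤ ε ∧ C * δ ≤ ε := by
  refine ⟨ε / (C + 1), ENNReal.div_pos hε.ne' (by finiteness),
    ENNReal.div_le_of_le_mul (le_mul_of_one_le_right' le_add_self), ?_⟩
  calc C * (ε / (C + 1)) ≤ (C + 1) * (ε / (C + 1)) := by gcongr; exact le_self_add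
    _ = ε := ENNReal.mul_div_cancel (by simp) (by finiteness)

/-- An approximating pair `(F, h)` on `M` becomes `(F, e^{-w} h)` on `M'`, because local Lipschitz
constants scale by `e^{-w}`. The bounded weight and the bounded density cost one constant each,
absorbed in the choice of `δ`. -/
theorem IsUpperRelaxed.comp_toConformal_symm (h : IsUpperRelaxed m f G) :
    IsUpperRelaxed (conformalMeasure w v m) (f ∘ (toConformal w).symm)
      ((fun x => Real.exp (-w x) * G x) ∘ (toConformal w).symm) := by
  intro ε hε
  set C : ℝ≥0∞ := ENNReal.ofReal (Real.exp ‖v‖) ^ (1 / 2 : ℝ≥0∞).toReal with hC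
  have hCt : C ≠ ∞ := ENNReal.rpow_ne_top_of_nonneg ENNReal.toReal_nonneg ENNReal.ofReal_ne_top
  set D : ℝ≥0∞ := ENNReal.ofReal (Real.exp ‖-w‖)
  have hDt : D ≠ ∞ := ENNReal.ofReal_ne_top
  obtain ⟨δ₁, hδ₁, -, h1⟩ := exists_pos_mul_le hCt hε
  obtain ⟨δ, hδ, hle, h2⟩ := exists_pos_mul_le hDt hδ₁
  obtain ⟨F, u, a, b, c, d, e, i⟩ := h δ hδ
  refine ⟨F ∘ (toConformal w).symm,
    (fun x => Real.exp (-w x) * u x) ∘ (toConformal w).symm,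
    (isLip_comp_toConformal_symm_iff w).2 a, memLp_conformalMeasure_iff.2 b,
    memLp_conformalMeasure_iff.2 (c.exp_mul (-w)), ?_, ?_, ?_⟩
  · rw [ae_conformalMeasure_iff]
    filter_upwards [d] with x hx
    rw [lipReal_comp_toConformal_symm w a]
    exact mul_le_mul_of_nonneg_left hx (Real.exp_pos _).le
  · exact (eLpNorm_conformalMeasure_le w v m (F - f) 2).trans
      ((mul_le_mul_right (e.trans hle) _).trans h1)
  · refine (eLpNorm_conformalMeasure_le w v m
      ((fun x => Real.exp (-w x) * u x) - (fun x => Real.exp (-w x) * G x)) 2).trans ?_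
    refine (mul_le_mul_right ?_ _).trans h1
    refine le_trans (le_of_eq ?_) ((eLpNorm_exp_mul_le (u - G) 2 (-w)).trans
      ((mul_le_mul_right i _).trans h2))
    congr 1
    funext x
    simp [mul_sub]

/-- The same argument backwards, with `e^w` in place of `e^{-w}`. -/
theorem IsUpperRelaxed.of_comp_toConformal_symm {H : ConformalSpace w → ℝ}
    (h : IsUpperRelaxed (conformalMeasure w v m) (f ∘ (toConformal w).symm) H) :
    IsUpperRelaxed m f (fun x => Real.exp (w x) * (H ∘ toConformal w) x) := by
  intro ε hε
  set C : ℝ≥0∞ := ENNReal.ofReal (Real.exp ‖v‖) ^ (1 / 2 : ℝ≥0∞).toReal with hC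
  have hCt : C ≠ ∞ := ENNReal.rpow_ne_top_of_nonneg ENNReal.toReal_nonneg ENNReal.ofReal_ne_top
  set D : ℝ≥0∞ := ENNReal.ofReal (Real.exp ‖w‖)
  have hDt : D ≠ ∞ := ENNReal.ofReal_ne_top
  obtain ⟨δ₁, hδ₁, hle, h1⟩ := exists_pos_mul_le hDt hε
  obtain ⟨δ, hδ, -, h2⟩ := exists_pos_mul_le hCt hδ₁
  obtain ⟨F, u, a, b, c, d, e, i⟩ := h δ hδ
  have a' : IsLip (F ∘ toConformal w) :=
    (isLip_comp_toConformal_symm_iff w (f := F ∘ toConformal w)).1 a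
  refine ⟨F ∘ toConformal w, fun x => Real.exp (w x) * (u ∘ toConformal w) x,
    a', b.comp_toConformal, c.comp_toConformal.exp_mul w, ?_, ?_, ?_⟩
  · rw [ae_conformalMeasure_iff] at d
    filter_upwards [d] with x hx
    have h4 : lipReal F (toConformal w x) = Real.exp (-w x) * lipReal (F ∘ toConformal w) x :=
      lipReal_comp_toConformal_symm w a' x
    rw [h4, Real.exp_neg, inv_mul_le_iff₀ (Real.exp_pos _)] at hx
    exact hx
  · exact (eLpNorm_comp_toConformal_le (F - f ∘ (toConformal w).symm) 2).trans
      (((mul_le_mul_right e _).trans h2).trans hle)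
  · have h3 : eLpNorm ((u - H) ∘ toConformal w) 2 m ≤ δ₁ :=
      (eLpNorm_comp_toConformal_le (u - H) 2).trans ((mul_le_mul_right i _).trans h2)
    refine le_trans (le_of_eq ?_) ((eLpNorm_exp_mul_le ((u - H) ∘ toConformal w) 2 w).trans
      ((mul_le_mul_right h3 _).trans h1))
    congr 1
    funext x
    simp [mul_sub]

/-- `W^{1,2}(M) = W^{1,2}(M')`. -/
theorem memSobolev_conformalMeasure_iff :
    MemSobolev (conformalMeasure w v m) (f ∘ (toConformal w).symm) ↔ MemSobolev m f := by
  constructor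
  · intro h
    have h1 := h.isRelaxedGradient_weakGrad
    exact memSobolev_of_upper (memLp_conformalMeasure_iff.1 h.1)
      (h1.1.comp_toConformal.exp_mul w) h1.isUpperRelaxed.of_comp_toConformal_symm
  · intro h
    have h1 := h.isRelaxedGradient_weakGrad
    exact memSobolev_of_upper (memLp_conformalMeasure_iff.2 h.1)
      (memLp_conformalMeasure_iff.2 (h1.1.exp_mul (-w))) h1.isUpperRelaxed.comp_toConformal_symm

/-- `|D'f| = e^{-w} |Df|`. -/
theorem weakGrad_conformalMeasure (h : MemSobolev m f) :
    ∀ᵐ x ∂m, weakGrad (conformalMeasure w v m) (f ∘ (toConformal w).symm) (toConformal w x) =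
      Real.exp (-w x) * weakGrad m f x := by
  have h' : MemSobolev (conformalMeasure w v m) (f ∘ (toConformal w).symm) :=
    memSobolev_conformalMeasure_iff.2 h
  have h1 := h.isRelaxedGradient_weakGrad
  have h1' := h'.isRelaxedGradient_weakGrad
  -- Each minimal gradient, rescaled, is an upper relaxed gradient for the other space; minimality
  -- on both sides gives the two inequalities.
  have h2 := h'.weakGrad_le_of_upper (memLp_conformalMeasure_iff.2 (h1.1.exp_mul (-w)))
    h1.isUpperRelaxed.comp_toConformal_symm
  have h4 := h.weakGrad_le_of_upper (h1'.1.comp_toConformal.exp_mul w)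
    h1'.isUpperRelaxed.of_comp_toConformal_symm
  have h5 := ae_conformalMeasure_iff.1 h2
  filter_upwards [h4, h5] with x hx1 hx2
  refine le_antisymm hx2 ?_
  rw [Real.exp_neg, inv_mul_le_iff₀ (Real.exp_pos _)]
  exact hx1

end ConformalSobolev

/-! ### Locality of the minimal gradient -/

section Locality

variable {X : Type*} [MetricSpace X] [MeasurableSpace X] [BorelSpace X] {m : Measure X}
  {f g G : X → ℝ}

/-- Dominated convergence from almost everywhere convergence: the functions are set to zero on a
measurable null set containing the exceptional points. -/
theorem tendsto_eLpNorm_two_zero_of_ae {u : ℕ → X → ℝ} {D : X → ℝ} (hD : MemLp D 2 m)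
    (hu : ∀ n, AEStronglyMeasurable (u n) m) (hle : ∀ n x, |u n x| ≤ |D x|)
    (hlim : ∀ᵐ x ∂m, Tendsto (fun n => u n x) atTop (𝓝 0)) :
    Tendsto (fun n => eLpNorm (u n) 2 m) atTop (𝓝 0) := by
  obtain ⟨S, hS, hSm, hS0⟩ := exists_measurable_superset_of_null (ae_iff.1 hlim)
  have hae : ∀ n, Sᶜ.indicator (u n) =ᵐ[m] u n := fun n => by
    filter_upwards [measure_eq_zero_iff_ae_notMem.1 hS0] with x hx
    exact indicator_of_mem hx _
  refine (tendsto_eLpNorm_two_zero hD (u := fun n => Sᶜ.indicator (u n))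
    (fun n => (hu n).indicator hSm.compl) (fun n x => ?_) fun x => ?_).congr
    fun n => eLpNorm_congr_ae (hae n)
  · by_cases hx : x ∈ Sᶜ
    · simpa [indicator_of_mem hx] using hle n x
    · simp [indicator_of_notMem hx]
  · by_cases hx : x ∈ Sᶜ
    · have : x ∉ {x | ¬Tendsto (fun n => u n x) atTop (𝓝 0)} := fun h => hx (hS h)
      simpa [indicator_of_mem hx] using this
    · simp [indicator_of_notMem hx]

theorem LipschitzWith.isLip_comp {T : ℝ → ℝ} (hT : LipschitzWith 1 T) (hf : IsLip f) :
    IsLip (T ∘ f) := by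
  obtain ⟨K, hK⟩ := hf
  exact ⟨_, hT.comp hK⟩

theorem lipReal_comp_le {T : ℝ → ℝ} (hT : LipschitzWith 1 T) (hf : IsLip f) (x : X) :
    lipReal (T ∘ f) x ≤ lipReal f x := by
  refine lipReal_le_of_eventually (fun ε hε => ?_) (lipReal_nonneg _ _)
  filter_upwards [hf.eventually_le (lt_add_of_pos_right (lipReal f x) hε)] with y h1
  refine le_trans ?_ h1
  simpa [Real.dist_eq] using hT.dist_le_mul (f y) (f x)

theorem abs_comp_sub_le {T : ℝ → ℝ} (hT : LipschitzWith 1 T) (a b : ℝ) : |T a - T b| ≤ |a - b| := by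
  simpa [Real.dist_eq] using hT.dist_le_mul a b

theorem abs_comp_le {T : ℝ → ℝ} (hT : LipschitzWith 1 T) (h0 : T 0 = 0) (a : ℝ) : |T a| ≤ |a| := by
  simpa [h0] using abs_comp_sub_le hT a 0

theorem memLp_comp {T : ℝ → ℝ} (hT : LipschitzWith 1 T) (h0 : T 0 = 0) (hf : MemLp f 2 m) :
    MemLp (T ∘ f) 2 m :=
  hf.mono (hT.continuous.comp_aestronglyMeasurable hf.1)
    (Eventually.of_forall fun x => abs_comp_le hT h0 (f x))

/-- Post-composition with a 1-Lipschitz map does not increase local Lipschitz constants or `L²`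
distances, so the same majorants serve. The condition `T 0 = 0` keeps the composition in `L²` when
the measure is infinite. -/
theorem IsUpperRelaxed.comp {T : ℝ → ℝ} (hT : LipschitzWith 1 T) (h0 : T 0 = 0)
    (h : IsUpperRelaxed m f G) : IsUpperRelaxed m (T ∘ f) G := by
  intro ε hε
  obtain ⟨F, u, a, b, c, d, e, i⟩ := h ε hε
  refine ⟨T ∘ F, u, hT.isLip_comp a, memLp_comp hT h0 b, c, ?_, ?_, i⟩
  · filter_upwards [d] with x hx using (lipReal_comp_le hT a x).trans hx
  · exact (eLpNorm_mono fun x => abs_comp_sub_le hT (F x) (f x)).trans e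

theorem MemSobolev.comp {T : ℝ → ℝ} (hT : LipschitzWith 1 T) (h0 : T 0 = 0)
    (h : MemSobolev m f) : MemSobolev m (T ∘ f) :=
  memSobolev_of_upper (memLp_comp hT h0 h.1) h.isRelaxedGradient_weakGrad.1
    (h.isRelaxedGradient_weakGrad.isUpperRelaxed.comp hT h0)

/-- The identity, flattened to a constant on the interval of radius `δ` about `c`, with value `0`
at `0`. -/
def flatten (c δ t : ℝ) : ℝ :=
  t - (max (-δ) (min δ (t - c)) - max (-δ) (min δ (-c)))

/-- Both the clamp and the identity minus the clamp are nondecreasing, so the increments of the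
latter are at most those of the identity. -/
theorem abs_flatten_sub_le (c δ a b : ℝ) :
    |flatten c δ a - flatten c δ b| ≤ |a - b| := by
  wlog hab : b ≤ a generalizing a b
  · rw [abs_sub_comm, abs_sub_comm a b]; exact this b a (le_of_not_ge hab)
  have h1 : max (-δ) (min δ (b - c)) ≤ max (-δ) (min δ (a - c)) := by gcongr
  have h2 : max (-δ) (min δ (a - c)) - max (-δ) (min δ (b - c)) ≤ a - b := by
    have := (abs_max_sub_max_le_max (-δ) (min δ (a - c)) (-δ) (min δ (b - c))).trans
      (max_le_max le_rfl (abs_min_sub_min_le_max δ (a - c) δ (b - c)))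
    simp only [sub_self, abs_zero, sub_sub_sub_cancel_right, abs_nonneg, sup_of_le_right] at this
    rw [abs_of_nonneg (sub_nonneg.2 hab)] at this
    exact (le_abs_self _).trans this
  unfold flatten
  rw [abs_of_nonneg (sub_nonneg.2 hab), abs_of_nonneg (by linarith)]
  linarith

theorem lipschitzWith_flatten (c δ : ℝ) : LipschitzWith 1 (flatten c δ) :=
  LipschitzWith.of_dist_le_mul fun a b => by
    simpa [Real.dist_eq] using abs_flatten_sub_le c δ a b

theorem flatten_zero (c δ : ℝ) : flatten c δ 0 = 0 := by simp [flatten]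

theorem abs_flatten_sub_self_le (c : ℝ) {δ : ℝ} (hδ : 0 ≤ δ) (t : ℝ) :
    |flatten c δ t - t| ≤ 2 * δ := by
  have h : ∀ s : ℝ, -δ ≤ max (-δ) (min δ s) ∧ max (-δ) (min δ s) ≤ δ := fun s =>
    ⟨le_max_left _ _, max_le (by linarith) (min_le_left _ _)⟩
  have h1 := h (t - c)
  have h2 := h (-c)
  unfold flatten
  rw [abs_le]
  constructor <;> linarith

theorem flatten_eq_of_abs_le {c δ s t : ℝ} (hs : |s - c| ≤ δ) (ht : |t - c| ≤ δ) :
    flatten c δ s = flatten c δ t := by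
  rw [abs_le] at hs ht
  unfold flatten
  rw [min_eq_right hs.2, min_eq_right ht.2, max_eq_right hs.1, max_eq_right ht.1]
  ring

/-- Where `|f - c| < δ` the composition is locally constant, and elsewhere the factor is 1. A
continuous factor is used instead of an indicator so that it passes to the limit along functions
converging almost everywhere. -/
theorem lipReal_flatten_comp_le (c : ℝ) {δ : ℝ} (hδ : 0 < δ) (hf : IsLip f) (x : X) :
    lipReal (flatten c δ ∘ f) x ≤ min 1 (|f x - c| / δ) * lipReal f x := by
  have h0 : 0 ≤ min 1 (|f x - c| / δ) := le_min zero_le_one (by positivity)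
  by_cases hx : |f x - c| < δ
  · refine le_trans (lipReal_le le_rfl fun a ha => ?_) (mul_nonneg h0 (lipReal_nonneg _ _))
    have : ∀ᶠ y in 𝓝 x, |f y - c| < δ :=
      ((hf.continuous.sub continuous_const).abs).continuousAt.eventually_lt continuousAt_const hx
    filter_upwards [this] with y hy
    have e : flatten c δ (f y) = flatten c δ (f x) := flatten_eq_of_abs_le hy.le hx.le
    simp only [Function.comp, e, sub_self, abs_zero]
    exact mul_nonneg (le_of_lt ha) dist_nonneg
  · rw [min_eq_left ((one_le_div hδ).2 (not_lt.1 hx)), one_mul]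
    exact lipReal_comp_le (lipschitzWith_flatten c δ) hf x

/-- The estimate for Lipschitz functions is applied to the approximating sequence. A subsequence
converges almost everywhere, so the continuous factors converge, and multiplication by the fixed
`L²` function `G` gives `L²` convergence by domination. -/
theorem IsRelaxedGradient.flatten_comp (hf : MemLp f 2 m) (h : IsRelaxedGradient m f G) (c : ℝ)
    {δ : ℝ} (hδ : 0 < δ) :
    IsUpperRelaxed m (flatten c δ ∘ f) (fun x => min 1 (|f x - c| / δ) * G x) := by
  obtain ⟨hG, F, hF, h1, h2⟩ := h
  obtain ⟨k, hk, hae⟩ := (tendstoInMeasure_of_tendsto_eLpNorm two_ne_zero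
    (fun n => (hF n).2.1.1) hf.1 h1).exists_seq_tendsto_ae
  have hθc : Continuous fun t : ℝ => min 1 (|t - c| / δ) := by fun_prop
  have hθ0 : ∀ t : ℝ, 0 ≤ min 1 (|t - c| / δ) := fun t => le_min zero_le_one (by positivity)
  have hθ1 : ∀ t : ℝ, min 1 (|t - c| / δ) ≤ 1 := fun t => min_le_left _ _
  have hmul : ∀ {u D : X → ℝ}, AEStronglyMeasurable u m → MemLp D 2 m →
      MemLp (fun x => min 1 (|u x - c| / δ) * D x) 2 m := fun {u D} hu hD =>
    hD.mono ((hθc.comp_aestronglyMeasurable hu).mul hD.1) (Eventually.of_forall fun x => by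
      rw [norm_mul, Real.norm_of_nonneg (hθ0 _)]
      exact mul_le_of_le_one_left (norm_nonneg _) (hθ1 _))
  have ht : Tendsto (fun n => eLpNorm (fun x =>
      (min 1 (|F (k n) x - c| / δ) - min 1 (|f x - c| / δ)) * G x) 2 m) atTop (𝓝 0) := by
    refine tendsto_eLpNorm_two_zero_of_ae hG (fun n => ?_) (fun n x => ?_) ?_
    · exact ((hθc.comp_aestronglyMeasurable (hF (k n)).2.1.1).sub
        (hθc.comp_aestronglyMeasurable hf.1)).mul hG.1
    · rw [abs_mul]
      refine mul_le_of_le_one_left (abs_nonneg _) ?_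
      rw [abs_le]
      constructor <;> linarith [hθ0 (F (k n) x), hθ1 (F (k n) x), hθ0 (f x), hθ1 (f x)]
    · filter_upwards [hae] with x hx
      have := ((((hθc.tendsto (f x)).comp hx).sub_const (min 1 (|f x - c| / δ))).mul_const (G x))
      simpa using this
  intro ε hε
  have hε2 : 0 < ε / 2 := ENNReal.half_pos hε.ne'
  obtain ⟨n, ⟨hn1, hn2⟩, hn3⟩ := (((h1.comp hk.tendsto_atTop).eventually_lt_const hε).and
    ((h2.comp hk.tendsto_atTop).eventually_lt_const hε2)).and (ht.eventually_lt_const hε2) |>.exists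
  have hψ := lipschitzWith_flatten c δ
  refine ⟨flatten c δ ∘ F (k n), fun x => min 1 (|F (k n) x - c| / δ) * lipReal (F (k n)) x,
    hψ.isLip_comp (hF _).1, memLp_comp hψ (flatten_zero c δ) (hF _).2.1,
    hmul (hF _).2.1.1 (hF _).2.2,
    Eventually.of_forall fun x => lipReal_flatten_comp_le c hδ (hF _).1 x, ?_, ?_⟩
  · exact (eLpNorm_mono fun x => abs_comp_sub_le hψ (F (k n) x) (f x)).trans hn1.le
  -- The error splits in two: the varying factor, bounded by 1, times `lip F - G`, and the
  -- difference of the two factors times `G`.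
  · have e : ((fun x => min 1 (|F (k n) x - c| / δ) * lipReal (F (k n)) x) -
        fun x => min 1 (|f x - c| / δ) * G x) =
        (fun x => min 1 (|F (k n) x - c| / δ) * (lipReal (F (k n)) - G) x) +
        fun x => (min 1 (|F (k n) x - c| / δ) - min 1 (|f x - c| / δ)) * G x := by
      funext x; simp only [Pi.add_apply, Pi.sub_apply]; ring
    have hD : MemLp (lipReal (F (k n)) - G) 2 m := (hF _).2.2.sub hG
    rw [e, ← ENNReal.add_halves ε]
    refine (eLpNorm_add_le (hmul (hF _).2.1.1 hD).1 (((hθc.comp_aestronglyMeasurable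
      (hF (k n)).2.1.1).sub (hθc.comp_aestronglyMeasurable hf.1)).mul hG.1)
      (by norm_num)).trans (add_le_add (le_trans (eLpNorm_mono fun x => ?_) hn2.le) hn3.le)
    rw [norm_mul, Real.norm_of_nonneg (hθ0 _)]
    exact mul_le_of_le_one_left (norm_nonneg _) (hθ1 _)

/-- The pairs of a function and an upper relaxed gradient form a closed set in `L² × L²`, by a
diagonal choice of approximants. -/
theorem IsUpperRelaxed.of_approx_pair (hf : MemLp f 2 m) (hG : MemLp G 2 m)
    (h : ∀ ε : ℝ≥0∞, 0 < ε → ∃ f' G', MemLp f' 2 m ∧ MemLp G' 2 m ∧ IsUpperRelaxed m f' G' ∧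
      eLpNorm (f' - f) 2 m ≤ ε ∧ eLpNorm (G' - G) 2 m ≤ ε) : IsUpperRelaxed m f G := by
  intro ε hε
  have hε2 : 0 < ε / 2 := ENNReal.half_pos hε.ne'
  obtain ⟨f', G', hf', hG', hK, hd, hd'⟩ := h _ hε2
  obtain ⟨F1, u1, a1, b1, c1, d1, e1, i1⟩ := hK _ hε2
  refine ⟨F1, u1, a1, b1, c1, d1, ?_, ?_⟩
  · rw [← sub_add_sub_cancel F1 f' f, ← ENNReal.add_halves ε]
    exact (eLpNorm_add_le (b1.sub hf').1 (hf'.sub hf).1 (by norm_num)).trans (add_le_add e1 hd)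
  · rw [← sub_add_sub_cancel u1 G' G, ← ENNReal.add_halves ε]
    exact (eLpNorm_add_le (c1.sub hG').1 (hG'.sub hG).1 (by norm_num)).trans (add_le_add i1 hd')

/-- Locality: `|Df| = 0` almost everywhere on the level sets of `f`. -/
theorem MemSobolev.weakGrad_eq_zero (h : MemSobolev m f) (c : ℝ) :
    ∀ᵐ x ∂m, f x = c → weakGrad m f x = 0 := by
  classical
  have hr := h.isRelaxedGradient_weakGrad
  set G := weakGrad m f with hGdef
  have hG := hr.1
  have hpos : ∀ n : ℕ, (0 : ℝ) < 1 / (n + 1) := fun n => Nat.one_div_pos_of_nat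
  -- With width `1 / (n + 1)` tending to zero, the factor `θ n` is `0` on `{f = c}` and eventually
  -- equals `1` at any other point.
  set θ : ℕ → X → ℝ := fun n x => min 1 (|f x - c| / (1 / (n + 1 : ℝ))) with hθ
  set H : X → ℝ := fun x => if f x = c then 0 else G x with hH
  have hθ0 : ∀ n x, 0 ≤ θ n x := fun n x => le_min zero_le_one (by have := hpos n; positivity)
  have hθ1 : ∀ n x, θ n x ≤ 1 := fun n x => min_le_left _ _
  have hθm : ∀ n, AEStronglyMeasurable (θ n) m := fun n => by
    have hc : Continuous fun t : ℝ => min 1 (|t - c| / (1 / (n + 1 : ℝ))) := by fun_prop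
    exact hc.comp_aestronglyMeasurable h.1.1
  have hGm : ∀ n, MemLp (fun x => θ n x * G x) 2 m := fun n =>
    hG.mono ((hθm n).mul hG.1) (Eventually.of_forall fun x => by
      rw [norm_mul, Real.norm_of_nonneg (hθ0 _ _)]
      exact mul_le_of_le_one_left (norm_nonneg _) (hθ1 _ _))
  have hlim : ∀ x, Tendsto (fun n => θ n x * G x) atTop (𝓝 (H x)) := by
    intro x
    by_cases hx : f x = c
    · simp [hθ, hH, hx]
    · simp only [hH, if_neg hx]
      refine tendsto_const_nhds.congr' ?_
      have hx' : 0 < |f x - c| := abs_pos.2 (sub_ne_zero.2 hx)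
      filter_upwards [(tendsto_one_div_add_atTop_nhds_zero_nat (𝕜 := ℝ)).eventually_lt_const hx']
        with n hn
      simp only [hθ]
      rw [min_eq_left ((one_le_div (hpos n)).2 hn.le), one_mul]
  have hHm : MemLp H 2 m := by
    refine hG.mono (aestronglyMeasurable_of_tendsto_ae atTop (fun n => (hGm n).1)
      (Eventually.of_forall hlim)) (Eventually.of_forall fun x => ?_)
    simp only [hH]
    split_ifs <;> simp
  -- The flattened functions converge to `f` in `L²` while their gradients `θ n * G` converge to
  -- `H`, which vanishes on the level set. So `H` competes with the minimal gradient.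
  have hup : IsUpperRelaxed m f H := by
    refine IsUpperRelaxed.of_approx_pair h.1 hHm fun ε hε => ?_
    have t1 : Tendsto (fun n : ℕ => eLpNorm (flatten c (1 / (n + 1)) ∘ f - f) 2 m) atTop (𝓝 0) := by
      refine tendsto_eLpNorm_two_zero (h.1.const_smul (2 : ℝ)) (fun n => ?_) (fun n x => ?_)
        (fun x => ?_)
      · exact ((memLp_comp (lipschitzWith_flatten _ _) (flatten_zero _ _) h.1).sub h.1).1
      · have := abs_comp_le (lipschitzWith_flatten c (1 / (n + 1))) (flatten_zero _ _) (f x)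
        simp only [Pi.sub_apply, Function.comp, Pi.smul_apply, smul_eq_mul, abs_mul]
        refine (abs_sub _ _).trans ?_
        rw [abs_of_pos (by norm_num : (0 : ℝ) < 2)]
        linarith
      · have h0 : Tendsto (fun n : ℕ => 2 * (1 / ((n : ℝ) + 1))) atTop (𝓝 0) := by
          simpa using (tendsto_one_div_add_atTop_nhds_zero_nat (𝕜 := ℝ)).const_mul 2
        exact squeeze_zero_norm (fun n => abs_flatten_sub_self_le c (hpos n).le (f x)) h0
    have t2 : Tendsto (fun n : ℕ => eLpNorm ((fun x => θ n x * G x) - H) 2 m) atTop (𝓝 0) := by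
      refine tendsto_eLpNorm_two_zero hG (fun n => ((hGm n).sub hHm).1) (fun n x => ?_)
        (fun x => ?_)
      · simp only [Pi.sub_apply, hH]
        split_ifs with hx
        · simp [hθ, hx]
        · rw [show θ n x * G x - G x = -((1 - θ n x) * G x) by ring, abs_neg, abs_mul,
            abs_of_nonneg (by linarith [hθ1 n x])]
          exact mul_le_of_le_one_left (abs_nonneg _) (by linarith [hθ0 n x])
      · simpa using (hlim x).sub_const (H x)
    obtain ⟨n, hn1, hn2⟩ := ((t1.eventually_lt_const hε).and (t2.eventually_lt_const hε)).exists
    exact ⟨_, _, memLp_comp (lipschitzWith_flatten _ _) (flatten_zero _ _) h.1, hGm n,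
      hr.flatten_comp h.1 c (hpos n), hn1.le, hn2.le⟩
  filter_upwards [h.weakGrad_le_of_upper hHm hup] with x hx hxc
  simp only [hH, if_pos hxc] at hx
  exact le_antisymm hx (weakGrad_nonneg _ _ _)

theorem MemSobolev.sub (hf : MemSobolev m f) (hg : MemSobolev m g) : MemSobolev m (f - g) :=
  (sobolevSpace m).sub_mem hf hg

theorem weakGrad_neg (hf : MemSobolev m f) : ∀ᵐ x ∂m, weakGrad m (-f) x = weakGrad m f x := by
  simpa using weakGrad_smul hf (-1)

theorem weakGrad_sub_comm (hf : MemSobolev m f) (hg : MemSobolev m g) :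
    ∀ᵐ x ∂m, weakGrad m (f - g) x = weakGrad m (g - f) x := by
  simpa using weakGrad_neg (hg.sub hf)

theorem weakGrad_sub_le (hf : MemSobolev m f) (hg : MemSobolev m g) :
    ∀ᵐ x ∂m, weakGrad m (f - g) x ≤ weakGrad m f x + weakGrad m g x := by
  have h1 := weakGrad_add_le hf ((sobolevSpace m).neg_mem hg)
  filter_upwards [h1, weakGrad_neg hg] with x h1 h2
  rw [← h2, sub_eq_add_neg]
  exact h1

/-- Functions that differ by a constant on a set have the same `|D ·|` there. -/
theorem weakGrad_eq_of_sub_eq (hf : MemSobolev m f) (hg : MemSobolev m g) (c : ℝ) :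
    ∀ᵐ x ∂m, f x - g x = c → weakGrad m f x = weakGrad m g x := by
  have h1 := weakGrad_add_le (hf.sub hg) hg
  have h2 := weakGrad_add_le (hg.sub hf) hf
  rw [sub_add_cancel] at h1 h2
  filter_upwards [h1, h2, (hf.sub hg).weakGrad_eq_zero c, weakGrad_sub_comm hf hg]
    with x k1 k2 k3 k4 hx
  rw [← k4] at k2
  rw [k3 hx] at k1 k2
  exact le_antisymm (by linarith) (by linarith)

end Locality

/-! ### Products with Lipschitz cutoffs -/

section Leibniz

variable {X : Type*} [MetricSpace X] [MeasurableSpace X] [BorelSpace X] {m : Measure X}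
  {f G χ : X → ℝ} {L : ℝ≥0}

/-- This is the gluing estimate with the second function equal to zero: the local Lipschitz constant
of `χ F` is at most `χ lip F + L |F|`, and this bound is stable in `L²`. -/
theorem IsUpperRelaxed.cutoff_mul (hf : MemLp f 2 m) (hG : MemLp G 2 m) (h : IsUpperRelaxed m f G)
    (hχ : LipschitzWith L χ) (h0 : ∀ x, 0 ≤ χ x) (h1 : ∀ x, χ x ≤ 1) :
    IsUpperRelaxed m (χ * f) (χ * G + (L : ℝ) • fun x => |f x|) := by
  intro ε hε
  obtain ⟨δ, hδ, hle, hδ'⟩ := exists_pos_mul_le (C := 1 + L) (by finiteness) hε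
  -- Truncated approximants are needed because `χ F` is Lipschitz only when `F` is bounded as well.
  obtain ⟨F, u, N, n1, a, b, c, d, e, i⟩ := h.bounded hf hδ
  have hm1 := MemLp.cutoff_mul hχ.continuous h0 h1 b
  have hm2 := MemLp.cutoff_mul hχ.continuous h0 h1 c
  refine ⟨χ * F, χ * u + (L : ℝ) • fun x => |F x|, ?_, hm1.1, hm2.1.add (b.abs.const_smul _), ?_,
    ?_, ?_⟩
  · obtain ⟨K, k⟩ := a
    refine ⟨K + N.toNNReal * L, LipschitzWith.of_dist_le_mul fun x y => ?_⟩
    have q1 := k.dist_le_mul x y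
    have q3 := hχ.dist_le_mul x y
    rw [Real.dist_eq] at q1 q3 ⊢
    have hN : |F y| ≤ (N.toNNReal : ℝ) := (n1 y).trans (Real.le_coe_toNNReal _)
    have : (χ * F) x - (χ * F) y = χ x * (F x - F y) + (χ x - χ y) * F y := by
      simp only [Pi.mul_apply]; ring
    rw [this]
    refine (abs_add_le _ _).trans ?_
    rw [abs_mul, abs_mul, abs_of_nonneg (h0 x)]
    have r1 : χ x * |F x - F y| ≤ K * dist x y :=
      (mul_le_of_le_one_left (abs_nonneg _) (h1 x)).trans q1
    have r2 : |χ x - χ y| * |F y| ≤ (L * dist x y) * (N.toNNReal : ℝ) := by gcongr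
    push_cast
    linarith
  · have hz : IsLip (0 : X → ℝ) := ⟨0, LipschitzWith.const 0⟩
    have hz0 : ∀ x, lipReal (0 : X → ℝ) x = 0 := fun x =>
      le_antisymm (lipReal_le le_rfl fun c hc => Eventually.of_forall fun y => by
        simpa using mul_nonneg (le_of_lt hc) dist_nonneg) (lipReal_nonneg _ _)
    have e1 : (fun x => (0 : X → ℝ) x + χ x * (F x - (0 : X → ℝ) x)) = χ * F := by
      funext x; simp
    filter_upwards [d] with x hx
    have h3 := lipReal_glue_le a hz hχ h0 h1 x
    rw [e1, hz0] at h3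
    have := mul_le_mul_of_nonneg_left hx (h0 x)
    simp only [Pi.add_apply, Pi.mul_apply, Pi.smul_apply, smul_eq_mul]
    simp only [Pi.zero_apply, sub_zero, mul_zero, add_zero] at h3
    linarith
  · rw [← mul_sub]
    exact ((MemLp.cutoff_mul hχ.continuous h0 h1 (b.sub hf)).2.trans e).trans hle
  · have e1 : (χ * u + (L : ℝ) • fun x => |F x|) - (χ * G + (L : ℝ) • fun x => |f x|) =
        χ * (u - G) + (L : ℝ) • fun x => |F x| - |f x| := by
      funext x; simp only [Pi.add_apply, Pi.mul_apply, Pi.sub_apply, Pi.smul_apply, smul_eq_mul]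
      ring
    have hm3 : MemLp (fun x => |F x| - |f x|) 2 m := b.abs.sub hf.abs
    have hm4 := MemLp.cutoff_mul hχ.continuous h0 h1 (c.sub hG)
    rw [e1]
    calc _ ≤ eLpNorm (χ * (u - G)) 2 m + eLpNorm ((L : ℝ) • fun x => |F x| - |f x|) 2 m :=
          eLpNorm_add_le hm4.1.1 (hm3.const_smul _).1 (by norm_num)
      _ ≤ δ + L * δ := by
          refine add_le_add (hm4.2.trans i) ?_
          rw [eLpNorm_const_smul, Real.enorm_eq_ofReal L.coe_nonneg, ENNReal.ofReal_coe_nnreal]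
          gcongr
          exact (eLpNorm_mono fun x => abs_abs_sub_abs_le (F x) (f x)).trans e
      _ = (1 + L) * δ := by ring
      _ ≤ ε := hδ'

theorem MemSobolev.cutoff_mul (h : MemSobolev m f) (hχ : LipschitzWith L χ) (h0 : ∀ x, 0 ≤ χ x)
    (h1 : ∀ x, χ x ≤ 1) : MemSobolev m (χ * f) :=
  memSobolev_of_upper (MemLp.cutoff_mul hχ.continuous h0 h1 h.1).1
    ((MemLp.cutoff_mul hχ.continuous h0 h1 h.isRelaxedGradient_weakGrad.1).1.add
      (h.1.abs.const_smul (L : ℝ)))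
    (h.isRelaxedGradient_weakGrad.isUpperRelaxed.cutoff_mul h.1 h.isRelaxedGradient_weakGrad.1
      hχ h0 h1)

theorem MemSobolev.weakGrad_cutoff_mul_le (h : MemSobolev m f) (hχ : LipschitzWith L χ)
    (h0 : ∀ x, 0 ≤ χ x) (h1 : ∀ x, χ x ≤ 1) :
    ∀ᵐ x ∂m, weakGrad m (χ * f) x ≤ χ x * weakGrad m f x + L * |f x| :=
  (h.cutoff_mul hχ h0 h1).weakGrad_le_of_upper
    ((MemLp.cutoff_mul hχ.continuous h0 h1 h.isRelaxedGradient_weakGrad.1).1.add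
      (h.1.abs.const_smul (L : ℝ)))
    (h.isRelaxedGradient_weakGrad.isUpperRelaxed.cutoff_mul h.1 h.isRelaxedGradient_weakGrad.1
      hχ h0 h1)

/-- The Leibniz rule for a Lipschitz cutoff function `χ`: `|D(χ f)|` is `χ |Df|` up to
`Lip(χ) |f|`. -/
theorem MemSobolev.abs_weakGrad_cutoff_mul_sub_le (h : MemSobolev m f) (hχ : LipschitzWith L χ)
    (h0 : ∀ x, 0 ≤ χ x) (h1 : ∀ x, χ x ≤ 1) :
    ∀ᵐ x ∂m, |weakGrad m (χ * f) x - χ x * weakGrad m f x| ≤ L * |f x| := by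
  have hχ' : LipschitzWith L (fun x => 1 - χ x) := LipschitzWith.of_dist_le_mul fun x y => by
    have := hχ.dist_le_mul x y
    rw [Real.dist_eq] at this ⊢
    rw [sub_sub_sub_cancel_left, abs_sub_comm]; exact this
  have h0' : ∀ x, 0 ≤ 1 - χ x := fun x => by linarith [h1 x]
  have h1' : ∀ x, 1 - χ x ≤ 1 := fun x => by linarith [h0 x]
  have hadd := weakGrad_add_le (h.cutoff_mul hχ h0 h1) (h.cutoff_mul hχ' h0' h1')
  -- The lower bound comes from the upper bound for the complementary cutoff: `|Df| ≤ |D(χ f)| +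
  -- |D((1 - χ) f)| ≤ |D(χ f)| + (1 - χ) |Df| + L |f|`.
  have e : χ * f + (fun x => 1 - χ x) * f = f := by
    funext x; simp only [Pi.add_apply, Pi.mul_apply]; ring
  rw [e] at hadd
  filter_upwards [hadd, h.weakGrad_cutoff_mul_le hχ h0 h1, h.weakGrad_cutoff_mul_le hχ' h0' h1']
    with x k1 k2 k3
  rw [abs_le]
  constructor <;> linarith

end Leibniz

/-! ### The parallelogram law almost everywhere -/

section Parallelogram

/-- The distance of `t` to `δ ℤ`. -/
def sawtooth (δ t : ℝ) : ℝ := |t - δ * round (t / δ)|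

theorem sawtooth_le {δ : ℝ} (hδ : 0 < δ) (t : ℝ) (k : ℤ) : sawtooth δ t ≤ |t - δ * k| := by
  have e : ∀ n : ℤ, |t - δ * n| = δ * |t / δ - n| := fun n => by
    rw [← abs_of_pos hδ, ← abs_mul, abs_of_pos hδ, mul_sub, mul_div_cancel₀ _ hδ.ne']
  rw [sawtooth, e, e]
  exact mul_le_mul_of_nonneg_left (round_le _ _) hδ.le

theorem sawtooth_nonneg (δ t : ℝ) : 0 ≤ sawtooth δ t := abs_nonneg _

/-- The sawtooth is the least of the 1-Lipschitz functions `|t - δ k|`, `k ∈ ℤ`. -/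
theorem lipschitzWith_sawtooth {δ : ℝ} (hδ : 0 < δ) : LipschitzWith 1 (sawtooth δ) := by
  have h : ∀ s t, sawtooth δ s ≤ sawtooth δ t + |s - t| := fun s t => by
    refine (sawtooth_le hδ s (round (t / δ))).trans ?_
    rw [sawtooth, add_comm]
    exact abs_sub_le _ _ _
  refine LipschitzWith.of_dist_le_mul fun s t => ?_
  rw [Real.dist_eq, Real.dist_eq, NNReal.coe_one, one_mul, abs_le]
  constructor
  · have := h t s; rw [abs_sub_comm] at this; linarith
  · linarith [h s t]

theorem sawtooth_zero (δ : ℝ) : sawtooth δ 0 = 0 := by simp [sawtooth]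

theorem sawtooth_le_self {δ : ℝ} (hδ : 0 < δ) (t : ℝ) : sawtooth δ t ≤ δ := by
  have h := abs_sub_round (t / δ)
  have e : |t - δ * round (t / δ)| = δ * |t / δ - round (t / δ)| := by
    rw [← abs_of_pos hδ, ← abs_mul, abs_of_pos hδ, mul_sub, mul_div_cancel₀ _ hδ.ne']
  rw [sawtooth, e]
  nlinarith

/-- Folding is `± id` up to one of countably many constants. Countability is what lets locality be
used on all pieces at once, outside a single null set. -/
theorem exists_sawtooth_eq (δ t : ℝ) :
    ∃ k : ℤ, sawtooth δ t - t = δ * k ∨ sawtooth δ t + t = δ * k := by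
  refine ⟨if 0 ≤ t - δ * round (t / δ) then -round (t / δ) else round (t / δ), ?_⟩
  unfold sawtooth
  split_ifs with h
  · left; rw [abs_of_nonneg h]; push_cast; ring
  · right; rw [abs_of_neg (not_le.1 h)]; ring

variable {X : Type*} [MetricSpace X] [MeasurableSpace X] [BorelSpace X] {m : Measure X}
  {f g : X → ℝ}

/-- The failure of the parallelogram law for `|D ·|`. -/
def parallelogramDefect (m : Measure X) (f g : X → ℝ) (x : X) : ℝ :=
  weakGrad m (f + g) x ^ 2 + weakGrad m (f - g) x ^ 2 - 2 * weakGrad m f x ^ 2 -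
    2 * weakGrad m g x ^ 2

theorem MemSobolev.memLp_weakGrad (hf : MemSobolev m f) : MemLp (weakGrad m f) 2 m :=
  hf.isRelaxedGradient_weakGrad.1

theorem integrable_parallelogramDefect (hf : MemSobolev m f) (hg : MemSobolev m g) :
    Integrable (parallelogramDefect m f g) m :=
  (((hf.add hg).memLp_weakGrad.integrable_sq.add (hf.sub hg).memLp_weakGrad.integrable_sq).sub
    (hf.memLp_weakGrad.integrable_sq.const_mul 2)).sub (hg.memLp_weakGrad.integrable_sq.const_mul 2)

theorem toReal_eLpNorm_two_sq (hf : MemLp f 2 m) :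
    (eLpNorm f 2 m).toReal ^ 2 = ∫ x, f x ^ 2 ∂m := by
  have h := hf.eLpNorm_eq_integral_rpow_norm two_ne_zero ENNReal.ofNat_ne_top
  have h0 : 0 ≤ ∫ x, f x ^ 2 ∂m := integral_nonneg fun x => sq_nonneg _
  simp only [ENNReal.toReal_ofNat, Real.rpow_ofNat, Real.norm_eq_abs, sq_abs] at h
  rw [h, ENNReal.toReal_ofReal (Real.rpow_nonneg h0 _), ← Real.rpow_natCast, ← Real.rpow_mul h0]
  norm_num

theorem sobolevNorm_sq (hf : MemSobolev m f) :
    sobolevNorm m f ^ 2 = ∫ x, f x ^ 2 ∂m + ∫ x, weakGrad m f x ^ 2 ∂m := by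
  rw [sobolevNorm, Real.sq_sqrt (by positivity), toReal_eLpNorm_two_sq hf.1,
    toReal_eLpNorm_two_sq hf.memLp_weakGrad]

/-- The parallelogram law for the Sobolev norm says that the defect has integral zero. -/
theorem sobolevNorm_parallelogram_iff (hf : MemSobolev m f) (hg : MemSobolev m g) :
    sobolevNorm m (f + g) ^ 2 + sobolevNorm m (f - g) ^ 2 =
      2 * sobolevNorm m f ^ 2 + 2 * sobolevNorm m g ^ 2 ↔
    ∫ x, parallelogramDefect m f g x ∂m = 0 := by
  have e1 : ∫ x, parallelogramDefect m f g x ∂m =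
      ∫ x, weakGrad m (f + g) x ^ 2 ∂m + ∫ x, weakGrad m (f - g) x ^ 2 ∂m -
        2 * ∫ x, weakGrad m f x ^ 2 ∂m - 2 * ∫ x, weakGrad m g x ^ 2 ∂m := by
    have i1 := (hf.add hg).memLp_weakGrad.integrable_sq
    have i2 := (hf.sub hg).memLp_weakGrad.integrable_sq
    have i3 := hf.memLp_weakGrad.integrable_sq.const_mul 2
    have i4 := hg.memLp_weakGrad.integrable_sq.const_mul 2
    rw [← integral_const_mul, ← integral_const_mul, ← integral_add i1 i2,
      ← integral_sub (f := fun x => weakGrad m (f + g) x ^ 2 + weakGrad m (f - g) x ^ 2)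
        (i1.add i2) i3,
      ← integral_sub (f := fun x => weakGrad m (f + g) x ^ 2 + weakGrad m (f - g) x ^ 2 -
        2 * weakGrad m f x ^ 2) ((i1.add i2).sub i3) i4]
    rfl
  -- The `L²` part of the norm satisfies the parallelogram law on its own, so only the gradient part
  -- remains.
  have e2 : ∫ x, (f + g) x ^ 2 ∂m + ∫ x, (f - g) x ^ 2 ∂m =
      2 * ∫ x, f x ^ 2 ∂m + 2 * ∫ x, g x ^ 2 ∂m := by
    have i1 := (hf.1.add hg.1).integrable_sq
    have i2 := (hf.1.sub hg.1).integrable_sq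
    have i3 := hf.1.integrable_sq.const_mul 2
    have i4 := hg.1.integrable_sq.const_mul 2
    rw [← integral_const_mul, ← integral_const_mul, ← integral_add i1 i2, ← integral_add i3 i4]
    congr 1
    funext x
    simp only [Pi.add_apply, Pi.sub_apply]
    ring
  rw [sobolevNorm_sq (hf.add hg), sobolevNorm_sq (hf.sub hg), sobolevNorm_sq hf,
    sobolevNorm_sq hg, e1]
  constructor <;> intro h <;> linarith

/-- On the set where `u = ±f + const`, `|D ·|` of `u` is that of `±f`. -/
theorem parallelogramDefect_sawtooth (hf : MemSobolev m f) (hg : MemSobolev m g) {δ : ℝ}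
    (hδ : 0 < δ) : ∀ᵐ x ∂m,
      parallelogramDefect m (sawtooth δ ∘ f) (sawtooth δ ∘ g) x = parallelogramDefect m f g x := by
  set u := sawtooth δ ∘ f with hu
  set v := sawtooth δ ∘ g with hv
  have hum : MemSobolev m u := hf.comp (lipschitzWith_sawtooth hδ) (sawtooth_zero δ)
  have hvm : MemSobolev m v := hg.comp (lipschitzWith_sawtooth hδ) (sawtooth_zero δ)
  have hf' : MemSobolev m (-f) := (sobolevSpace m).neg_mem hf
  have hg' : MemSobolev m (-g) := (sobolevSpace m).neg_mem hg
  -- Here `(p, q)` will be one of the four pairs `(±f, ±g)`. If `u - p` and `v - q` equal given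
  -- constants on a set, then so do the differences of the sums and of the differences, and locality
  -- applies to all four gradients in the defect.
  have key : ∀ {p q : X → ℝ}, MemSobolev m p → MemSobolev m q → ∀ᵐ x ∂m, ∀ k l : ℤ,
      u x - p x = δ * k → v x - q x = δ * l →
      parallelogramDefect m u v x = parallelogramDefect m p q x := by
    intro p q hp hq
    rw [ae_all_iff]; intro k
    rw [ae_all_iff]; intro l
    filter_upwards [weakGrad_eq_of_sub_eq hum hp (δ * k), weakGrad_eq_of_sub_eq hvm hq (δ * l),
      weakGrad_eq_of_sub_eq (hum.add hvm) (hp.add hq) (δ * k + δ * l),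
      weakGrad_eq_of_sub_eq (hum.sub hvm) (hp.sub hq) (δ * k - δ * l)] with x h1 h2 h3 h4 k1 k2
    rw [parallelogramDefect, parallelogramDefect, h1 k1, h2 k2,
      h3 (by simp only [Pi.add_apply]; linarith), h4 (by simp only [Pi.sub_apply]; linarith)]
  -- The defect is insensitive to the signs of its arguments: a sign change at most exchanges the
  -- gradients of the sum and of the difference.
  have s1 : ∀ᵐ x ∂m, parallelogramDefect m f (-g) x = parallelogramDefect m f g x := by
    filter_upwards [weakGrad_neg hg] with x h1
    rw [parallelogramDefect, parallelogramDefect, h1, sub_neg_eq_add, ← sub_eq_add_neg]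
    ring
  have s2 : ∀ᵐ x ∂m, parallelogramDefect m (-f) g x = parallelogramDefect m f g x := by
    filter_upwards [weakGrad_neg hf, weakGrad_neg (hf.add hg), weakGrad_sub_comm hg hf]
      with x h1 h2 h3
    rw [parallelogramDefect, parallelogramDefect, h1, show -f + g = g - f by abel,
      show -f - g = -(f + g) by abel, h2, h3]
    ring
  have s3 : ∀ᵐ x ∂m, parallelogramDefect m (-f) (-g) x = parallelogramDefect m f g x := by
    filter_upwards [weakGrad_neg hf, weakGrad_neg hg, weakGrad_neg (hf.add hg),
      weakGrad_sub_comm hg hf] with x h1 h2 h3 h4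
    rw [parallelogramDefect, parallelogramDefect, h1, h2, show -f + -g = -(f + g) by abel,
      show -f - -g = g - f by abel, h3, h4]
  filter_upwards [key hf hg, key hf hg', key hf' hg, key hf' hg', s1, s2, s3]
    with x a1 a2 a3 a4 b1 b2 b3
  obtain ⟨k, hk⟩ : ∃ k : ℤ, u x - f x = δ * k ∨ u x + f x = δ * k := exists_sawtooth_eq δ (f x)
  obtain ⟨l, hl⟩ : ∃ l : ℤ, v x - g x = δ * l ∨ v x + g x = δ * l := exists_sawtooth_eq δ (g x)
  rcases hk with hk | hk <;> rcases hl with hl | hl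
  · exact a1 k l hk hl
  · exact (a2 k l hk (by simpa using hl)).trans b1
  · exact (a3 k l (by simpa using hk) hl).trans b2
  · exact (a4 k l (by simpa using hk) (by simpa using hl)).trans b3

theorem abs_sq_sub_sq_le {p r a b d : ℝ} (hr0 : 0 ≤ r) (hrd : r ≤ d) (h : |p - r| ≤ a)
    (hab : a ≤ b) : |p ^ 2 - r ^ 2| ≤ b * (2 * d + b) := by
  have h1 : |p + r| ≤ 2 * d + b := by
    rw [show p + r = (p - r) + 2 * r by ring]
    refine (abs_add_le _ _).trans ?_
    rw [abs_of_nonneg (by linarith : 0 ≤ 2 * r)]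
    linarith
  rw [show p ^ 2 - r ^ 2 = (p - r) * (p + r) by ring, abs_mul]
  exact mul_le_mul (h.trans hab) h1 (abs_nonneg _) ((abs_nonneg _).trans (h.trans hab))

/-- By the Leibniz rule each gradient of a product with `χ` is `χ` times the gradient, up to `L`
times the size of the folded function. That size is at most `2δ` for the sum and the difference. The
minimum with `|f| + |g|` supplies a dominating function even when the measure is infinite. -/
theorem abs_parallelogramDefect_cutoff_le (hf : MemSobolev m f) (hg : MemSobolev m g) {δ : ℝ}
    (hδ : 0 < δ) {χ : X → ℝ} {L : ℝ≥0} (hχ : LipschitzWith L χ) (h0 : ∀ x, 0 ≤ χ x)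
    (h1 : ∀ x, χ x ≤ 1) : ∀ᵐ x ∂m,
      |parallelogramDefect m (χ * sawtooth δ ∘ f) (χ * sawtooth δ ∘ g) x -
        χ x ^ 2 * parallelogramDefect m f g x| ≤
      6 * ((L * min (2 * δ) (|f x| + |g x|)) * (2 * (weakGrad m f x + weakGrad m g x) +
        L * min (2 * δ) (|f x| + |g x|))) := by
  set u := sawtooth δ ∘ f with hu
  set v := sawtooth δ ∘ g with hv
  have hT := lipschitzWith_sawtooth hδ
  have hum : MemSobolev m u := hf.comp hT (sawtooth_zero δ)
  have hvm : MemSobolev m v := hg.comp hT (sawtooth_zero δ)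
  have hule : ∀ᵐ x ∂m, weakGrad m u x ≤ weakGrad m f x := hum.weakGrad_le_of_upper
    hf.memLp_weakGrad (hf.isRelaxedGradient_weakGrad.isUpperRelaxed.comp hT (sawtooth_zero δ))
  have hvle : ∀ᵐ x ∂m, weakGrad m v x ≤ weakGrad m g x := hvm.weakGrad_le_of_upper
    hg.memLp_weakGrad (hg.isRelaxedGradient_weakGrad.isUpperRelaxed.comp hT (sawtooth_zero δ))
  filter_upwards [hule, hvle, parallelogramDefect_sawtooth hf hg hδ,
    weakGrad_add_le hum hvm, weakGrad_sub_le hum hvm,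
    hum.abs_weakGrad_cutoff_mul_sub_le hχ h0 h1, hvm.abs_weakGrad_cutoff_mul_sub_le hχ h0 h1,
    (hum.add hvm).abs_weakGrad_cutoff_mul_sub_le hχ h0 h1,
    (hum.sub hvm).abs_weakGrad_cutoff_mul_sub_le hχ h0 h1]
    with x p1 p2 p3 p4 p5 q1 q2 q3 q4
  rw [← p3, parallelogramDefect, parallelogramDefect, ← mul_add, ← mul_sub]
  have uu : |u x| ≤ δ :=
    (abs_of_nonneg (sawtooth_nonneg δ (f x))).trans_le (sawtooth_le_self hδ _)
  have vv : |v x| ≤ δ :=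
    (abs_of_nonneg (sawtooth_nonneg δ (g x))).trans_le (sawtooth_le_self hδ _)
  have uf : |u x| ≤ |f x| := abs_comp_le hT (sawtooth_zero δ) _
  have vg : |v x| ≤ |g x| := abs_comp_le hT (sawtooth_zero δ) _
  have hL : (0 : ℝ) ≤ L := L.coe_nonneg
  have b1 : L * |u x| ≤ L * min (2 * δ) (|f x| + |g x|) := mul_le_mul_of_nonneg_left
    (le_min (by linarith) (by linarith [abs_nonneg (g x)])) hL
  have b2 : L * |v x| ≤ L * min (2 * δ) (|f x| + |g x|) := mul_le_mul_of_nonneg_left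
    (le_min (by linarith) (by linarith [abs_nonneg (f x)])) hL
  have b3 : L * |(u + v) x| ≤ L * min (2 * δ) (|f x| + |g x|) := mul_le_mul_of_nonneg_left
    ((abs_add_le (u x) (v x)).trans (le_min (by linarith) (by linarith))) hL
  have b4 : L * |(u - v) x| ≤ L * min (2 * δ) (|f x| + |g x|) := mul_le_mul_of_nonneg_left
    ((abs_sub (u x) (v x)).trans (le_min (by linarith) (by linarith))) hL
  have n0 := weakGrad_nonneg m f x
  have n1 := weakGrad_nonneg m g x
  -- Used for each of the four squares in the defect; their coefficients `1, 1, 2, 2` add up to the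
  -- constant `6`.
  have bound : ∀ h : X → ℝ, weakGrad m h x ≤ weakGrad m f x + weakGrad m g x →
      |weakGrad m (χ * h) x - χ x * weakGrad m h x| ≤ L * |h x| →
      L * |h x| ≤ L * min (2 * δ) (|f x| + |g x|) →
      |weakGrad m (χ * h) x ^ 2 - (χ x * weakGrad m h x) ^ 2| ≤
      (L * min (2 * δ) (|f x| + |g x|)) * (2 * (weakGrad m f x + weakGrad m g x) +
        L * min (2 * δ) (|f x| + |g x|)) := fun h k1 k2 k3 =>
    abs_sq_sub_sq_le (mul_nonneg (h0 x) (weakGrad_nonneg _ _ _))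
      ((mul_le_of_le_one_left (weakGrad_nonneg _ _ _) (h1 x)).trans k1) k2 k3
  have c1 := abs_le.1 (bound u (by linarith) q1 b1)
  have c2 := abs_le.1 (bound v (by linarith) q2 b2)
  have c3 := abs_le.1 (bound (u + v) (by linarith) q3 b3)
  have c4 := abs_le.1 (bound (u - v) (by linarith) q4 b4)
  rw [abs_le]
  constructor <;> linarith [c1.1, c1.2, c2.1, c2.2, c3.1, c3.2, c4.1, c4.2]

/-- The integrated law holds for the products of `χ` with the folded functions. As the fold width
tends to zero their defects converge in integral to `χ²` times the defect of `f` and `g`. -/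
theorem integral_cutoff_mul_parallelogramDefect (hH : InfinitesimallyHilbertian m)
    (hf : MemSobolev m f) (hg : MemSobolev m g) {χ : X → ℝ} {L : ℝ≥0} (hχ : LipschitzWith L χ)
    (h0 : ∀ x, 0 ≤ χ x) (h1 : ∀ x, χ x ≤ 1) :
    ∫ x, χ x ^ 2 * parallelogramDefect m f g x ∂m = 0 := by
  have hpos : ∀ n : ℕ, (0 : ℝ) < 1 / (n + 1) := fun n => Nat.one_div_pos_of_nat
  set q : ℕ → X → ℝ := fun n =>
    parallelogramDefect m (χ * sawtooth (1 / (n + 1)) ∘ f) (χ * sawtooth (1 / (n + 1)) ∘ g) with hq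
  have hu : ∀ n : ℕ, MemSobolev m (χ * sawtooth (1 / (n + 1)) ∘ f) := fun n =>
    (hf.comp (lipschitzWith_sawtooth (hpos n)) (sawtooth_zero _)).cutoff_mul hχ h0 h1
  have hv : ∀ n : ℕ, MemSobolev m (χ * sawtooth (1 / (n + 1)) ∘ g) := fun n =>
    (hg.comp (lipschitzWith_sawtooth (hpos n)) (sawtooth_zero _)).cutoff_mul hχ h0 h1
  have hq0 : ∀ n, ∫ x, q n x ∂m = 0 := fun n =>
    (sobolevNorm_parallelogram_iff (hu n) (hv n)).1 (hH _ (hu n) _ (hv n))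
  have hqi : ∀ n, Integrable (q n) m := fun n => integrable_parallelogramDefect (hu n) (hv n)
  have hpi := integrable_parallelogramDefect hf hg
  have hχm : AEStronglyMeasurable (fun x => χ x ^ 2) m :=
    (hχ.continuous.pow 2).measurable.aestronglyMeasurable
  have hci : Integrable (fun x => χ x ^ 2 * parallelogramDefect m f g x) m :=
    hpi.bdd_mul hχm (c := 1) (Eventually.of_forall fun x => by
      rw [Real.norm_of_nonneg (sq_nonneg _)]; exact pow_le_one₀ (h0 x) (h1 x))
  -- The error bound with the minimum replaced by `|f| + |g|`. It is a product of two `L²` functions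
  -- and does not depend on the width.
  set b : X → ℝ := fun x => 6 * ((L * (|f x| + |g x|)) * (2 * (weakGrad m f x + weakGrad m g x) +
        L * (|f x| + |g x|))) with hb
  have hbi : Integrable b m := by
    have k1 : MemLp (fun x => L * (|f x| + |g x|)) 2 m := (hf.1.abs.add hg.1.abs).const_mul _
    have k2 : MemLp (fun x => 2 * (weakGrad m f x + weakGrad m g x)) 2 m :=
      (hf.memLp_weakGrad.add hg.memLp_weakGrad).const_mul 2
    exact (k1.integrable_mul (k2.add k1)).const_mul 6
  have hbound : ∀ n, ∀ᵐ x ∂m, |q n x - χ x ^ 2 * parallelogramDefect m f g x| ≤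
      6 * ((L * min (2 * (1 / (n + 1 : ℝ))) (|f x| + |g x|)) *
        (2 * (weakGrad m f x + weakGrad m g x) +
        L * min (2 * (1 / (n + 1 : ℝ))) (|f x| + |g x|))) := fun n =>
    abs_parallelogramDefect_cutoff_le hf hg (hpos n) hχ h0 h1
  have hlim : Tendsto (fun n => ∫ x, (q n x - χ x ^ 2 * parallelogramDefect m f g x) ∂m) atTop
      (𝓝 (∫ _, 0 ∂m)) := by
    refine tendsto_integral_of_dominated_convergence b (fun n => ((hqi n).sub hci).1) hbi
      (fun n => ?_) ?_
    · filter_upwards [hbound n] with x hx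
      refine hx.trans ?_
      have n0 := weakGrad_nonneg m f x
      have n1 := weakGrad_nonneg m g x
      have hmin : min (2 * (1 / (n + 1 : ℝ))) (|f x| + |g x|) ≤ |f x| + |g x| := min_le_right _ _
      have hmin0 : 0 ≤ min (2 * (1 / (n + 1 : ℝ))) (|f x| + |g x|) :=
        le_min (by have := hpos n; positivity) (by positivity)
      simp only [hb]
      gcongr
    · filter_upwards [ae_all_iff.2 hbound] with x hx
      have hmin : Tendsto (fun n : ℕ => min (2 * (1 / ((n : ℝ) + 1))) (|f x| + |g x|)) atTop
          (𝓝 0) := by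
        have := ((tendsto_one_div_add_atTop_nhds_zero_nat (𝕜 := ℝ)).const_mul 2).min
          (tendsto_const_nhds (x := |f x| + |g x|))
        rwa [mul_zero, min_eq_left (by positivity)] at this
      refine squeeze_zero_norm hx ?_
      have h2 := hmin.const_mul (L : ℝ)
      have h3 := (h2.mul (h2.const_add (2 * (weakGrad m f x + weakGrad m g x)))).const_mul 6
      simpa using h3
  simp only [integral_sub (hqi _) hci, hq0, integral_zero, zero_sub] at hlim
  simpa using tendsto_nhds_unique tendsto_const_nhds hlim

/-- In an infinitesimally Hilbertian space, `|D ·|` satisfies the parallelogram law almost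
everywhere. -/
theorem InfinitesimallyHilbertian.parallelogramDefect_eq_zero (hH : InfinitesimallyHilbertian m)
    (hf : MemSobolev m f) (hg : MemSobolev m g) : ∀ᵐ x ∂m, parallelogramDefect m f g x = 0 := by
  have hpi := integrable_parallelogramDefect hf hg
  -- Closed sets suffice, and the indicator of a closed set is the pointwise limit of the squares of
  -- the Lipschitz functions `χ n`.
  refine ae_eq_zero_of_forall_setIntegral_isClosed_eq_zero hpi fun E hE => ?_
  have hpos : ∀ n : ℕ, (0 : ℝ) < 1 / (n + 1) := fun n => Nat.one_div_pos_of_nat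
  set χ : ℕ → X → ℝ := fun n x => (thickenedIndicator (hpos n) E x : ℝ) with hχ
  have hLip : ∀ n : ℕ, LipschitzWith (1 / (n + 1 : ℝ)).toNNReal⁻¹ (χ n) := fun n =>
    lipschitzWith_thickenedIndicator (hpos n) E
  have hχ0 : ∀ n x, 0 ≤ χ n x := fun n x => NNReal.coe_nonneg _
  have hχ1 : ∀ n x, χ n x ≤ 1 := fun n x =>
    NNReal.coe_le_one.2 (thickenedIndicator_le_one (hpos n) E x)
  have hlim : ∀ x, Tendsto (fun n => χ n x) atTop (𝓝 (E.indicator (fun _ => (1 : ℝ)) x)) := by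
    intro x
    have := tendsto_pi_nhds.1 (thickenedIndicator_tendsto_indicator_closure hpos
      tendsto_one_div_add_atTop_nhds_zero_nat E) x
    rw [hE.closure_eq] at this
    have h3 := (NNReal.continuous_coe.tendsto _).comp this
    have e : ((E.indicator (fun _ => (1 : ℝ≥0)) x : ℝ≥0) : ℝ) = E.indicator (fun _ => (1 : ℝ)) x := by
      by_cases hx : x ∈ E <;> simp [hx]
    rw [e] at h3
    exact h3
  have ht : Tendsto (fun n => ∫ x, χ n x ^ 2 * parallelogramDefect m f g x ∂m) atTop
      (𝓝 (∫ x, E.indicator (parallelogramDefect m f g) x ∂m)) := by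
    refine tendsto_integral_of_dominated_convergence (fun x => ‖parallelogramDefect m f g x‖)
      (fun n => ?_) hpi.norm (fun n => Eventually.of_forall fun x => ?_)
      (Eventually.of_forall fun x => ?_)
    · exact ((hLip n).continuous.pow 2).measurable.aestronglyMeasurable.mul hpi.1
    · rw [norm_mul, Real.norm_of_nonneg (sq_nonneg _)]
      exact mul_le_of_le_one_left (norm_nonneg _) (pow_le_one₀ (hχ0 n x) (hχ1 n x))
    · have := ((hlim x).pow 2).mul_const (parallelogramDefect m f g x)
      by_cases hx : x ∈ E
      · simpa [hx] using this
      · simpa [hx] using this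
  simp only [integral_cutoff_mul_parallelogramDefect hH hf hg (hLip _) (hχ0 _) (hχ1 _)] at ht
  rw [integral_indicator hE.measurableSet] at ht
  exact tendsto_nhds_unique ht tendsto_const_nhds

/-- The easy converse. Together the two directions replace the integrated condition by a pointwise
one, which can be carried to another measure and another distance. -/
theorem infinitesimallyHilbertian_of_parallelogramDefect_eq_zero
    (h : ∀ f g : X → ℝ, MemSobolev m f → MemSobolev m g →
      ∀ᵐ x ∂m, parallelogramDefect m f g x = 0) : InfinitesimallyHilbertian m := fun f hf g hg =>
  (sobolevNorm_parallelogram_iff hf hg).2 (integral_eq_zero_of_ae (h f g hf hg))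

end Parallelogram

/-! ### Products of `L^p` functions as continuous bilinear maps -/

section LpProducts

variable {X : Type*} [MeasurableSpace X] {m : Measure X}

/-- The product `L² × L² → L¹`. -/
def mulL2 (m : Measure X) : Lp ℝ 2 m →L[ℝ] Lp ℝ 2 m →L[ℝ] Lp ℝ 1 m :=
  (ContinuousLinearMap.mul ℝ ℝ).holderL m 2 2 1

theorem coeFn_mulL2 (u v : Lp ℝ 2 m) : ∀ᵐ x ∂m, mulL2 m u v x = u x * v x :=
  (ContinuousLinearMap.mul ℝ ℝ).coeFn_holder u v

/-- The product `L^∞ × L^p → L^p`. -/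
def mulLinfty (m : Measure X) (p : ℝ≥0∞) [Fact (1 ≤ p)] :
    Lp ℝ ∞ m →L[ℝ] Lp ℝ p m →L[ℝ] Lp ℝ p m :=
  (ContinuousLinearMap.mul ℝ ℝ).holderL m ∞ p p

theorem coeFn_mulLinfty {p : ℝ≥0∞} [Fact (1 ≤ p)] {a : X → ℝ} (ha : MemLp a ∞ m) (u : Lp ℝ p m) :
    ∀ᵐ x ∂m, mulLinfty m p ha.toLp u x = a x * u x := by
  filter_upwards [(ContinuousLinearMap.mul ℝ ℝ).coeFn_holder (r := p) ha.toLp u, ha.coeFn_toLp]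
    with x h1 h2
  rw [← h2]
  exact h1

end LpProducts

/-! ### The `L¹`-valued inner product on the cotangent module -/

section CotangentInner

variable {X : Type*} [MetricSpace X] [MeasurableSpace X] [BorelSpace X] {m : Measure X}

theorem continuous_pointwiseNorm : Continuous (pointwiseNorm : Cotangent m → Lp ℝ 2 m) :=
  UniformSpace.Completion.continuous_extension

theorem norm_pointwiseNorm (ω : Cotangent m) : ‖pointwiseNorm ω‖ = ‖ω‖ := by
  induction ω using UniformSpace.Completion.induction_on with
  | hp => exact isClosed_eq continuous_pointwiseNorm.norm continuous_norm
  | ih e =>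
    rw [pointwiseNorm_coe, UniformSpace.Completion.norm_coe, PreCotangent.pnormLp, Lp.norm_toLp,
      PreCotangent.norm_def]

theorem pointwiseNorm_coe_ae (e : PreCotangent m) :
    ∀ᵐ x ∂m, pointwiseNorm (e : Cotangent m) x = weakGrad m (e.val x) x := by
  rw [pointwiseNorm_coe]
  exact e.memLp_pnorm.coeFn_toLp

/-- The squared pointwise norm `|ω|² ∈ L¹(m)`. -/
def pointwiseNormSq (ω : Cotangent m) : Lp ℝ 1 m := mulL2 m (pointwiseNorm ω) (pointwiseNorm ω)

theorem coeFn_pointwiseNormSq (ω : Cotangent m) :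
    ∀ᵐ x ∂m, pointwiseNormSq ω x = pointwiseNorm ω x ^ 2 := by
  filter_upwards [coeFn_mulL2 (pointwiseNorm ω) (pointwiseNorm ω)] with x hx
  rw [sq, ← hx, pointwiseNormSq]

theorem continuous_pointwiseNormSq : Continuous (pointwiseNormSq : Cotangent m → Lp ℝ 1 m) :=
  ((mulL2 m).continuous.comp continuous_pointwiseNorm).clm_apply continuous_pointwiseNorm

theorem integral_pointwiseNormSq (ω : Cotangent m) :
    ∫ x, pointwiseNormSq ω x ∂m = ‖ω‖ ^ 2 := by
  rw [integral_congr_ae (coeFn_pointwiseNormSq ω), ← toReal_eLpNorm_two_sq (Lp.memLp _),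
    ← Lp.norm_def, norm_pointwiseNorm]

/-- The pointwise inner product, with values in `L¹(m)`. -/
def innerLp (ω η : Cotangent m) : Lp ℝ 1 m :=
  (1 / 4 : ℝ) • (pointwiseNormSq (ω + η) - pointwiseNormSq (ω - η))

theorem coeFn_innerLp (ω η : Cotangent m) : ∀ᵐ x ∂m, innerLp ω η x = cotangentInner ω η x := by
  filter_upwards [coeFn_pointwiseNormSq (ω + η), coeFn_pointwiseNormSq (ω - η),
    Lp.coeFn_smul (1 / 4 : ℝ) (pointwiseNormSq (ω + η) - pointwiseNormSq (ω - η)),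
    Lp.coeFn_sub (pointwiseNormSq (ω + η)) (pointwiseNormSq (ω - η))] with x h1 h2 h3 h4
  rw [innerLp, h3, Pi.smul_apply, h4, Pi.sub_apply, h1, h2, cotangentInner, smul_eq_mul]
  ring

theorem continuous_pointwiseNormSq_add :
    Continuous fun p : Cotangent m × Cotangent m => pointwiseNormSq (p.1 + p.2) :=
  continuous_pointwiseNormSq.comp (by fun_prop)

theorem continuous_pointwiseNormSq_sub :
    Continuous fun p : Cotangent m × Cotangent m => pointwiseNormSq (p.1 - p.2) :=
  continuous_pointwiseNormSq.comp (by fun_prop)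

theorem Continuous.innerLp {Z : Type*} [TopologicalSpace Z] {f g : Z → Cotangent m}
    (hf : Continuous f) (hg : Continuous g) : Continuous fun z => innerLp (f z) (g z) := by
  have h1 : Continuous fun z => f z + g z := by fun_prop
  have h2 : Continuous fun z => f z - g z := by fun_prop
  have h3 : Continuous fun z => pointwiseNormSq (f z + g z) := continuous_pointwiseNormSq.comp h1
  have h4 : Continuous fun z => pointwiseNormSq (f z - g z) := continuous_pointwiseNormSq.comp h2
  unfold _root_.innerLp
  fun_prop

theorem continuous_innerLp_right (ω : Cotangent m) : Continuous fun η => innerLp ω η :=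
  continuous_const.innerLp continuous_id

theorem innerLp_coe_ae (e e' : PreCotangent m) :
    ∀ᵐ x ∂m, innerLp (e : Cotangent m) (e' : Cotangent m) x =
      carreDuChamp m (e.val x) (e'.val x) x := by
  filter_upwards [coeFn_innerLp (e : Cotangent m) e', pointwiseNorm_coe_ae (e + e'),
    pointwiseNorm_coe_ae (e - e')] with x h1 h2 h3
  rw [h1, cotangentInner, ← UniformSpace.Completion.coe_add, ← UniformSpace.Completion.coe_sub,
    h2, h3]
  rfl

/-- Two families involve only countably many pairs of Sobolev functions, so the pointwise law holds
for them outside one null set. Both sides are continuous into `L¹`, and families are dense. -/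
theorem pointwiseNormSq_parallelogram (hH : InfinitesimallyHilbertian m) (ω η : Cotangent m) :
    pointwiseNormSq (ω + η) + pointwiseNormSq (ω - η) =
      (2 : ℝ) • pointwiseNormSq ω + (2 : ℝ) • pointwiseNormSq η := by
  induction ω, η using UniformSpace.Completion.induction_on₂ with
  | hp =>
    have h := continuous_pointwiseNormSq_add (m := m)
    have h' := continuous_pointwiseNormSq_sub (m := m)
    have h'' := continuous_pointwiseNormSq (m := m)
    exact isClosed_eq (by fun_prop) (by fun_prop)
  | ih e e' =>
    rw [← UniformSpace.Completion.coe_add, ← UniformSpace.Completion.coe_sub]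
    have hdef := (e.isStep.prodMk e'.isStep).ae (m := m)
      (P := fun p x => parallelogramDefect m p.1 p.2 x = 0)
      fun p => hH.parallelogramDefect_eq_zero p.1.2 p.2.2
    refine Lp.ext ?_
    filter_upwards [hdef, coeFn_pointwiseNormSq ((e + e' : PreCotangent m) : Cotangent m),
      coeFn_pointwiseNormSq ((e - e' : PreCotangent m) : Cotangent m),
      coeFn_pointwiseNormSq (e : Cotangent m), coeFn_pointwiseNormSq (e' : Cotangent m),
      pointwiseNorm_coe_ae (e + e'), pointwiseNorm_coe_ae (e - e'), pointwiseNorm_coe_ae e,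
      pointwiseNorm_coe_ae e',
      Lp.coeFn_add (pointwiseNormSq ((e + e' : PreCotangent m) : Cotangent m))
        (pointwiseNormSq ((e - e' : PreCotangent m) : Cotangent m)),
      Lp.coeFn_add ((2 : ℝ) • pointwiseNormSq (e : Cotangent m))
        ((2 : ℝ) • pointwiseNormSq (e' : Cotangent m)),
      Lp.coeFn_smul (2 : ℝ) (pointwiseNormSq (e : Cotangent m)),
      Lp.coeFn_smul (2 : ℝ) (pointwiseNormSq (e' : Cotangent m))]
      with x h0 h1 h2 h3 h4 k1 k2 k3 k4 l1 l2 l3 l4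
    rw [l1, l2, Pi.add_apply, Pi.add_apply, l3, l4, Pi.smul_apply, Pi.smul_apply, h1, h2, h3, h4,
      k1, k2, k3, k4]
    have h0' : weakGrad m ((e + e').val x) x ^ 2 + weakGrad m ((e - e').val x) x ^ 2 -
      2 * weakGrad m (e.val x) x ^ 2 - 2 * weakGrad m (e'.val x) x ^ 2 = 0 := h0
    simp only [smul_eq_mul]
    linarith

/-- A function that satisfies the parallelogram law has a biadditive polarization. -/
theorem polarization_add_right {E F : Type*} [AddCommGroup E] [AddCommGroup F] [Module ℝ F]
    {q : E → F} (hq : ∀ x y, q (x + y) + q (x - y) = (2 : ℝ) • q x + (2 : ℝ) • q y) (x y z : E) :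
    q (x + (y + z)) - q (x - (y + z)) = (q (x + y) - q (x - y)) + (q (x + z) - q (x - z)) := by
  have a := hq (x + y) z
  have b := hq (x - y) z
  have c := hq (x + z) y
  have d := hq (x - z) y
  rw [show x + z + y = x + (y + z) by abel, show x + z - y = x - y + z by abel] at c
  rw [show x - z + y = x + y - z by abel, show x - z - y = x - (y + z) by abel] at d
  rw [show x + y + z = x + (y + z) by abel] at a
  rw [show x - y - z = x - (y + z) by abel] at b
  have h : (2 : ℝ) • (q (x + (y + z)) - q (x - (y + z))) =
      (2 : ℝ) • ((q (x + y) - q (x - y)) + (q (x + z) - q (x - z))) := by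
    -- Twice the left side is regrouped into the four sums that the law evaluates at `(x ± y, z)`
    -- and `(x ± z, y)`; the terms in `q y` and `q z` then cancel.
    have e : (2 : ℝ) • (q (x + (y + z)) - q (x - (y + z))) =
        (q (x + (y + z)) + q (x + y - z)) - (q (x - y + z) + q (x - (y + z))) +
        ((q (x + (y + z)) + q (x - y + z)) - (q (x + y - z) + q (x - (y + z)))) := by
      rw [two_smul]; abel
    rw [e, a, b, c, d]
    simp only [smul_add, smul_sub]
    abel
  exact smul_right_injective F (two_ne_zero : (2 : ℝ) ≠ 0) h

theorem innerLp_add_right (hH : InfinitesimallyHilbertian m) (ω η ζ : Cotangent m) :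
    innerLp ω (η + ζ) = innerLp ω η + innerLp ω ζ := by
  rw [innerLp, innerLp, innerLp, ← smul_add,
    polarization_add_right (pointwiseNormSq_parallelogram hH)]

/-- The map `⟨ω, ·⟩` from `L²(T*M)` to `L¹(m)`. -/
def innerCLM (hH : InfinitesimallyHilbertian m) (ω : Cotangent m) : Cotangent m →L[ℝ] Lp ℝ 1 m :=
  -- Homogeneity over `ℝ` comes for free: an additive continuous map is real-linear.
  (AddMonoidHom.mk' (innerLp ω) (innerLp_add_right hH ω)).toRealLinearMap
    (continuous_innerLp_right ω)

theorem innerCLM_apply (hH : InfinitesimallyHilbertian m) (ω η : Cotangent m) :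
    innerCLM hH ω η = innerLp ω η := rfl

theorem pointwiseNormSq_zero : pointwiseNormSq (0 : Cotangent m) = 0 := by
  have : pointwiseNorm (0 : Cotangent m) = 0 := by
    rw [← norm_eq_zero, norm_pointwiseNorm, norm_zero]
  rw [pointwiseNormSq, this, map_zero]

theorem pointwiseNormSq_neg (hH : InfinitesimallyHilbertian m) (ω : Cotangent m) :
    pointwiseNormSq (-ω) = pointwiseNormSq ω := by
  have h := pointwiseNormSq_parallelogram hH 0 ω
  rw [zero_add, zero_sub, pointwiseNormSq_zero, smul_zero, zero_add, two_smul] at h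
  exact add_left_cancel h

theorem innerLp_comm (hH : InfinitesimallyHilbertian m) (ω η : Cotangent m) :
    innerLp ω η = innerLp η ω := by
  rw [innerLp, innerLp, add_comm, ← neg_sub η ω, pointwiseNormSq_neg hH]

theorem innerLp_self (hH : InfinitesimallyHilbertian m) (ω : Cotangent m) :
    innerLp ω ω = pointwiseNormSq ω := by
  have h := pointwiseNormSq_parallelogram hH ω ω
  rw [sub_self, pointwiseNormSq_zero, add_zero] at h
  rw [innerLp, sub_self, pointwiseNormSq_zero, sub_zero, h, ← add_smul, smul_smul]
  norm_num

theorem integral_innerLp (ω η : Cotangent m) :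
    ∫ x, innerLp ω η x ∂m = (‖ω + η‖ ^ 2 - ‖ω - η‖ ^ 2) / 4 := by
  have e : ∀ᵐ x ∂m, innerLp ω η x =
      (1 / 4) * (pointwiseNormSq (ω + η) x - pointwiseNormSq (ω - η) x) := by
    filter_upwards [Lp.coeFn_smul (1 / 4 : ℝ) (pointwiseNormSq (ω + η) - pointwiseNormSq (ω - η)),
      Lp.coeFn_sub (pointwiseNormSq (ω + η)) (pointwiseNormSq (ω - η))] with x h1 h2
    rw [innerLp, h1, Pi.smul_apply, h2, Pi.sub_apply, smul_eq_mul]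
  rw [integral_congr_ae e, integral_const_mul,
    integral_sub (L1.integrable_coeFn _) (L1.integrable_coeFn _), integral_pointwiseNormSq,
    integral_pointwiseNormSq]
  ring

/-- Real homogeneity is not visible in the polarization formula; it is read off from the linearity
of `innerCLM` applied to differentials. -/
theorem carreDuChamp_smul_right (hH : InfinitesimallyHilbertian m) (f g : sobolevSpace m) (c : ℝ) :
    ∀ᵐ x ∂m, carreDuChamp m f (c • g : sobolevSpace m) x = c * carreDuChamp m f g x := by
  have e : differential m (c • g) = c • differential m g :=
    UniformSpace.Completion.coe_smul c (PreCotangent.const g)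
  have h := (innerCLM hH (differential m f)).map_smul c (differential m g)
  rw [← e, innerCLM_apply, innerCLM_apply] at h
  filter_upwards [innerLp_coe_ae (PreCotangent.const f) (PreCotangent.const (c • g)),
    innerLp_coe_ae (PreCotangent.const f) (PreCotangent.const g),
    Lp.coeFn_smul c (innerLp (differential m f) (differential m g))] with x h1 h2 h3
  have h1' : innerLp (differential m f) (differential m (c • g)) x =
    carreDuChamp m f (c • g : sobolevSpace m) x := h1
  have h2' : innerLp (differential m f) (differential m g) x = carreDuChamp m f g x := h2
  rw [← h1', h, h3, Pi.smul_apply, h2', smul_eq_mul]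

/-- The defining estimate of `linftyMul` with the step function itself as approximant has error
zero. -/
theorem linftyMul_of_isStep {s : X → ℝ} (hs : IsStep s) (hb : MemLp s ∞ m) :
    linftyMul m s = (preStepMulL hs hb).completion := by
  have h := linftyMul_spec hb hs hb
  rw [sub_self, eLpNorm_zero, ENNReal.toReal_zero] at h
  exact (sub_eq_zero.1 (norm_le_zero_iff.1 h)).symm

theorem linftyMul_coe {s : X → ℝ} (hs : IsStep s) (hb : MemLp s ∞ m) (e : PreCotangent m) :
    linftyMul m s (e : Cotangent m) = (preStepMul hs hb e : PreCotangent m) := by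
  rw [linftyMul_of_isStep hs hb, ContinuousLinearMap.completion_apply_coe]
  rfl

/-- Multiplication by `a ∈ L^∞` is a limit of multiplications by step functions. -/
theorem exists_tendsto_linftyMul {a : X → ℝ} (ha : MemLp a ∞ m) :
    ∃ s : ℕ → X → ℝ, (∀ n, IsStep (s n)) ∧ (∃ hb : ∀ n, MemLp (s n) ∞ m,
      Tendsto (fun n => (hb n).toLp) atTop (𝓝 ha.toLp)) ∧
      Tendsto (fun n => eLpNorm (s n - a) ∞ m) atTop (𝓝 0) ∧
      Tendsto (fun n => linftyMul m (s n)) atTop (𝓝 (linftyMul m a)) := by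
  choose s hs hb hc using exists_isStep_approx ha
  have h0 : Tendsto (fun n => (eLpNorm (s n - a) ∞ m).toReal) atTop (𝓝 0) :=
    squeeze_zero (fun n => ENNReal.toReal_nonneg) hc tendsto_one_div_add_atTop_nhds_zero_nat
  refine ⟨s, hs, ⟨hb, ?_⟩, ?_, ?_⟩
  · rw [tendsto_iff_norm_sub_tendsto_zero]
    refine h0.congr fun n => ?_
    rw [← MemLp.toLp_sub, Lp.norm_toLp]
  · exact (ENNReal.tendsto_toReal_iff (fun n => ((hb n).sub ha).2.ne) ENNReal.zero_ne_top).1 h0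
  · rw [tendsto_iff_norm_sub_tendsto_zero]
    refine squeeze_zero (fun n => norm_nonneg _) (fun n => ?_) h0
    rw [linftyMul_of_isStep (hs n) (hb n)]
    exact linftyMul_spec ha (hs n) (hb n)

/-- On families, a step function multiplies each Sobolev function by a constant on each piece, so
homogeneity of the carré du champ suffices. Density and continuity do the rest. -/
theorem innerLp_linftyMul_of_isStep (hH : InfinitesimallyHilbertian m) {s : X → ℝ} (hs : IsStep s)
    (hb : MemLp s ∞ m) (ω η : Cotangent m) :
    innerLp ω (linftyMul m s η) = mulLinfty m 1 hb.toLp (innerLp ω η) := by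
  induction ω, η using UniformSpace.Completion.induction_on₂ with
  | hp =>
    have h : Continuous fun p : Cotangent m × Cotangent m => linftyMul m s p.2 := by fun_prop
    have h' : Continuous fun p : Cotangent m × Cotangent m => innerLp p.1 p.2 :=
      continuous_fst.innerLp continuous_snd
    exact isClosed_eq (continuous_fst.innerLp h) (by fun_prop)
  | ih e e' =>
    rw [linftyMul_coe hs hb]
    have h := (hs.prodMk (e.isStep.prodMk e'.isStep)).ae (m := m)
      (P := fun p x => carreDuChamp m p.2.1 (p.1 • p.2.2 : sobolevSpace m) x =
        p.1 * carreDuChamp m p.2.1 p.2.2 x)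
      fun p => carreDuChamp_smul_right hH p.2.1 p.2.2 p.1
    refine Lp.ext ?_
    filter_upwards [h, innerLp_coe_ae e (preStepMul hs hb e'), innerLp_coe_ae e e',
      coeFn_mulLinfty hb (innerLp (e : Cotangent m) (e' : Cotangent m))] with x h1 h2 h3 h4
    rw [h2, h4, h3]
    exact h1

/-- `⟨ω, a η⟩ = a ⟨ω, η⟩`. -/
theorem innerLp_linftyMul (hH : InfinitesimallyHilbertian m) {a : X → ℝ} (ha : MemLp a ∞ m)
    (ω η : Cotangent m) :
    innerLp ω (linftyMul m a η) = mulLinfty m 1 ha.toLp (innerLp ω η) := by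
  obtain ⟨s, hs, ⟨hb, h1⟩, -, h2⟩ := exists_tendsto_linftyMul ha
  have h3 : Tendsto (fun n => innerLp ω (linftyMul m (s n) η)) atTop
      (𝓝 (innerLp ω (linftyMul m a η))) :=
    ((continuous_innerLp_right ω).tendsto _).comp
      (((ContinuousLinearMap.apply ℝ _ η).continuous.tendsto _).comp h2)
  have h4 : Tendsto (fun n => mulLinfty m 1 (hb n).toLp (innerLp ω η)) atTop
      (𝓝 (mulLinfty m 1 ha.toLp (innerLp ω η))) :=
    (((ContinuousLinearMap.apply ℝ _ (innerLp ω η)).continuous.comp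
      (mulLinfty m 1).continuous).tendsto _).comp h1
  refine tendsto_nhds_unique h3 (h4.congr fun n => ?_)
  exact (innerLp_linftyMul_of_isStep hH (hs n) (hb n) ω η).symm

theorem cotangentInner_linftyMul_right (hH : InfinitesimallyHilbertian m) {a : X → ℝ}
    (ha : MemLp a ∞ m) (ω η : Cotangent m) :
    ∀ᵐ x ∂m, cotangentInner ω (linftyMul m a η) x = a x * cotangentInner ω η x := by
  filter_upwards [coeFn_innerLp ω (linftyMul m a η), coeFn_innerLp ω η,
    coeFn_mulLinfty ha (innerLp ω η)] with x h1 h2 h3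
  rw [← h1, ← h2, innerLp_linftyMul hH ha, h3]

theorem cotangentInner_comm (hH : InfinitesimallyHilbertian m) (ω η : Cotangent m) :
    ∀ᵐ x ∂m, cotangentInner ω η x = cotangentInner η ω x := by
  filter_upwards [coeFn_innerLp ω η, coeFn_innerLp η ω] with x h1 h2
  rw [← h1, ← h2, innerLp_comm hH]

theorem cotangentInner_linftyMul_left (hH : InfinitesimallyHilbertian m) {a : X → ℝ}
    (ha : MemLp a ∞ m) (ω η : Cotangent m) :
    ∀ᵐ x ∂m, cotangentInner (linftyMul m a ω) η x = a x * cotangentInner ω η x := by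
  filter_upwards [cotangentInner_comm hH (linftyMul m a ω) η, cotangentInner_comm hH ω η,
    cotangentInner_linftyMul_right hH ha η ω] with x h1 h2 h3
  rw [h1, h2, h3]

theorem cotangentInner_self (hH : InfinitesimallyHilbertian m) (ω : Cotangent m) :
    ∀ᵐ x ∂m, cotangentInner ω ω x = pointwiseNorm ω x ^ 2 := by
  filter_upwards [coeFn_innerLp ω ω, coeFn_pointwiseNormSq ω] with x h1 h2
  rw [← h1, ← h2, innerLp_self hH]

theorem eq_zero_of_pointwiseNorm_eq_zero {ω : Cotangent m}
    (h : ∀ᵐ x ∂m, pointwiseNorm ω x = 0) : ω = 0 := by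
  rw [← norm_eq_zero, ← norm_pointwiseNorm, norm_eq_zero]
  exact (Lp.eq_zero_iff_ae_eq_zero).2 h

end CotangentInner

/-! ### The Riesz theorem for the cotangent module -/

section Riesz

variable {X : Type*} [MetricSpace X] [MeasurableSpace X] [BorelSpace X] {m : Measure X}

theorem norm_parallelogram (hH : InfinitesimallyHilbertian m) (ω η : Cotangent m) :
    ‖ω + η‖ * ‖ω + η‖ + ‖ω - η‖ * ‖ω - η‖ = 2 * (‖ω‖ * ‖ω‖ + ‖η‖ * ‖η‖) := by
  have h := congrArg (L1.integralCLM (E := ℝ)) (pointwiseNormSq_parallelogram hH ω η)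
  have e : ∀ ω : Cotangent m, L1.integralCLM (E := ℝ) (pointwiseNormSq ω) = ‖ω‖ ^ 2 := fun ω => by
    rw [← integral_pointwiseNormSq, ← L1.integral_eq_integral, L1.integral_eq]
  simp only [map_add, map_smul, e, smul_eq_mul] at h
  linarith

/-- Continuous functionals on `L²(T*M)` are represented by the integrated inner product. -/
theorem exists_integral_innerLp_eq (hH : InfinitesimallyHilbertian m)
    (ℓ : Cotangent m →L[ℝ] ℝ) : ∃ ω, ∀ η, ℓ η = ∫ x, innerLp ω η x ∂m := by
  -- By Jordan and von Neumann the norm comes from an inner product, to which the Fréchet–Riesz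
  -- theorem applies. Its polarization is the integrated pointwise product.
  let _ : InnerProductSpace ℝ (Cotangent m) := InnerProductSpace.ofNorm ℝ (norm_parallelogram hH)
  refine ⟨(InnerProductSpace.toDual ℝ (Cotangent m)).symm ℓ, fun η => ?_⟩
  rw [integral_innerLp]
  have h := InnerProductSpace.toDual_symm_apply (𝕜 := ℝ) (x := η) (y := ℓ)
  rw [← h]
  generalize (InnerProductSpace.toDual ℝ (Cotangent m)).symm ℓ = ω
  have h1 := norm_add_sq_real ω η
  have h2 := norm_sub_sq_real ω η
  rw [h1, h2]
  ring

theorem exists_isRieszDual_of_cotangent (hH : InfinitesimallyHilbertian m) (ω : Cotangent m) :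
    ∃ V : Tangent m, IsRieszDual ω V := by
  refine ⟨⟨innerCLM hH ω, fun a ha η => ?_⟩, fun η => coeFn_innerLp ω η⟩
  filter_upwards [coeFn_mulLinfty ha (innerLp ω η)] with x hx
  rw [innerCLM_apply, innerCLM_apply, innerLp_linftyMul hH ha, hx]

theorem IsRieszDual.tangent_unique {ω : Cotangent m} {V W : Tangent m} (hV : IsRieszDual ω V)
    (hW : IsRieszDual ω W) : V = W := by
  refine Subtype.ext (ContinuousLinearMap.ext fun η => Lp.ext ?_)
  filter_upwards [hV η, hW η] with x h1 h2
  rw [h1, h2]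

/-- The functional `η ↦ ∫ V(η)` is represented by some `ω`. Since `V` and `⟨ω, ·⟩` are both linear
over `L^∞`, equality of integrals localizes to equality almost everywhere. -/
theorem exists_isRieszDual_of_tangent (hH : InfinitesimallyHilbertian m) (V : Tangent m) :
    ∃ ω : Cotangent m, IsRieszDual ω V := by
  obtain ⟨ω, hω⟩ := exists_integral_innerLp_eq hH
    ((L1.integralCLM (E := ℝ)) ∘L (V : Cotangent m →L[ℝ] Lp ℝ 1 m))
  have hω' : ∀ η, ∫ x, (V : Cotangent m →L[ℝ] Lp ℝ 1 m) η x ∂m = ∫ x, innerLp ω η x ∂m :=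
    fun η => by
      rw [← hω η, ← L1.integral_eq_integral, L1.integral_eq, ContinuousLinearMap.comp_apply]
  refine ⟨ω, fun η => ?_⟩
  have key : (V : Cotangent m →L[ℝ] Lp ℝ 1 m) η =ᵐ[m] innerLp ω η := by
    refine Integrable.ae_eq_of_forall_setIntegral_eq _ _ (L1.integrable_coeFn _)
      (L1.integrable_coeFn _) fun A hA _ => ?_
    -- Testing with `χ_A η` turns the identity of total integrals into one of integrals over the
    -- arbitrary measurable set `A`.
    set a : X → ℝ := A.indicator fun _ => 1 with ha_def
    have ha : MemLp a ∞ m := memLp_top_of_bound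
      (measurable_const.indicator hA).aestronglyMeasurable 1 (Eventually.of_forall fun x => by
        by_cases hx : x ∈ A <;> simp [ha_def, hx])
    have h := hω' (linftyMul m a η)
    have e1 : ∀ᵐ x ∂m, (V : Cotangent m →L[ℝ] Lp ℝ 1 m) (linftyMul m a η) x =
        A.indicator ((V : Cotangent m →L[ℝ] Lp ℝ 1 m) η) x := by
      filter_upwards [V.2 a ha η] with x hx
      rw [hx]
      by_cases hxA : x ∈ A <;> simp [ha_def, hxA]
    have e2 : ∀ᵐ x ∂m, innerLp ω (linftyMul m a η) x = A.indicator (innerLp ω η) x := by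
      filter_upwards [coeFn_mulLinfty ha (innerLp ω η)] with x hx
      rw [innerLp_linftyMul hH ha, hx]
      by_cases hxA : x ∈ A <;> simp [ha_def, hxA]
    rw [integral_congr_ae e1, integral_congr_ae e2, integral_indicator hA,
      integral_indicator hA] at h
    exact h
  filter_upwards [key, coeFn_innerLp ω η] with x h1 h2
  rw [h1, h2]

/-- The inner product is nondegenerate: the difference of two representatives is orthogonal to
itself, so its norm is zero. -/
theorem IsRieszDual.cotangent_unique (hH : InfinitesimallyHilbertian m) {ω ω' : Cotangent m}
    {V : Tangent m} (h : IsRieszDual ω V) (h' : IsRieszDual ω' V) : ω = ω' := by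
  have h1 : ∀ η, innerLp ω η = innerLp ω' η := fun η => by
    refine Lp.ext ?_
    filter_upwards [h η, h' η, coeFn_innerLp ω η, coeFn_innerLp ω' η] with x k1 k2 k3 k4
    rw [k3, k4, ← k1, k2]
  have h2 : pointwiseNormSq (ω - ω') = 0 := by
    rw [← innerLp_self hH, ← innerCLM_apply hH, map_sub, innerCLM_apply, innerCLM_apply,
      innerLp_comm hH _ ω, innerLp_comm hH _ ω', h1]
    exact sub_self _
  have h3 := integral_pointwiseNormSq (ω - ω')
  rw [h2, integral_congr_ae (Lp.coeFn_zero ℝ 1 m)] at h3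
  simp only [Pi.zero_apply, integral_zero] at h3
  exact sub_eq_zero.1 (norm_eq_zero.1 (pow_eq_zero_iff two_ne_zero |>.1 h3.symm))

/-- The Riesz theorem for the cotangent module of an infinitesimally Hilbertian space. -/
theorem InfinitesimallyHilbertian.rieszCorrespondence (hH : InfinitesimallyHilbertian m) :
    RieszCorrespondence m := by
  refine ⟨fun ω => ?_, fun V => ?_⟩
  · obtain ⟨V, hV⟩ := exists_isRieszDual_of_cotangent hH ω
    exact ⟨V, hV, fun W hW => hW.tangent_unique hV⟩
  · obtain ⟨ω, hω⟩ := exists_isRieszDual_of_tangent hH V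
    exact ⟨ω, hω, fun η hη => hη.cotangent_unique hH hω⟩

theorem isRieszDual_sharp (hH : InfinitesimallyHilbertian m) (ω : Cotangent m) :
    IsRieszDual ω (sharp ω) := by
  have h := exists_isRieszDual_of_cotangent hH ω
  rw [sharp, dif_pos h]
  exact h.choose_spec

theorem isRieszDual_flat (hH : InfinitesimallyHilbertian m) (V : Tangent m) :
    IsRieszDual (flat V) V := by
  have h := exists_isRieszDual_of_tangent hH V
  rw [flat, dif_pos h]
  exact h.choose_spec

end Riesz

/-! ### The identification of the cotangent modules -/

section Transfer

variable {X : Type*} [MetricSpace X] [MeasurableSpace X] [BorelSpace X] [GeodesicSpace X]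

/-- All four gradients in the defect scale by the same `e^{-w}`, so its vanishing almost everywhere
is inherited. The weight varies from point to point, which is why the pointwise form of the law is
required. -/
theorem InfinitesimallyHilbertian.conformalMeasure {m : Measure X}
    (hH : InfinitesimallyHilbertian m) (w v : X →ᵇ ℝ) :
    InfinitesimallyHilbertian (conformalMeasure w v m) := by
  refine infinitesimallyHilbertian_of_parallelogramDefect_eq_zero fun f g hf hg => ?_
  have hf' : MemSobolev m (f ∘ toConformal w) :=
    (memSobolev_conformalMeasure_iff (f := f ∘ toConformal w)).1 hf
  have hg' : MemSobolev m (g ∘ toConformal w) :=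
    (memSobolev_conformalMeasure_iff (f := g ∘ toConformal w)).1 hg
  have e : ∀ h : ConformalSpace w → ℝ, MemSobolev m (h ∘ toConformal w) → ∀ᵐ x ∂m,
      weakGrad (_root_.conformalMeasure w v m) h (toConformal w x) =
        Real.exp (-w x) * weakGrad m (h ∘ toConformal w) x := fun h hh =>
    weakGrad_conformalMeasure hh
  rw [ae_conformalMeasure_iff]
  filter_upwards [e f hf', e g hg', e (f + g) (hf'.add hg'), e (f - g) (hf'.sub hg'),
    hH.parallelogramDefect_eq_zero hf' hg'] with x h1 h2 h3 h4 h5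
  rw [parallelogramDefect, h1, h2, h3, h4]
  have h5' : weakGrad m ((f + g) ∘ toConformal w) x ^ 2 +
    weakGrad m ((f - g) ∘ toConformal w) x ^ 2 - 2 * weakGrad m (f ∘ toConformal w) x ^ 2 -
    2 * weakGrad m (g ∘ toConformal w) x ^ 2 = 0 := h5
  linear_combination Real.exp (-w x) ^ 2 * h5'

variable (m : Measure X) (w v : X →ᵇ ℝ)

theorem lpTransfer_const_ne_top (p : ℝ≥0∞) :
    ENNReal.ofReal (Real.exp ‖v‖) ^ (1 / p).toReal ≠ ∞ :=
  ENNReal.rpow_ne_top_of_nonneg ENNReal.toReal_nonneg ENNReal.ofReal_ne_top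

/-- `L^p(m)` and `L^p(e^v m)` consist of the same functions. -/
def lpTransfer (p : ℝ≥0∞) [Fact (1 ≤ p)] : Lp ℝ p m ≃L[ℝ] Lp ℝ p (conformalMeasure w v m) :=
  LinearEquiv.toContinuousLinearEquivOfBounds
    { toFun := fun u => (memLp_conformalMeasure_iff.2 (Lp.memLp u)).toLp (u ∘ (toConformal w).symm)
      invFun := fun u => (Lp.memLp u).comp_toConformal.toLp (u ∘ toConformal w)
      map_add' := fun u u' => by
        rw [← MemLp.toLp_add, MemLp.toLp_eq_toLp_iff]
        exact ae_conformalMeasure_iff.2 (Lp.coeFn_add u u')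
      map_smul' := fun c u => by
        rw [RingHom.id_apply, ← MemLp.toLp_const_smul, MemLp.toLp_eq_toLp_iff]
        exact ae_conformalMeasure_iff.2 (Lp.coeFn_smul c u)
      left_inv := fun u => by
        refine Lp.ext ?_
        filter_upwards [MemLp.coeFn_toLp (Lp.memLp ((memLp_conformalMeasure_iff (w := w) (v := v).2
          (Lp.memLp u)).toLp (u ∘ (toConformal w).symm))).comp_toConformal,
          ae_conformalMeasure_iff.1 (memLp_conformalMeasure_iff (w := w) (v := v).2
            (Lp.memLp u)).coeFn_toLp] with x h1 h2
        rw [h1]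
        exact h2
      right_inv := fun u => by
        refine Lp.ext (ae_conformalMeasure_iff.2 ?_)
        filter_upwards [ae_conformalMeasure_iff.1 (memLp_conformalMeasure_iff (w := w) (v := v).2
            (Lp.memLp ((Lp.memLp u).comp_toConformal.toLp (u ∘ toConformal w)))).coeFn_toLp,
          (Lp.memLp u).comp_toConformal.coeFn_toLp] with x h1 h2
        rw [h1]
        exact h2 }
    (ENNReal.ofReal (Real.exp ‖v‖) ^ (1 / p).toReal).toReal
    (ENNReal.ofReal (Real.exp ‖v‖) ^ (1 / p).toReal).toReal
    (fun u => by
      change ‖(memLp_conformalMeasure_iff.2 (Lp.memLp u)).toLp (u ∘ (toConformal w).symm)‖ ≤ _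
      rw [Lp.norm_toLp, Lp.norm_def, ← ENNReal.toReal_mul]
      exact ENNReal.toReal_mono (ENNReal.mul_ne_top (lpTransfer_const_ne_top v p)
        (Lp.eLpNorm_ne_top u)) (eLpNorm_conformalMeasure_le w v m u p))
    (fun u => by
      change ‖(Lp.memLp u).comp_toConformal.toLp (u ∘ toConformal w)‖ ≤ _
      rw [Lp.norm_toLp, Lp.norm_def, ← ENNReal.toReal_mul]
      exact ENNReal.toReal_mono (ENNReal.mul_ne_top (lpTransfer_const_ne_top v p)
        (Lp.eLpNorm_ne_top u)) (eLpNorm_comp_toConformal_le u p))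

theorem coeFn_lpTransfer (p : ℝ≥0∞) [Fact (1 ≤ p)] (u : Lp ℝ p m) :
    ∀ᵐ x ∂m, lpTransfer m w v p u (toConformal w x) = u x :=
  ae_conformalMeasure_iff.1 (memLp_conformalMeasure_iff (w := w) (v := v).2
    (Lp.memLp u)).coeFn_toLp

/-- `W^{1,2}(M)` and `W^{1,2}(M')` consist of the same functions. -/
def sobolevTransfer : sobolevSpace m ≃ₗ[ℝ] sobolevSpace (conformalMeasure w v m) where
  toFun f := ⟨(f : X → ℝ) ∘ (toConformal w).symm,
    (memSobolev_conformalMeasure_iff (f := (f : X → ℝ))).2 f.2⟩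
  invFun g := ⟨(g : ConformalSpace w → ℝ) ∘ toConformal w,
    (memSobolev_conformalMeasure_iff (f := (g : ConformalSpace w → ℝ) ∘ toConformal w)).1 g.2⟩
  map_add' _ _ := rfl
  map_smul' _ _ := rfl
  left_inv _ := rfl
  right_inv _ := rfl

variable {m w}

theorem IsStep.comp_toConformal_symm {α : Type*} {e : X → α} (he : IsStep e) :
    IsStep (e ∘ (toConformal w).symm) := by
  refine ⟨?_, fun a => measurable_toConformal_symm w (he.2 a)⟩
  rw [(toConformal w).symm.surjective.range_comp]
  exact he.1

theorem IsStep.comp_toConformal {α : Type*} {e : ConformalSpace w → α} (he : IsStep e) :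
    IsStep (e ∘ toConformal w) := by
  refine ⟨?_, fun a => measurable_toConformal w (he.2 a)⟩
  rw [(toConformal w).surjective.range_comp]
  exact he.1

variable {v}

theorem weakGrad_sobolevTransfer_step {e : X → sobolevSpace m} (he : IsStep e) :
    ∀ᵐ x ∂m, weakGrad (conformalMeasure w v m) (sobolevTransfer m w v (e x)) (toConformal w x) =
      Real.exp (-w x) * weakGrad m (e x) x :=
  he.ae (m := m) (P := fun f x => weakGrad (conformalMeasure w v m) (sobolevTransfer m w v f)
    (toConformal w x) = Real.exp (-w x) * weakGrad m f x) fun f => weakGrad_conformalMeasure f.2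

/-- Pointwise norms of a family differ by the factor `e^{-w}`, which is bounded with bounded
inverse, and the two measures have the same `L²` functions. -/
theorem memLp_weakGrad_step_iff {e : X → sobolevSpace m} (he : IsStep e) :
    MemLp (fun y => weakGrad (conformalMeasure w v m)
      (sobolevTransfer m w v (e ((toConformal w).symm y))) y) 2 (conformalMeasure w v m) ↔
    MemLp (fun x => weakGrad m (e x) x) 2 m := by
  have h := weakGrad_sobolevTransfer_step (w := w) (v := v) he
  have h1 : MemLp (fun y => weakGrad (conformalMeasure w v m)
      (sobolevTransfer m w v (e ((toConformal w).symm y))) y) 2 (conformalMeasure w v m) ↔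
      MemLp (fun x => Real.exp ((-w) x) * weakGrad m (e x) x) 2 m := by
    rw [← memLp_conformalMeasure_iff (w := w) (v := v) (m := m)]
    exact memLp_congr_ae (ae_conformalMeasure_iff.2 h)
  rw [h1]
  refine ⟨fun h2 => ?_, fun h2 => h2.exp_mul (-w)⟩
  refine (h2.exp_mul w).ae_eq (Eventually.of_forall fun x => ?_)
  dsimp only
  rw [← mul_assoc, ← Real.exp_add]
  simp

variable (m w v)

/-- The identification of the pre-cotangent modules, as a linear equivalence. -/
def preCotangentTransfer : PreCotangent m ≃ₗ[ℝ] PreCotangent (conformalMeasure w v m) where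
  toFun e := (⟨fun y => sobolevTransfer m w v (e.val ((toConformal w).symm y)),
    e.isStep.comp_toConformal_symm.comp (sobolevTransfer m w v),
    (memLp_weakGrad_step_iff e.isStep).2 e.memLp_pnorm⟩ :
      preCotangentSubmodule (conformalMeasure w v m))
  invFun e := (⟨fun x => (sobolevTransfer m w v).symm (e.val (toConformal w x)),
    e.isStep.comp_toConformal.comp (sobolevTransfer m w v).symm,
    (memLp_weakGrad_step_iff (w := w) (v := v)
      (e.isStep.comp_toConformal.comp (sobolevTransfer m w v).symm)).1 e.memLp_pnorm⟩ :
      preCotangentSubmodule m)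
  map_add' _ _ := rfl
  map_smul' _ _ := rfl
  left_inv _ := rfl
  right_inv _ := rfl

variable {m w v}

theorem pnorm_preCotangentTransfer (e : PreCotangent m) :
    ∀ᵐ x ∂m, (preCotangentTransfer m w v e).pnorm (toConformal w x) =
      Real.exp (-w x) * e.pnorm x :=
  weakGrad_sobolevTransfer_step e.isStep

/-- With its reverse below, this makes the map on families bicontinuous, so that it and its inverse
extend to the completions. It is not an isometry. -/
theorem norm_preCotangentTransfer_le (e : PreCotangent m) :
    ‖preCotangentTransfer m w v e‖ ≤
      (ENNReal.ofReal (Real.exp ‖v‖) ^ (1 / 2 : ℝ≥0∞).toReal *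
        ENNReal.ofReal (Real.exp ‖-w‖)).toReal * ‖e‖ := by
  rw [PreCotangent.norm_def, PreCotangent.norm_def, ← ENNReal.toReal_mul]
  have hC := lpTransfer_const_ne_top v 2
  refine ENNReal.toReal_mono (ENNReal.mul_ne_top (ENNReal.mul_ne_top hC ENNReal.ofReal_ne_top)
    e.memLp_pnorm.2.ne) ?_
  rw [eLpNorm_congr_ae (g := (fun x => Real.exp ((-w) x) * e.pnorm x) ∘ (toConformal w).symm)
    (ae_conformalMeasure_iff.2 (pnorm_preCotangentTransfer e)), mul_assoc]
  exact (eLpNorm_conformalMeasure_le w v m _ 2).trans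
    (mul_le_mul_right (eLpNorm_exp_mul_le _ 2 (-w)) _)

theorem norm_le_norm_preCotangentTransfer (e : PreCotangent m) :
    ‖e‖ ≤ (ENNReal.ofReal (Real.exp ‖w‖) *
      ENNReal.ofReal (Real.exp ‖v‖) ^ (1 / 2 : ℝ≥0∞).toReal).toReal *
        ‖preCotangentTransfer m w v e‖ := by
  rw [PreCotangent.norm_def, PreCotangent.norm_def, ← ENNReal.toReal_mul]
  have hC := lpTransfer_const_ne_top v 2
  refine ENNReal.toReal_mono (ENNReal.mul_ne_top (ENNReal.mul_ne_top ENNReal.ofReal_ne_top hC)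
    (preCotangentTransfer m w v e).memLp_pnorm.2.ne) ?_
  have e1 : e.pnorm =ᵐ[m] fun x => Real.exp (w x) *
      ((preCotangentTransfer m w v e).pnorm ∘ toConformal w) x := by
    filter_upwards [pnorm_preCotangentTransfer (w := w) (v := v) e] with x hx
    rw [Function.comp, hx, ← mul_assoc, ← Real.exp_add]
    simp
  rw [eLpNorm_congr_ae e1, mul_assoc]
  exact (eLpNorm_exp_mul_le _ 2 w).trans (mul_le_mul_right (eLpNorm_comp_toConformal_le _ 2) _)

variable (m w v)

/-- The identification of the pre-cotangent modules, as a homeomorphism. -/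
def preCotangentTransferL : PreCotangent m ≃L[ℝ] PreCotangent (conformalMeasure w v m) :=
  (preCotangentTransfer m w v).toContinuousLinearEquivOfBounds _ _ norm_preCotangentTransfer_le
    fun e => by
      simpa using norm_le_norm_preCotangentTransfer (w := w) (v := v)
        ((preCotangentTransfer m w v).symm e)

/-- The identification of `L²(T*M)` and `L²(T*M')`. -/
def cotangentTransfer : Cotangent m ≃L[ℝ] Cotangent (conformalMeasure w v m) :=
  ContinuousLinearEquiv.equivOfInverse
    (preCotangentTransferL m w v : PreCotangent m →L[ℝ] _).completion
    ((preCotangentTransferL m w v).symm : PreCotangent (conformalMeasure w v m) →L[ℝ] _).completion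
    (fun ω => by
      induction ω using UniformSpace.Completion.induction_on with
      | hp => exact isClosed_eq (by fun_prop) continuous_id
      | ih e =>
        rw [ContinuousLinearMap.completion_apply_coe, ContinuousLinearMap.completion_apply_coe]
        simp)
    (fun ω => by
      induction ω using UniformSpace.Completion.induction_on with
      | hp => exact isClosed_eq (by fun_prop) continuous_id
      | ih e =>
        rw [ContinuousLinearMap.completion_apply_coe, ContinuousLinearMap.completion_apply_coe]
        simp)

variable {m w v}

theorem cotangentTransfer_coe (e : PreCotangent m) :
    cotangentTransfer m w v (e : Cotangent m) = (preCotangentTransfer m w v e : PreCotangent _) :=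
  ContinuousLinearMap.completion_apply_coe _ e

theorem memLp_top_exp (u : X →ᵇ ℝ) : MemLp (fun x => Real.exp (u x)) ∞ m :=
  memLp_top_of_bound (Real.continuous_exp.comp u.continuous).measurable.aestronglyMeasurable
    (Real.exp ‖u‖) (Eventually.of_forall fun x => by
      rw [Real.norm_of_nonneg (Real.exp_pos _).le]
      exact Real.exp_le_exp.2 (abs_le.1 (u.norm_coe_le_norm x)).2)

/-- `|ω|' = e^{-w} |ω|`. -/
theorem pointwiseNorm_cotangentTransfer (ω : Cotangent m) :
    ∀ᵐ x ∂m, pointwiseNorm (cotangentTransfer m w v ω) (toConformal w x) =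
      Real.exp (-w x) * pointwiseNorm ω x := by
  -- Stated as an equality of two continuous `L²`-valued maps, so that it needs checking on families
  -- only.
  have key : pointwiseNorm (cotangentTransfer m w v ω) =
      lpTransfer m w v 2 (mulLinfty m 2 (memLp_top_exp (m := m) (-w)).toLp (pointwiseNorm ω)) := by
    induction ω using UniformSpace.Completion.induction_on with
    | hp =>
      have h1 := continuous_pointwiseNorm (m := m)
      have h2 : Continuous fun ω : Cotangent m => pointwiseNorm (cotangentTransfer m w v ω) :=
        continuous_pointwiseNorm.comp (cotangentTransfer m w v).continuous
      exact isClosed_eq h2 (by fun_prop)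
    | ih e =>
      refine Lp.ext (ae_conformalMeasure_iff.2 ?_)
      filter_upwards [pnorm_preCotangentTransfer (w := w) (v := v) e, pointwiseNorm_coe_ae e,
        ae_conformalMeasure_iff.1 (pointwiseNorm_coe_ae (preCotangentTransfer m w v e)),
        coeFn_lpTransfer m w v 2
          (mulLinfty m 2 (memLp_top_exp (m := m) (-w)).toLp (pointwiseNorm (e : Cotangent m))),
        coeFn_mulLinfty (memLp_top_exp (m := m) (-w)) (pointwiseNorm (e : Cotangent m))]
        with x h1 h2 h3 h4 h5
      rw [cotangentTransfer_coe, h3, h4, h5, h2]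
      exact h1
  filter_upwards [coeFn_lpTransfer m w v 2
      (mulLinfty m 2 (memLp_top_exp (m := m) (-w)).toLp (pointwiseNorm ω)),
    coeFn_mulLinfty (memLp_top_exp (m := m) (-w)) (pointwiseNorm ω)] with x h1 h2
  rw [key, h1, h2]
  rfl

/-- `⟨ω, η⟩' = e^{-2w} ⟨ω, η⟩`. -/
theorem cotangentInner_cotangentTransfer (ω η : Cotangent m) :
    ∀ᵐ x ∂m, cotangentInner (cotangentTransfer m w v ω) (cotangentTransfer m w v η)
      (toConformal w x) = Real.exp (-2 * w x) * cotangentInner ω η x := by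
  filter_upwards [pointwiseNorm_cotangentTransfer (w := w) (v := v) (ω + η),
    pointwiseNorm_cotangentTransfer (w := w) (v := v) (ω - η)] with x h1 h2
  have e : Real.exp (-2 * w x) = Real.exp (-w x) ^ 2 := by
    rw [← Real.exp_nat_mul]; congr 1; push_cast; ring
  rw [cotangentInner, cotangentInner, ← map_add, ← map_sub, h1, h2, e]
  ring

/-- For step functions acting on families both sides are the same family. Step approximants of `a`
also approximate it uniformly almost everywhere on `M'`, so the multiplication operators converge on
both sides. -/
theorem cotangentTransfer_linftyMul {a : X → ℝ} (ha : MemLp a ∞ m) (ω : Cotangent m) :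
    cotangentTransfer m w v (linftyMul m a ω) =
      linftyMul (conformalMeasure w v m) (a ∘ (toConformal w).symm)
        (cotangentTransfer m w v ω) := by
  obtain ⟨s, hs, ⟨hb, -⟩, h1, h2⟩ := exists_tendsto_linftyMul ha
  have ha' : MemLp (a ∘ (toConformal w).symm) ∞ (conformalMeasure w v m) :=
    memLp_conformalMeasure_iff.2 ha
  have hb' : ∀ n, MemLp (s n ∘ (toConformal w).symm) ∞ (conformalMeasure w v m) := fun n =>
    memLp_conformalMeasure_iff.2 (hb n)
  have hs' : ∀ n, IsStep (s n ∘ (toConformal w).symm) := fun n => (hs n).comp_toConformal_symm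
  have hstep : ∀ n, cotangentTransfer m w v (linftyMul m (s n) ω) =
      linftyMul (conformalMeasure w v m) (s n ∘ (toConformal w).symm)
        (cotangentTransfer m w v ω) := by
    intro n
    induction ω using UniformSpace.Completion.induction_on with
    | hp => exact isClosed_eq (by fun_prop) (by fun_prop)
    | ih e =>
      rw [linftyMul_coe (hs n) (hb n), cotangentTransfer_coe, cotangentTransfer_coe,
        linftyMul_coe (hs' n) (hb' n)]
      rfl
  have h3 : Tendsto (fun n => linftyMul (conformalMeasure w v m) (s n ∘ (toConformal w).symm))
      atTop (𝓝 (linftyMul (conformalMeasure w v m) (a ∘ (toConformal w).symm))) := by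
    rw [tendsto_iff_norm_sub_tendsto_zero]
    have h4 : Tendsto (fun n => (eLpNorm (s n - a) ∞ m).toReal) atTop (𝓝 0) :=
      (ENNReal.tendsto_toReal ENNReal.zero_ne_top).comp h1
    refine squeeze_zero (fun n => norm_nonneg _) (fun n => ?_) h4
    rw [linftyMul_of_isStep (hs' n) (hb' n)]
    refine (linftyMul_spec ha' (hs' n) (hb' n)).trans ?_
    refine ENNReal.toReal_mono ((hb n).sub ha).2.ne ?_
    -- For the exponent `∞` the comparison constant has exponent `0` and equals 1.
    refine (eLpNorm_conformalMeasure_le w v m (s n - a) ∞).trans (le_of_eq ?_)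
    simp
  have t1 : Tendsto (fun n => cotangentTransfer m w v (linftyMul m (s n) ω)) atTop
      (𝓝 (cotangentTransfer m w v (linftyMul m a ω))) :=
    ((cotangentTransfer m w v).continuous.tendsto _).comp
      (((ContinuousLinearMap.apply ℝ _ ω).continuous.tendsto _).comp h2)
  have t2 : Tendsto (fun n => linftyMul (conformalMeasure w v m) (s n ∘ (toConformal w).symm)
      (cotangentTransfer m w v ω)) atTop (𝓝 (linftyMul (conformalMeasure w v m)
        (a ∘ (toConformal w).symm) (cotangentTransfer m w v ω))) :=
    ((ContinuousLinearMap.apply ℝ _ (cotangentTransfer m w v ω)).continuous.tendsto _).comp h3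
  exact tendsto_nhds_unique t1 (t2.congr fun n => (hstep n).symm)

theorem isCotangentIdentification_cotangentTransfer :
    IsCotangentIdentification m w v (cotangentTransfer m w v) where
  -- A constant family is sent to the constant family of the same function, definitionally.
  map_differential _ _ _ := cotangentTransfer_coe _
  map_mul _ ha ω := cotangentTransfer_linftyMul ha ω

end Transfer

/-! ### Uniqueness of the cotangent identification -/

section Uniqueness

variable {X : Type*} [MetricSpace X] [MeasurableSpace X] [BorelSpace X]

theorem isStep_indicator_one {B : Set X} (hB : MeasurableSet B) :
    IsStep (B.indicator fun _ => (1 : ℝ)) := by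
  classical
  refine ⟨((countable_singleton (0 : ℝ)).insert 1).mono ?_, fun a =>
    (measurable_const.indicator hB) (measurableSet_singleton a)⟩
  rintro _ ⟨x, rfl⟩
  by_cases hx : x ∈ B <;> simp [hx]

theorem memLp_top_indicator_one {m : Measure X} {B : Set X} (hB : MeasurableSet B) :
    MemLp (B.indicator fun _ => (1 : ℝ)) ∞ m :=
  memLp_top_of_bound (measurable_const.indicator hB).aestronglyMeasurable 1
    (Eventually.of_forall fun x => by by_cases hx : x ∈ B <;> simp [hx])

/-- A family `{(B_i, f_i)}` agrees on `B_i` with `df_i`. -/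
theorem linftyMul_indicator_coe {m : Measure X} (e : PreCotangent m) (f : sobolevSpace m) :
    linftyMul m ((e.val ⁻¹' {f}).indicator fun _ => (1 : ℝ)) (e : Cotangent m) =
      linftyMul m ((e.val ⁻¹' {f}).indicator fun _ => (1 : ℝ)) (differential m f) := by
  have hB := e.isStep.2 f
  rw [differential, linftyMul_coe (isStep_indicator_one hB) (memLp_top_indicator_one hB),
    linftyMul_coe (isStep_indicator_one hB) (memLp_top_indicator_one hB)]
  congr 1
  refine Subtype.ext (funext fun x => ?_)
  change (e.val ⁻¹' {f}).indicator (fun _ => (1 : ℝ)) x • e.val x =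
    (e.val ⁻¹' {f}).indicator (fun _ => (1 : ℝ)) x • f
  by_cases hx : x ∈ e.val ⁻¹' {f}
  · have hx' : e.val x = f := hx
    rw [hx']
  · simp [hx]

/-- The product `⟨ω, χ_B ω⟩` equals `|ω|²` on `B` and vanishes by assumption. -/
theorem pointwiseNorm_eq_zero_of_linftyMul_indicator {m : Measure X}
    (hH : InfinitesimallyHilbertian m) {B : Set X} (hB : MeasurableSet B) {ω : Cotangent m}
    (h : linftyMul m (B.indicator fun _ => (1 : ℝ)) ω = 0) :
    ∀ᵐ x ∂m, x ∈ B → pointwiseNorm ω x = 0 := by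
  have h0 : ∀ᵐ x ∂m, cotangentInner ω (0 : Cotangent m) x = 0 :=
    Eventually.of_forall fun x => by simp [cotangentInner]
  have h1 := cotangentInner_linftyMul_right hH (memLp_top_indicator_one (m := m) hB) ω ω
  rw [h] at h1
  filter_upwards [h0, h1, cotangentInner_self hH ω] with x k0 k1 k2 hx
  rw [k0, indicator_of_mem hx, one_mul, k2] at k1
  exact pow_eq_zero_iff two_ne_zero |>.1 k1.symm

variable [GeodesicSpace X] {m : Measure X} {w v : X →ᵇ ℝ}

/-- On each piece of a family the image is forced: multiplication by the indicator of the piece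
turns the family into a differential, whose image is prescribed. The pieces are countably many, and
families are dense. -/
theorem IsCotangentIdentification.unique (hH : InfinitesimallyHilbertian m)
    {ι ι' : Cotangent m ≃L[ℝ] Cotangent (conformalMeasure w v m)}
    (h : IsCotangentIdentification m w v ι) (h' : IsCotangentIdentification m w v ι') : ι = ι' := by
  have hH' := hH.conformalMeasure w v
  refine ContinuousLinearEquiv.ext (funext fun ω => ?_)
  induction ω using UniformSpace.Completion.induction_on with
  | hp => exact isClosed_eq ι.continuous ι'.continuous
  | ih e =>
    refine sub_eq_zero.1 (eq_zero_of_pointwiseNorm_eq_zero ?_)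
    have hpart : ∀ f ∈ range e.val, ∀ᵐ y ∂conformalMeasure w v m,
        y ∈ (toConformal w).symm ⁻¹' (e.val ⁻¹' {f}) →
        pointwiseNorm (ι (e : Cotangent m) - ι' (e : Cotangent m)) y = 0 := by
      intro f _
      have hB := e.isStep.2 f
      have hB' : MeasurableSet ((toConformal w).symm ⁻¹' (e.val ⁻¹' {f})) :=
        measurable_toConformal_symm w hB
      have hmul := memLp_top_indicator_one (m := m) hB
      have hf' : (f : X → ℝ) ∘ (toConformal w).symm ∈ sobolevSpace (conformalMeasure w v m) :=
        memSobolev_conformalMeasure_iff.2 f.2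
      refine pointwiseNorm_eq_zero_of_linftyMul_indicator hH' hB' ?_
      -- The right side does not involve `κ`, so any two identifications agree after multiplication
      -- by this indicator.
      have key : ∀ {κ : Cotangent m ≃L[ℝ] Cotangent (conformalMeasure w v m)},
          IsCotangentIdentification m w v κ →
          linftyMul (conformalMeasure w v m)
            (((toConformal w).symm ⁻¹' (e.val ⁻¹' {f})).indicator fun _ => (1 : ℝ))
            (κ (e : Cotangent m)) =
          linftyMul (conformalMeasure w v m)
            (((toConformal w).symm ⁻¹' (e.val ⁻¹' {f})).indicator fun _ => (1 : ℝ))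
            (differential (conformalMeasure w v m) ⟨_, hf'⟩) := by
        intro κ hκ
        have e1 : ((toConformal w).symm ⁻¹' (e.val ⁻¹' {f})).indicator (fun _ => (1 : ℝ)) =
          ((e.val ⁻¹' {f}).indicator fun _ => (1 : ℝ)) ∘ (toConformal w).symm := rfl
        rw [e1, ← hκ.map_mul _ hmul, linftyMul_indicator_coe, hκ.map_mul _ hmul,
          ← hκ.map_differential f f.2 hf']
      rw [map_sub, key h, key h', sub_self]
    filter_upwards [(ae_ball_iff e.isStep.1).2 hpart] with y hy
    exact hy _ (mem_range_self ((toConformal w).symm y)) rfl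

theorem IsCotangentIdentification.eq_cotangentTransfer (hH : InfinitesimallyHilbertian m)
    {ι : Cotangent m ≃L[ℝ] Cotangent (conformalMeasure w v m)}
    (h : IsCotangentIdentification m w v ι) : ι = cotangentTransfer m w v :=
  h.unique hH isCotangentIdentification_cotangentTransfer

end Uniqueness

/-! ### Tangent modules, gradients and inner products -/

section TangentTransfer

variable {X : Type*} [MetricSpace X] [MeasurableSpace X] [BorelSpace X] [GeodesicSpace X]
  {m : Measure X} {w v : X →ᵇ ℝ}

/-- Transport of a map `L²(T*M) → L¹(m)` along the identifications. -/
def tangentTransferAmbient (ι : Cotangent m ≃L[ℝ] Cotangent (conformalMeasure w v m)) :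
    (Cotangent m →L[ℝ] Lp ℝ 1 m) ≃L[ℝ]
      (Cotangent (conformalMeasure w v m) →L[ℝ] Lp ℝ 1 (conformalMeasure w v m)) :=
  ι.arrowCongr (lpTransfer m w v 1)

theorem tangentTransferAmbient_apply (ι : Cotangent m ≃L[ℝ] Cotangent (conformalMeasure w v m))
    (V : Cotangent m →L[ℝ] Lp ℝ 1 m) (ω : Cotangent m) :
    ∀ᵐ x ∂m, tangentTransferAmbient ι V (ι ω) (toConformal w x) = V ω x := by
  have e : tangentTransferAmbient ι V (ι ω) = lpTransfer m w v 1 (V ω) := by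
    simp [tangentTransferAmbient]
  rw [e]
  exact coeFn_lpTransfer m w v 1 (V ω)

/-- Since `ι` commutes with multiplication by `L^∞` functions, linearity over `L^∞` for a map and
for its transport are the same condition. -/
theorem tangentTransferAmbient_mem_iff
    {ι : Cotangent m ≃L[ℝ] Cotangent (conformalMeasure w v m)}
    (hι : IsCotangentIdentification m w v ι) (V : Cotangent m →L[ℝ] Lp ℝ 1 m) :
    tangentTransferAmbient ι V ∈ Tangent (conformalMeasure w v m) ↔ V ∈ Tangent m := by
  constructor
  · intro h a ha ω
    filter_upwards [ae_conformalMeasure_iff.1 (h (a ∘ (toConformal w).symm)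
        (memLp_conformalMeasure_iff.2 ha) (ι ω)),
      tangentTransferAmbient_apply ι V (linftyMul m a ω), tangentTransferAmbient_apply ι V ω]
      with x h1 h2 h3
    rw [← hι.map_mul a ha, h2, h3] at h1
    exact h1
  · intro h a ha ω'
    obtain ⟨ω, rfl⟩ := ι.surjective ω'
    have ha' : MemLp (a ∘ toConformal w) ∞ m := ha.comp_toConformal
    have e : ι (linftyMul m (a ∘ toConformal w) ω) =
      linftyMul (conformalMeasure w v m) a (ι ω) := hι.map_mul _ ha' ω
    refine ae_conformalMeasure_iff.2 ?_
    filter_upwards [h _ ha' ω,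
      tangentTransferAmbient_apply ι V (linftyMul m (a ∘ toConformal w) ω),
      tangentTransferAmbient_apply ι V ω] with x h1 h2 h3
    rw [← e, h2, h3, h1]
    rfl

/-- The identification of `L²(TM)` and `L²(TM')`. -/
def tangentTransfer {ι : Cotangent m ≃L[ℝ] Cotangent (conformalMeasure w v m)}
    (hι : IsCotangentIdentification m w v ι) : Tangent m ≃L[ℝ] Tangent (conformalMeasure w v m) :=
  (tangentTransferAmbient ι).ofSubmodules _ _ (by
    ext V'
    constructor
    · rintro ⟨V, hV, rfl⟩
      exact (tangentTransferAmbient_mem_iff hι V).2 hV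
    · intro hV'
      obtain ⟨V, rfl⟩ := (tangentTransferAmbient ι).surjective V'
      exact ⟨V, (tangentTransferAmbient_mem_iff hι V).1 hV', rfl⟩)

theorem isTangentIdentification_tangentTransfer
    {ι : Cotangent m ≃L[ℝ] Cotangent (conformalMeasure w v m)}
    (hι : IsCotangentIdentification m w v ι) :
    IsTangentIdentification m w v ι (tangentTransfer hι) := fun V ω =>
  tangentTransferAmbient_apply ι V ω

/-- Surjectivity of `ι` makes the defining relation determine the image of `V` on every covector of
`M'`. -/
theorem IsTangentIdentification.unique
    {ι : Cotangent m ≃L[ℝ] Cotangent (conformalMeasure w v m)}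
    {J J' : Tangent m ≃L[ℝ] Tangent (conformalMeasure w v m)}
    (h : IsTangentIdentification m w v ι J) (h' : IsTangentIdentification m w v ι J') : J = J' := by
  refine ContinuousLinearEquiv.ext (funext fun V =>
    Subtype.ext (ContinuousLinearMap.ext fun ω' => ?_))
  obtain ⟨ω, rfl⟩ := ι.surjective ω'
  refine Lp.ext (ae_conformalMeasure_iff.2 ?_)
  filter_upwards [h V ω, h' V ω] with x h1 h2
  rw [h1, h2]

/-- If `V` is dual to `ω`, then the image of `V` is dual to the image of `e^{2w} ω`. -/
theorem IsRieszDual.tangentIdentification (hH : InfinitesimallyHilbertian m)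
    {J : Tangent m ≃L[ℝ] Tangent (conformalMeasure w v m)}
    (hJ : IsTangentIdentification m w v (cotangentTransfer m w v) J) {ω : Cotangent m}
    {V : Tangent m} (h : IsRieszDual ω V) {a : X → ℝ} (ha : MemLp a ∞ m)
    (haw : ∀ x, Real.exp (-2 * w x) * a x = 1) :
    IsRieszDual (cotangentTransfer m w v (linftyMul m a ω)) (J V) := by
  intro η'
  obtain ⟨η, rfl⟩ := (cotangentTransfer m w v).surjective η'
  refine ae_conformalMeasure_iff.2 ?_
  filter_upwards [hJ V η, h η, cotangentInner_linftyMul_left hH ha ω η,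
    cotangentInner_cotangentTransfer (w := w) (v := v) (linftyMul m a ω) η] with x h1 h2 h3 h4
  rw [h1, h2, h4, h3, ← mul_assoc, haw, one_mul]

/-- Evaluated on the image of `η`, the transported field `e^{-2w} ∇f` gives `e^{-2w} ⟨df, η⟩`, which
is the product on `M'` of `d'f` with that image. Uniqueness of the Riesz dual concludes. -/
theorem tangentGradient_conformalMeasure (hH : InfinitesimallyHilbertian m)
    {J : Tangent m ≃L[ℝ] Tangent (conformalMeasure w v m)}
    (hJ : IsTangentIdentification m w v (cotangentTransfer m w v) J) (f : X → ℝ)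
    (hf : f ∈ sobolevSpace m)
    (hf' : f ∘ (toConformal w).symm ∈ sobolevSpace (conformalMeasure w v m)) :
    tangentGradient (conformalMeasure w v m) ⟨_, hf'⟩ =
      J (tangentMul (fun x => Real.exp (-2 * w x)) (tangentGradient m ⟨f, hf⟩)) := by
  have hmem : MemLp (fun x => Real.exp (-2 * w x)) ∞ m := by
    simpa using memLp_top_exp (m := m) ((-2 : ℝ) • w)
  refine (isRieszDual_sharp (hH.conformalMeasure w v) _).tangent_unique fun η' => ?_
  obtain ⟨η, rfl⟩ := (cotangentTransfer m w v).surjective η'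
  have hd : cotangentTransfer m w v (differential m ⟨f, hf⟩) =
      differential (conformalMeasure w v m) ⟨_, hf'⟩ :=
    isCotangentIdentification_cotangentTransfer.map_differential f hf hf'
  refine ae_conformalMeasure_iff.2 ?_
  filter_upwards [hJ (tangentMul (fun x => Real.exp (-2 * w x)) (tangentGradient m ⟨f, hf⟩)) η,
    (tangentGradient m ⟨f, hf⟩).2 _ hmem η,
    isRieszDual_sharp hH (differential m ⟨f, hf⟩) η,
    cotangentInner_cotangentTransfer (w := w) (v := v) (differential m ⟨f, hf⟩) η] with x h1 h2 h3 h4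
  rw [h1, ← hd, h4, ← h3]
  exact h2

/-- The dual covectors of both fields are multiplied by `e^{2w}` before being carried over, and the
cotangent product on `M'` contributes `e^{-2w}`. -/
theorem tangentInner_conformalMeasure (hH : InfinitesimallyHilbertian m)
    {J : Tangent m ≃L[ℝ] Tangent (conformalMeasure w v m)}
    (hJ : IsTangentIdentification m w v (cotangentTransfer m w v) J) (V W : Tangent m) :
    ∀ᵐ x ∂m, tangentInner (J V) (J W) (toConformal w x) =
      Real.exp (2 * w x) * tangentInner V W x := by
  have hmem : MemLp (fun x => Real.exp (2 * w x)) ∞ m := by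
    simpa using memLp_top_exp (m := m) ((2 : ℝ) • w)
  have hinv : ∀ x, Real.exp (-2 * w x) * Real.exp (2 * w x) = 1 := fun x => by
    rw [← Real.exp_add]; simp
  have hH' := hH.conformalMeasure w v
  have hflat : ∀ V : Tangent m, flat (J V) =
      cotangentTransfer m w v (linftyMul m (fun x => Real.exp (2 * w x)) (flat V)) := fun V =>
    (isRieszDual_flat hH' (J V)).cotangent_unique hH'
      ((isRieszDual_flat hH V).tangentIdentification hH hJ hmem hinv)
  filter_upwards [cotangentInner_cotangentTransfer (w := w) (v := v)
      (linftyMul m (fun x => Real.exp (2 * w x)) (flat V))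
      (linftyMul m (fun x => Real.exp (2 * w x)) (flat W)),
    cotangentInner_linftyMul_left hH hmem (flat V)
      (linftyMul m (fun x => Real.exp (2 * w x)) (flat W)),
    cotangentInner_linftyMul_right hH hmem (flat V) (flat W)] with x h1 h2 h3
  rw [tangentInner, tangentInner, hflat, hflat, h1, h2, h3, ← mul_assoc, hinv, one_mul]

end TangentTransfer

end

theorem proposition3p5 {X : Type*} [MetricSpace X] [MeasurableSpace X] [BorelSpace X]
    [GeodesicSpace X] (m : Measure X) (hm : IsAdmissibleMeasure m)
    (hH : InfinitesimallyHilbertian m) (w v : X →ᵇ ℝ) :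
    -- `W^{1,2}(M) = W^{1,2}(M')`, `M'` is infinitesimally Hilbertian, and the Riesz correspondence,
    -- through which gradients and inner products on tangent modules are defined, holds on both
    (∀ f : X → ℝ, f ∈ sobolevSpace m ↔
      f ∘ (toConformal w).symm ∈ sobolevSpace (conformalMeasure w v m)) ∧
    InfinitesimallyHilbertian (conformalMeasure w v m) ∧
    RieszCorrespondence m ∧ RieszCorrespondence (conformalMeasure w v m) ∧
    -- the cotangent modules and the tangent modules are canonically identified
    (∃! ι : Cotangent m ≃L[ℝ] Cotangent (conformalMeasure w v m),
      IsCotangentIdentification m w v ι) ∧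
    ∀ ι : Cotangent m ≃L[ℝ] Cotangent (conformalMeasure w v m),
      IsCotangentIdentification m w v ι →
      (∃! J : Tangent m ≃L[ℝ] Tangent (conformalMeasure w v m),
        IsTangentIdentification m w v ι J) ∧
      ∀ J : Tangent m ≃L[ℝ] Tangent (conformalMeasure w v m),
        IsTangentIdentification m w v ι J →
        -- `∇'f = e^{-2w} ∇f`
        (∀ (f : X → ℝ) (hf : f ∈ sobolevSpace m)
          (hf' : f ∘ (toConformal w).symm ∈ sobolevSpace (conformalMeasure w v m)),
          tangentGradient (conformalMeasure w v m) ⟨_, hf'⟩ =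
            J (tangentMul (fun x => Real.exp (-2 * w x)) (tangentGradient m ⟨f, hf⟩))) ∧
        -- `⟨V, W⟩_{M'} = e^{2w} ⟨V, W⟩`
        ∀ V W : Tangent m, ∀ᵐ x ∂m,
          tangentInner (J V) (J W) (toConformal w x) = Real.exp (2 * w x) * tangentInner V W x := by
  refine ⟨fun f => memSobolev_conformalMeasure_iff.symm, hH.conformalMeasure w v,
    hH.rieszCorrespondence, (hH.conformalMeasure w v).rieszCorrespondence,
    ⟨cotangentTransfer m w v, isCotangentIdentification_cotangentTransfer,
      fun ι hι => hι.eq_cotangentTransfer hH⟩, fun ι hι => ⟨⟨tangentTransfer hι,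
      isTangentIdentification_tangentTransfer hι,
      fun J hJ => hJ.unique (isTangentIdentification_tangentTransfer hι)⟩, fun J hJ => ?_⟩⟩
  -- By uniqueness an arbitrary identification is the explicit one, for which the scaling of the
  -- inner product is known.
  obtain rfl := hι.eq_cotangentTransfer hH
  exact ⟨fun f hf hf' => tangentGradient_conformalMeasure hH hJ f hf hf',
    fun V W => tangentInner_conformalMeasure hH hJ V W⟩
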